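/- Write $X=(x,y)\in\mathbb{R}^n\times\mathbb{R}=\mathbb{R}^{n+1}$, let $B_1$ be the open unit ball of $\mathbb{R}^{n+1}$ and $\Sigma=\{y=0\}$. For $b>-1$ let $H^{1,b}(B_1)$ be the closure of $C^\infty(\overline{B_1})$ under the norm $$\|u\|_{H^{1,b}(B_1)}^2=\int_{B_1}|y|^b u^2\,dX+\int_{B_1}|y|^b|\nabla u|^2\,dX .$$ A function $u\in H^{1,b}(B_1)$ is called $L_b$-harmonic in $B_1$, where $L_b=\operatorname{div}(|y|^b\nabla)$, if $$\int_{B_1}|y|^b\langle\nabla u,\nabla\varphi\rangle\,dX=0\qquad\text{for every }\varphi\in C_c^\infty(B_1).$$ It is called symmetric if $u(x,-y)=u(x,y)$, and antisymmetric if $u(x,-y)=-u(x,y)$, in $B_1$. As usual, elements of $H^{1,b}(B_1)$ are identified when they agree almost everywhere, and identities between them are understood almost everywhere. Let $a\in(-1,1)$. (1) If $u$ is $L_a$-harmonic in $B_1$ and antisymmetric, then there exists a unique symmetric function $v\in H^{1,2-a}(B_1)$ that is $L_{2-a}$-harmonic in $B_1$ and satisfies $$u(x,y)=v(x,y)\,y|y|^{-a}\quad\text{in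 }B_1 .$$ (2) If $u$ is $L_a$-harmonic in $B_1$, then there exist unique symmetric functions $u_e^a\in H^{1,a}(B_1)$ and $u_e^{2-a}\in H^{1,2-a}(B_1)$, respectively $L_a$-harmonic and $L_{2-a}$-harmonic in $B_1$, such that $$u(X)=u_e^a(X)+u_e^{2-a}(X)\,y|y|^{-a}\quad\text{in }B_1 ;$$ moreover $u_e^a$ and $u_e^{2-a}$ are of class $C^\infty$ in $B_1$ (that is, have $C^\infty$ representatives). -/

import Mathlib

open MeasureTheory Filter
open scoped Topology ContDiff

noncomputable section

namespace WeightedHarmonic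

/-- The space `ℝ^{n+1}` of points `X = (x, y)` with `x ∈ ℝ^n`, `y ∈ ℝ`; `y` is the last coordinate. -/
abbrev Pt (n : ℕ) : Type := EuclideanSpace ℝ (Fin (n + 1))

/-- The coordinate `y` of `X = (x, y)`; the characteristic manifold `Σ` is `{y = 0}`. -/
def yCoord {n : ℕ} (X : Pt n) : ℝ := X (Fin.last n)

/-- The reflection `(x, y) ↦ (x, -y)`. -/
def reflectY {n : ℕ} (X : Pt n) : Pt n :=
  WithLp.toLp 2 (Function.update X.ofLp (Fin.last n) (-X (Fin.last n)))

/-- The open unit ball `B_1` of `ℝ^{n+1}`. -/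
def unitBall (n : ℕ) : Set (Pt n) := Metric.ball (0 : Pt n) 1

/-- Lebesgue measure on `B_1`. -/
def ballMeasure (n : ℕ) : Measure (Pt n) := volume.restrict (unitBall n)

/-- The measure `|y|^b dX` on `B_1`. -/
def weightedMeasure (n : ℕ) (b : ℝ) : Measure (Pt n) :=
  (ballMeasure n).withDensity fun X => ENNReal.ofReal (|yCoord X| ^ b)

/-- `u ∈ H^{1,b}(B_1)` with gradient `G`: the pair `(u, G)` is the limit, in
`L²(B_1, |y|^b dX)`, of pairs `(φ_k, ∇φ_k)` with `φ_k ∈ C^∞` up to the boundary of `B_1`.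
So `u` ranges over the closure of the smooth functions under the norm
`(∫ |y|^b u² + ∫ |y|^b |∇u|²)^{1/2}`. -/
def HasSobolevGradient {n : ℕ} (b : ℝ) (u : Pt n → ℝ) (G : Pt n → Pt n) : Prop :=
  MemLp u 2 (weightedMeasure n b) ∧ MemLp G 2 (weightedMeasure n b) ∧
    ∃ φ : ℕ → Pt n → ℝ, (∀ k, ContDiff ℝ ∞ (φ k)) ∧
      Tendsto (fun k => eLpNorm (fun X => φ k X - u X) 2 (weightedMeasure n b)) atTop (𝓝 0) ∧
      Tendsto (fun k => eLpNorm (fun X => gradient (φ k) X - G X) 2 (weightedMeasure n b))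
        atTop (𝓝 0)

/-- `u` is `L_b`-harmonic in `B_1`, `L_b = div(|y|^b ∇)`: `u ∈ H^{1,b}(B_1)` and
`∫_{B_1} |y|^b ⟨∇u, ∇φ⟩ dX = 0` for every `φ ∈ C_c^∞(B_1)`. -/
def IsLHarmonic {n : ℕ} (b : ℝ) (u : Pt n → ℝ) : Prop :=
  ∃ G : Pt n → Pt n, HasSobolevGradient b u G ∧
    ∀ φ : Pt n → ℝ, ContDiff ℝ ∞ φ → HasCompactSupport φ → tsupport φ ⊆ unitBall n →
      ∫ X, |yCoord X| ^ b * inner ℝ (G X) (gradient φ X) ∂(ballMeasure n) = 0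

/-- `u(x, -y) = u(x, y)` for almost every `(x, y) ∈ B_1`. -/
def IsSymmetricInY {n : ℕ} (u : Pt n → ℝ) : Prop :=
  ∀ᵐ X ∂(ballMeasure n), u (reflectY X) = u X

/-- `u(x, -y) = -u(x, y)` for almost every `(x, y) ∈ B_1`. -/
def IsAntisymmetricInY {n : ℕ} (u : Pt n → ℝ) : Prop :=
  ∀ᵐ X ∂(ballMeasure n), u (reflectY X) = -u X

/-- The function `y |y|^{-a}`. -/
def oddPower {n : ℕ} (a : ℝ) (X : Pt n) : ℝ := yCoord X * |yCoord X| ^ (-a)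

end WeightedHarmonic

end

open MeasureTheory Filter
open scoped Topology ContDiff

noncomputable section

namespace WeightedHarmonic

variable {n : ℕ}

/-! ### Reflection, the coordinate `y`, and the weighted measures -/

/-! Three ingredients: division by `y|y|^{-a}`, the even/odd splitting, and a mean value formula
that yields smoothness.

Division. Since `|y|^{2-a} (y|y|^{a-2})² = |y|^a`, multiplication by `y|y|^{a-2}` carries
`L²(|y|^a)` isometrically into `L²(|y|^{2-a})`. For odd `u` put `v = y|y|^{a-2} u`, with gradient
`y|y|^{a-2} ∇u + (a-1)|y|^{a-2} u e_y`. The first term is covered by the isometry. The second is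
Hardy's inequality `‖u/y‖ ≤ C‖∇u‖` in `L²(|y|^a)`, valid because `a < 1` and because the odd parts
of smooth approximants of `u` vanish on `Σ` (`hardy_limit`, `hasSobolevGradient_divOdd`). For the
equation (`weakDivFree_divOddGrad`), the flux `|y|^{2-a}∇v` is `y∇u + (a-1)u e_y`. Testing the
equation of `u` with `φ y|y|^{-a}` gives `∫ y⟨∇u,∇φ⟩ + (1-a)φ ∂_y u = 0`, and the unweighted
integration by parts `∫ u ∂_yφ = -∫ φ ∂_y u` turns this into the equation of `v`.

Splitting. The even and odd parts of a solution are solutions, because reflection preserves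
everything. Uniqueness holds because reflecting the decomposition recovers both parts, and
`y|y|^{-a}` vanishes only on a null set.

Smoothness of even solutions, for every `b > -1` (`exists_contDiffOn_of_isLHarmonic`). On even
functions `|y|^{-b}L_b = Δ + (b/y)∂_y` behaves like a Laplacian in dimension `N = n+1+b`, and
ordinary translations are replaced by generalized (Bessel) ones: the squared distance becomes
`|x-x'|² + y² + y'² - 2yy't`, averaged in `t` against `(1-t²)^{b/2-1}`. That weight is integrable
only for `b > 0`. Integrating by parts once in `t` replaces it, up to the factor `b`, by
`(1-t²)^{b/2}` at the cost of a term in `Φ'`, which is the form used here.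

Generalized translation commutes with the operator (`lap_transl`), so the translate of a profile
`Ψ(l|·|²)` is mapped to `4l` times that of `rΨ'' + (N/2)Ψ'`. The same profile appears when `l^{N/2}
∫ u T_X[Ψ'(l|·|²)] |y|^b` is differentiated in `l`. As `u` is orthogonal to the image of test
functions, these averages do not depend on `l` (`rpow_mul_translConv_eq`). As `l → ∞` they
concentrate at `X` and its reflection and give a nonzero constant times `u(X)` almost everywhere
(`ae_rpow_mul_translConv_eq`). At finite `l` the same expression is smooth in `(l, X)`, because all
dependence on `X` is in the kernel. -/

/-- The coordinate `y` as a continuous linear functional. -/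
def yProj (n : ℕ) : Pt n →L[ℝ] ℝ := EuclideanSpace.proj (Fin.last n)

lemma yProj_apply (X : Pt n) : yProj n X = yCoord X := rfl

lemma continuous_yCoord : Continuous (yCoord : Pt n → ℝ) := (yProj n).continuous

lemma measurable_yCoord : Measurable (yCoord : Pt n → ℝ) := continuous_yCoord.measurable

lemma contDiff_yCoord {k : WithTop ℕ∞} : ContDiff ℝ k (yCoord : Pt n → ℝ) := (yProj n).contDiff

/-- The unit vector in the direction of `y`. -/
def eY (n : ℕ) : Pt n := EuclideanSpace.single (Fin.last n) 1

lemma yCoord_eY : yCoord (eY n) = 1 := by simp [yCoord, eY]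

lemma norm_eY : ‖eY n‖ = 1 := by simp [eY]

lemma inner_eY (X : Pt n) : inner ℝ X (eY n) = yCoord X := by
  simp [eY, yCoord, EuclideanSpace.inner_single_right]

lemma inner_eY_left (X : Pt n) : inner ℝ (eY n) X = yCoord X := by
  rw [real_inner_comm, inner_eY]

lemma abs_yCoord_le (X : Pt n) : |yCoord X| ≤ ‖X‖ := by
  rw [← inner_eY]
  simpa [norm_eY] using abs_real_inner_le_norm X (eY n)

/-- The reflection as a linear isometry. -/
def reflectEquiv (n : ℕ) : Pt n ≃ₗᵢ[ℝ] Pt n :=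
  LinearIsometryEquiv.piLpCongrRight 2
    (fun i => if i = Fin.last n then LinearIsometryEquiv.neg ℝ else LinearIsometryEquiv.refl ℝ ℝ)

lemma reflectEquiv_apply (X : Pt n) : reflectEquiv n X = reflectY X := by
  ext i
  by_cases h : i = Fin.last n
  · subst h; simp [reflectEquiv, reflectY]
  · simp [reflectEquiv, reflectY, h]

lemma coe_reflectEquiv : (reflectEquiv n : Pt n → Pt n) = reflectY := funext reflectEquiv_apply

@[simp] lemma yCoord_reflectY (X : Pt n) : yCoord (reflectY X) = -yCoord X := by
  simp [yCoord, reflectY]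

@[simp] lemma reflectY_reflectY (X : Pt n) : reflectY (reflectY X) = X := by
  ext i
  by_cases h : i = Fin.last n
  · subst h; simp [reflectY]
  · simp [reflectY]

@[simp] lemma norm_reflectY (X : Pt n) : ‖reflectY X‖ = ‖X‖ := by
  rw [← reflectEquiv_apply, LinearIsometryEquiv.norm_map]

lemma reflectY_sub (X Y : Pt n) : reflectY (X - Y) = reflectY X - reflectY Y := by
  simp only [← reflectEquiv_apply, map_sub]

lemma reflectY_eq_sub (X : Pt n) : reflectY X = X - (2 * yCoord X) • eY n := by
  ext i
  by_cases h : i = Fin.last n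
  · subst h; simp [reflectY, eY, yCoord]; ring
  · simp [reflectY, h, eY]

lemma inner_reflectY (X Y : Pt n) : inner ℝ (reflectY X) (reflectY Y) = inner ℝ X Y := by
  simp only [← reflectEquiv_apply, LinearIsometryEquiv.inner_map_map]

lemma inner_reflectY_right (X Y : Pt n) : inner ℝ X (reflectY Y) = inner ℝ (reflectY X) Y := by
  rw [← inner_reflectY X, reflectY_reflectY]

lemma contDiff_reflectY {k : WithTop ℕ∞} : ContDiff ℝ k (reflectY : Pt n → Pt n) := by
  rw [← coe_reflectEquiv]; exact (reflectEquiv n).contDiff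

lemma measurable_reflectY : Measurable (reflectY : Pt n → Pt n) :=
  (contDiff_reflectY (k := 0)).continuous.measurable

lemma mem_unitBall {X : Pt n} : X ∈ unitBall n ↔ ‖X‖ < 1 := by simp [unitBall]

lemma measurableSet_unitBall : MeasurableSet (unitBall n) := Metric.isOpen_ball.measurableSet

lemma reflectY_mem_unitBall {X : Pt n} : reflectY X ∈ unitBall n ↔ X ∈ unitBall n := by
  simp [mem_unitBall]

lemma measurePreserving_reflectY_volume : MeasurePreserving (reflectY : Pt n → Pt n) := by
  rw [← coe_reflectEquiv]; exact (reflectEquiv n).measurePreserving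

lemma measurePreserving_reflectY_ball :
    MeasurePreserving (reflectY : Pt n → Pt n) (ballMeasure n) (ballMeasure n) := by
  have := measurePreserving_reflectY_volume.restrict_preimage (measurableSet_unitBall (n := n))
  have h : (reflectY : Pt n → Pt n) ⁻¹' unitBall n = unitBall n := by
    ext X; exact reflectY_mem_unitBall
  rwa [h] at this

lemma measurable_weight (b : ℝ) : Measurable fun X : Pt n => ENNReal.ofReal (|yCoord X| ^ b) :=
  ((measurable_yCoord.abs).pow_const b).ennreal_ofReal

lemma lintegral_weighted (b : ℝ) {f : Pt n → ENNReal} (hf : AEMeasurable f (ballMeasure n)) :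
    ∫⁻ X, f X ∂(weightedMeasure n b)
      = ∫⁻ X, ENNReal.ofReal (|yCoord X| ^ b) * f X ∂(ballMeasure n) := by
  rw [weightedMeasure, lintegral_withDensity_eq_lintegral_mul₀ (measurable_weight b).aemeasurable hf]
  rfl

lemma integral_weighted (b : ℝ) {E : Type*} [NormedAddCommGroup E] [NormedSpace ℝ E]
    (f : Pt n → E) :
    ∫ X, f X ∂(weightedMeasure n b) = ∫ X, |yCoord X| ^ b • f X ∂(ballMeasure n) := by
  rw [weightedMeasure, integral_withDensity_eq_integral_toReal_smul (measurable_weight b)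
    (by simp)]
  refine integral_congr_ae (Eventually.of_forall fun X => ?_)
  simp only
  rw [ENNReal.toReal_ofReal (by positivity)]

lemma measurePreserving_reflectY_weighted (b : ℝ) :
    MeasurePreserving (reflectY : Pt n → Pt n) (weightedMeasure n b) (weightedMeasure n b) := by
  refine ⟨measurable_reflectY, ?_⟩
  ext s hs
  rw [Measure.map_apply measurable_reflectY hs, weightedMeasure,
    withDensity_apply _ hs, withDensity_apply _ (measurable_reflectY hs),
    ← (measurePreserving_reflectY_ball (n := n)).setLIntegral_comp_preimage hs (measurable_weight b)]
  simp

lemma volume_yCoord_eq_zero : volume {X : Pt n | yCoord X = 0} = 0 := by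
  have h := Measure.addHaar_submodule (volume : Measure (Pt n)) (LinearMap.ker (yProj n).toLinearMap)
    (fun h => by
      have : eY n ∈ LinearMap.ker (yProj n).toLinearMap := h ▸ Submodule.mem_top
      have h2 : yCoord (eY n) = 0 := this
      rw [yCoord_eY] at h2
      exact one_ne_zero h2)
  exact h

lemma ae_yCoord_ne_zero : ∀ᵐ X ∂(ballMeasure n), yCoord X ≠ 0 := by
  refine ae_restrict_of_ae ?_
  rw [ae_iff]; simpa using volume_yCoord_eq_zero (n := n)

lemma ae_mem_unitBall : ∀ᵐ X ∂(ballMeasure n), X ∈ unitBall n :=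
  ae_restrict_mem measurableSet_unitBall

/-- The weight is positive off the null set `Σ`, so null sets do not depend on the exponent `b`.
This permits passing freely between the exponents `a`, `2 - a` and `0`. -/
lemma ae_weighted_iff (b : ℝ) {p : Pt n → Prop} :
    (∀ᵐ X ∂(weightedMeasure n b), p X) ↔ ∀ᵐ X ∂(ballMeasure n), p X := by
  rw [weightedMeasure, ae_withDensity_iff (measurable_weight b)]
  refine eventually_congr ?_
  filter_upwards [ae_yCoord_ne_zero] with X hX
  have : ENNReal.ofReal (|yCoord X| ^ b) ≠ 0 := by
    simp only [ne_eq, ENNReal.ofReal_eq_zero, not_le]; positivity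
  simp [this]

lemma weightedMeasure_absolutelyContinuous (b : ℝ) : weightedMeasure n b ≪ ballMeasure n :=
  withDensity_absolutelyContinuous _ _

lemma ballMeasure_absolutelyContinuous (b : ℝ) : ballMeasure n ≪ weightedMeasure n b := by
  intro s hs
  have : ∀ᵐ X ∂(weightedMeasure n b), X ∉ s := by
    rw [ae_iff]; simpa using hs
  rw [ae_weighted_iff, ae_iff] at this
  simpa using this

lemma aestronglyMeasurable_weighted_iff (b : ℝ) {E : Type*} [TopologicalSpace E]
    {f : Pt n → E} : AEStronglyMeasurable f (weightedMeasure n b) ↔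
      AEStronglyMeasurable f (ballMeasure n) :=
  ⟨fun h => h.mono_ac (ballMeasure_absolutelyContinuous b),
    fun h => h.mono_ac (weightedMeasure_absolutelyContinuous b)⟩

/-- The ball lies in the cube `[-1,1]^{n+1}`, where the function is a product of one-variable
functions. -/
lemma integrable_abs_rpow {c : ℝ} (hc : -1 < c) :
    Integrable (fun X : Pt n => |yCoord X| ^ c) (ballMeasure n) := by
  have h1 : IntegrableOn (fun t : ℝ => |t| ^ c) (Set.Icc (-1) 1) := by
    have h := intervalIntegral.intervalIntegrable_rpow' (a := 0) (b := 1) hc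
    have h0 : IntegrableOn (fun t : ℝ => |t| ^ c) (Set.Ioc 0 1) := by
      have := (intervalIntegrable_iff_integrableOn_Ioc_of_le zero_le_one).1 h
      refine this.congr_fun (fun t ht => ?_) measurableSet_Ioc
      simp only [abs_of_pos ht.1]
    have h2 : IntegrableOn (fun t : ℝ => |t| ^ c) (Set.Ico (-1) 0) := by
      have := (MeasurePreserving.integrableOn_comp_preimage (Measure.measurePreserving_neg
        (volume : Measure ℝ)) (Homeomorph.neg ℝ).measurableEmbedding (s := Set.Ioc 0 1)
        (f := fun t : ℝ => |t| ^ c)).2 h0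
      have e : (Neg.neg : ℝ → ℝ) ⁻¹' Set.Ioc 0 1 = Set.Ico (-1) 0 := by
        ext t; simp only [Set.mem_preimage, Set.mem_Ioc, Set.mem_Ico]
        constructor <;> rintro ⟨h, h'⟩ <;> constructor <;> linarith
      rw [e] at this
      refine this.congr_fun (fun t ht => ?_) measurableSet_Ico
      simp
    have h3 : IntegrableOn (fun t : ℝ => |t| ^ c) {0} := by simp
    refine ((h2.union h3).union h0).mono_set ?_
    intro t ht
    rcases lt_trichotomy t 0 with h | h | h
    · exact Or.inl (Or.inl ⟨ht.1, h⟩)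
    · exact Or.inl (Or.inr h)
    · exact Or.inr ⟨h, ht.2⟩
  have h0 : IntegrableOn (fun _ : ℝ => (1 : ℝ)) (Set.Icc (-1) 1) := by
    simp
  let f : Fin (n + 1) → ℝ → ℝ := fun i =>
    (Set.Icc (-1 : ℝ) 1).indicator (if i = Fin.last n then fun t => |t| ^ c else fun _ => 1)
  have hf : ∀ i, Integrable (f i) := by
    intro i
    by_cases h : i = Fin.last n
    · simp only [f, if_pos h]; exact h1.integrable_indicator measurableSet_Icc
    · simp only [f, if_neg h]; exact h0.integrable_indicator measurableSet_Icc
  have hp := Integrable.fintype_prod hf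
  have hv := (EuclideanSpace.volume_preserving_symm_measurableEquiv_toLp (Fin (n+1)))
  have hp' := (hv.integrable_comp_emb (MeasurableEquiv.measurableEmbedding _)).2 hp
  refine (hp'.integrableOn (s := unitBall n)).congr_fun (fun X hX => ?_) measurableSet_unitBall
  have hX' : ‖X‖ < 1 := mem_unitBall.1 hX
  have hi : ∀ i, X i ∈ Set.Icc (-1 : ℝ) 1 := fun i => by
    have := (PiLp.norm_apply_le X i).trans hX'.le
    exact abs_le.1 this
  simp only [Function.comp, f]
  have : ∀ i, (Set.Icc (-1 : ℝ) 1).indicator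
      (if i = Fin.last n then fun t => |t| ^ c else fun _ => 1) (X i)
      = if i = Fin.last n then |yCoord X| ^ c else 1 := by
    intro i
    rw [Set.indicator_of_mem (hi i)]
    split_ifs with h
    · subst h; rfl
    · rfl
  exact (Finset.prod_congr rfl fun i _ => this i).trans (by simp)

instance isFiniteMeasure_ball : IsFiniteMeasure (ballMeasure n) :=
  ⟨by rw [ballMeasure, Measure.restrict_apply_univ]; exact measure_ball_lt_top⟩

lemma isFiniteMeasure_weighted {b : ℝ} (hb : -1 < b) : IsFiniteMeasure (weightedMeasure n b) :=
  isFiniteMeasure_withDensity_ofReal (integrable_abs_rpow hb).hasFiniteIntegral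

/-! ### Weighted Sobolev functions and weak solutions -/

lemma contDiff_gradient {φ : Pt n → ℝ} (h : ContDiff ℝ ∞ φ) : ContDiff ℝ ∞ (gradient φ) := by
  have : gradient φ = fun X => (InnerProductSpace.toDual ℝ (Pt n)).symm (fderiv ℝ φ X) := rfl
  rw [this]
  exact (InnerProductSpace.toDual ℝ (Pt n)).symm.contDiff.comp
    (h.fderiv_right (m := ∞) (by simp))

lemma continuous_gradient {φ : Pt n → ℝ} (h : ContDiff ℝ ∞ φ) : Continuous (gradient φ) :=
  (contDiff_gradient h).continuous

lemma gradient_add' {φ ψ : Pt n → ℝ} {X : Pt n} (hφ : DifferentiableAt ℝ φ X)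
    (hψ : DifferentiableAt ℝ ψ X) :
    gradient (fun X => φ X + ψ X) X = gradient φ X + gradient ψ X := by
  simp [gradient, fderiv_fun_add hφ hψ]

lemma gradient_sub' {φ ψ : Pt n → ℝ} {X : Pt n} (hφ : DifferentiableAt ℝ φ X)
    (hψ : DifferentiableAt ℝ ψ X) :
    gradient (fun X => φ X - ψ X) X = gradient φ X - gradient ψ X := by
  simp [gradient, fderiv_fun_sub hφ hψ]

lemma gradient_const_mul' {φ : Pt n → ℝ} {X : Pt n} (c : ℝ) (hφ : DifferentiableAt ℝ φ X) :
    gradient (fun X => c * φ X) X = c • gradient φ X := by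
  simp [gradient, fderiv_const_mul hφ c]

lemma gradient_mul' {φ ψ : Pt n → ℝ} {X : Pt n} (hφ : DifferentiableAt ℝ φ X)
    (hψ : DifferentiableAt ℝ ψ X) :
    gradient (fun X => φ X * ψ X) X = φ X • gradient ψ X + ψ X • gradient φ X := by
  simp [gradient, fderiv_fun_mul hφ hψ]

lemma hasFDerivAt_comp_yCoord {f : ℝ → ℝ} {f' : ℝ} {X : Pt n} (h : HasDerivAt f f' (yCoord X)) :
    HasFDerivAt (fun X => f (yCoord X)) (f' • yProj n) X :=
  h.comp_hasFDerivAt X (yProj n).hasFDerivAt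

lemma gradient_comp_yCoord {f : ℝ → ℝ} {f' : ℝ} {X : Pt n} (h : HasDerivAt f f' (yCoord X)) :
    gradient (fun X => f (yCoord X)) X = f' • eY n := by
  rw [gradient, (hasFDerivAt_comp_yCoord h).fderiv, LinearIsometryEquiv.symm_apply_eq]
  ext Y
  simp [inner_eY_left, yProj_apply]

lemma gradient_comp_reflectY {φ : Pt n → ℝ} (hφ : Differentiable ℝ φ) (X : Pt n) :
    gradient (fun X => φ (reflectY X)) X = reflectY (gradient φ (reflectY X)) := by
  have h1 : HasFDerivAt (reflectY : Pt n → Pt n)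
      (reflectEquiv n).toContinuousLinearEquiv.toContinuousLinearMap X := by
    have := (reflectEquiv n).toContinuousLinearEquiv.hasFDerivAt (x := X)
    simpa [coe_reflectEquiv] using this
  have h2 := (hφ (reflectY X)).hasFDerivAt.comp X h1
  have h3 : fderiv ℝ (fun X => φ (reflectY X)) X = _ := h2.fderiv
  rw [gradient, h3, LinearIsometryEquiv.symm_apply_eq]
  ext Y
  simp only [ContinuousLinearMap.comp_apply, InnerProductSpace.toDual_apply_apply]
  rw [real_inner_comm, inner_reflectY_right, real_inner_comm, inner_gradient_left]
  simp [reflectEquiv_apply]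

lemma memLp_weighted_of_continuous {b : ℝ} (hb : -1 < b) {E : Type*} [NormedAddCommGroup E]
    [SecondCountableTopologyEither (Pt n) E] {f : Pt n → E} (hf : Continuous f) (p : ENNReal) :
    MemLp f p (weightedMeasure n b) := by
  have := isFiniteMeasure_weighted (n := n) hb
  obtain ⟨C, hC⟩ := (isCompact_closedBall (0 : Pt n) 1).exists_bound_of_continuousOn
    hf.continuousOn
  refine MemLp.of_bound hf.aestronglyMeasurable C ?_
  rw [ae_weighted_iff]
  filter_upwards [ae_mem_unitBall] with X hX
  exact hC X (Metric.ball_subset_closedBall hX)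

lemma HasSobolevGradient.of_contDiff {b : ℝ} (hb : -1 < b) {φ : Pt n → ℝ}
    (hφ : ContDiff ℝ ∞ φ) : HasSobolevGradient b φ (gradient φ) :=
  ⟨memLp_weighted_of_continuous hb hφ.continuous 2,
    memLp_weighted_of_continuous hb (continuous_gradient hφ) 2,
    fun _ => φ, fun _ => hφ, by simp, by simp⟩

/-- Square integrability comes for free: `u` and `G` differ by finite norm from a smooth function
and its gradient, which are bounded on the ball. -/
lemma HasSobolevGradient.of_approx {b : ℝ} (hb : -1 < b) {u : Pt n → ℝ} {G : Pt n → Pt n}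
    (hu : AEStronglyMeasurable u (weightedMeasure n b))
    (hG : AEStronglyMeasurable G (weightedMeasure n b))
    (h : ∀ ε : ENNReal, 0 < ε → ε < ⊤ → ∃ φ : Pt n → ℝ, ContDiff ℝ ∞ φ ∧
      eLpNorm (fun X => φ X - u X) 2 (weightedMeasure n b) ≤ ε ∧
      eLpNorm (fun X => gradient φ X - G X) 2 (weightedMeasure n b) ≤ ε) :
    HasSobolevGradient b u G := by
  obtain ⟨φ₁, hφ₁, h₁, h₁'⟩ := h 1 (by simp) (by simp)
  refine ⟨?_, ?_, ?_⟩
  · have e : u = fun X => φ₁ X - (φ₁ X - u X) := by ext; ring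
    rw [e]
    exact (memLp_weighted_of_continuous hb hφ₁.continuous 2).sub
      ⟨hφ₁.continuous.aestronglyMeasurable.sub hu, h₁.trans_lt (by simp)⟩
  · have e : G = fun X => gradient φ₁ X - (gradient φ₁ X - G X) := by ext; simp
    rw [e]
    exact (memLp_weighted_of_continuous hb (continuous_gradient hφ₁) 2).sub
      ⟨(continuous_gradient hφ₁).aestronglyMeasurable.sub hG, h₁'.trans_lt (by simp)⟩
  · have hε : ∀ k : ℕ, (0 : ENNReal) < (k + 1 : ENNReal)⁻¹ := fun k => by
      simp [ENNReal.inv_pos]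
    have hε' : ∀ k : ℕ, (k + 1 : ENNReal)⁻¹ < ⊤ := fun k => by simp
    choose φ hφ h1 h2 using fun k : ℕ => h _ (hε k) (hε' k)
    have ht : Tendsto (fun k : ℕ => (k + 1 : ENNReal)⁻¹) atTop (𝓝 0) := by
      have := (tendsto_add_atTop_iff_nat 1).2 ENNReal.tendsto_inv_nat_nhds_zero
      simpa using this
    exact ⟨φ, hφ, tendsto_of_tendsto_of_tendsto_of_le_of_le tendsto_const_nhds ht
      (fun _ => zero_le) h1, tendsto_of_tendsto_of_tendsto_of_le_of_le tendsto_const_nhds ht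
      (fun _ => zero_le) h2⟩

lemma HasSobolevGradient.exists_approx {b : ℝ} {u : Pt n → ℝ} {G : Pt n → Pt n}
    (h : HasSobolevGradient b u G) {ε : ENNReal} (hε : 0 < ε) :
    ∃ φ : Pt n → ℝ, ContDiff ℝ ∞ φ ∧
      eLpNorm (fun X => φ X - u X) 2 (weightedMeasure n b) ≤ ε ∧
      eLpNorm (fun X => gradient φ X - G X) 2 (weightedMeasure n b) ≤ ε := by
  obtain ⟨-, -, φ, hφ, h1, h2⟩ := h
  obtain ⟨k, hk1, hk2⟩ := ((h1.eventually_le_const hε).and (h2.eventually_le_const hε)).exists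
  exact ⟨φ k, hφ k, hk1, hk2⟩

/-- Closedness of the weighted Sobolev space: a limit of limits of smooth functions is again such a
limit. -/
lemma HasSobolevGradient.of_tendsto {b : ℝ} (hb : -1 < b) {u : Pt n → ℝ} {G : Pt n → Pt n}
    {U : ℕ → Pt n → ℝ} {H : ℕ → Pt n → Pt n}
    (hu : AEStronglyMeasurable u (weightedMeasure n b))
    (hG : AEStronglyMeasurable G (weightedMeasure n b))
    (hUH : ∀ k, HasSobolevGradient b (U k) (H k))
    (hU : Tendsto (fun k => eLpNorm (fun X => U k X - u X) 2 (weightedMeasure n b)) atTop (𝓝 0))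
    (hH : Tendsto (fun k => eLpNorm (fun X => H k X - G X) 2 (weightedMeasure n b)) atTop (𝓝 0)) :
    HasSobolevGradient b u G := by
  refine .of_approx hb hu hG fun ε hε hε' => ?_
  have hε2 : 0 < ε / 2 := ENNReal.half_pos hε.ne'
  obtain ⟨k, hk1, hk2⟩ :=
    ((hU.eventually_le_const hε2).and (hH.eventually_le_const hε2)).exists
  obtain ⟨φ, hφ, h1, h2⟩ := (hUH k).exists_approx hε2
  refine ⟨φ, hφ, ?_, ?_⟩
  · have e : (fun X => φ X - u X) = (fun X => φ X - U k X) + (fun X => U k X - u X) := by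
      ext; simp
    rw [e, ← ENNReal.add_halves ε]
    exact (eLpNorm_add_le (hφ.continuous.aestronglyMeasurable.sub (hUH k).1.1)
      ((hUH k).1.1.sub hu) (by norm_num)).trans (add_le_add h1 hk1)
  · have e : (fun X => gradient φ X - G X)
        = (fun X => gradient φ X - H k X) + (fun X => H k X - G X) := by
      ext; simp
    rw [e, ← ENNReal.add_halves ε]
    exact (eLpNorm_add_le ((continuous_gradient hφ).aestronglyMeasurable.sub (hUH k).2.1.1)
      ((hUH k).2.1.1.sub hG) (by norm_num)).trans (add_le_add h2 hk2)

lemma HasSobolevGradient.congr {b : ℝ} {u u' : Pt n → ℝ} {G : Pt n → Pt n}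
    (h : HasSobolevGradient b u G) (he : u' =ᵐ[ballMeasure n] u) :
    HasSobolevGradient b u' G := by
  have he' : u' =ᵐ[weightedMeasure n b] u := (ae_weighted_iff b).2 he
  obtain ⟨h1, h2, φ, hφ, h3, h4⟩ := h
  refine ⟨(memLp_congr_ae he').2 h1, h2, φ, hφ, h3.congr fun k => eLpNorm_congr_ae ?_, h4⟩
  filter_upwards [he'] with X hX
  rw [hX]

lemma HasSobolevGradient.add {b : ℝ} (hb : -1 < b) {u v : Pt n → ℝ} {G H : Pt n → Pt n}
    (hu : HasSobolevGradient b u G) (hv : HasSobolevGradient b v H) :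
    HasSobolevGradient b (fun X => u X + v X) (fun X => G X + H X) := by
  refine .of_approx hb (hu.1.add hv.1).1 (hu.2.1.add hv.2.1).1 fun ε hε hε' => ?_
  have hε2 : 0 < ε / 2 := ENNReal.half_pos hε.ne'
  obtain ⟨φ, hφ, h1, h2⟩ := hu.exists_approx hε2
  obtain ⟨ψ, hψ, h3, h4⟩ := hv.exists_approx hε2
  refine ⟨fun X => φ X + ψ X, hφ.add hψ, ?_, ?_⟩
  · have e : (fun X => φ X + ψ X - (u X + v X)) = (fun X => φ X - u X) + (fun X => ψ X - v X) := by
      ext; simp; ring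
    rw [e, ← ENNReal.add_halves ε]
    exact (eLpNorm_add_le (hφ.continuous.aestronglyMeasurable.sub hu.1.1)
      (hψ.continuous.aestronglyMeasurable.sub hv.1.1) (by norm_num)).trans (add_le_add h1 h3)
  · have e : (fun X => gradient (fun X => φ X + ψ X) X - (G X + H X))
        = (fun X => gradient φ X - G X) + (fun X => gradient ψ X - H X) := by
      funext X
      rw [gradient_add' (hφ.differentiable (by simp) X) (hψ.differentiable (by simp) X)]
      simp only [Pi.add_apply]; abel
    rw [e, ← ENNReal.add_halves ε]
    exact (eLpNorm_add_le ((continuous_gradient hφ).aestronglyMeasurable.sub hu.2.1.1)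
      ((continuous_gradient hψ).aestronglyMeasurable.sub hv.2.1.1) (by norm_num)).trans
      (add_le_add h2 h4)

lemma HasSobolevGradient.const_mul {b : ℝ} {u : Pt n → ℝ} {G : Pt n → Pt n} (c : ℝ)
    (hu : HasSobolevGradient b u G) :
    HasSobolevGradient b (fun X => c * u X) (fun X => c • G X) := by
  obtain ⟨h1, h2, φ, hφ, h3, h4⟩ := hu
  refine ⟨h1.const_mul c, h2.const_smul c, fun k X => c * φ k X,
    fun k => contDiff_const.mul (hφ k), ?_, ?_⟩
  · have := ENNReal.Tendsto.const_mul (a := ‖c‖ₑ) h3 (Or.inr (by simp))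
    rw [mul_zero] at this
    refine this.congr fun k => ?_
    rw [← eLpNorm_const_smul]
    congr 1; ext X; simp; ring
  · have := ENNReal.Tendsto.const_mul (a := ‖c‖ₑ) h4 (Or.inr (by simp))
    rw [mul_zero] at this
    refine this.congr fun k => ?_
    rw [← eLpNorm_const_smul]
    congr 1; funext X
    rw [gradient_const_mul' c ((hφ k).differentiable (by simp) X)]
    simp [smul_sub]

lemma HasSobolevGradient.reflect {b : ℝ} {u : Pt n → ℝ} {G : Pt n → Pt n}
    (hu : HasSobolevGradient b u G) :
    HasSobolevGradient b (fun X => u (reflectY X)) (fun X => reflectY (G (reflectY X))) := by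
  have hR := measurePreserving_reflectY_weighted (n := n) b
  have hc : Continuous (reflectY : Pt n → Pt n) := (contDiff_reflectY (k := 0)).continuous
  obtain ⟨h1, h2, φ, hφ, h3, h4⟩ := hu
  have hn : ∀ F : Pt n → Pt n, AEStronglyMeasurable F (weightedMeasure n b) →
      eLpNorm (fun X => reflectY (F (reflectY X))) 2 (weightedMeasure n b)
        = eLpNorm F 2 (weightedMeasure n b) := fun F hF => by
    rw [← eLpNorm_comp_measurePreserving hF hR]
    exact eLpNorm_congr_norm_ae (Eventually.of_forall fun X => by simp)
  refine ⟨h1.comp_measurePreserving hR, ⟨?_, ?_⟩, fun k X => φ k (reflectY X),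
    fun k => (hφ k).comp contDiff_reflectY, h3.congr fun k => ?_, h4.congr fun k => ?_⟩
  · exact hc.comp_aestronglyMeasurable (h2.1.comp_measurePreserving hR)
  · rw [hn G h2.1]; exact h2.2
  · exact (eLpNorm_comp_measurePreserving
      ((hφ k).continuous.aestronglyMeasurable.sub h1.1) hR).symm
  · refine (hn _ ((continuous_gradient (hφ k)).aestronglyMeasurable.sub h2.1)).symm.trans ?_
    congr 1; funext X
    rw [gradient_comp_reflectY ((hφ k).differentiable (by simp)), Pi.sub_apply, reflectY_sub]

lemma integrable_inner_of_memLp {b : ℝ} (hb : -1 < b) {G F : Pt n → Pt n}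
    (hG : MemLp G 2 (weightedMeasure n b)) (hF : Continuous F) :
    Integrable (fun X => inner ℝ (G X) (F X)) (weightedMeasure n b) := by
  have hF' := memLp_weighted_of_continuous hb hF 2
  have h : Integrable (fun X => ‖G X‖ * ‖F X‖) (weightedMeasure n b) :=
    hG.norm.integrable_mul hF'.norm
  refine h.mono (hG.1.inner hF'.1) (Eventually.of_forall fun X => ?_)
  rw [norm_mul, norm_norm, norm_norm]
  exact norm_inner_le_norm (G X) (F X)

lemma integral_weak_form (b : ℝ) (G : Pt n → Pt n) (φ : Pt n → ℝ) :
    ∫ X, |yCoord X| ^ b * inner ℝ (G X) (gradient φ X) ∂(ballMeasure n)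
      = ∫ X, inner ℝ (G X) (gradient φ X) ∂(weightedMeasure n b) := by
  rw [integral_weighted]; rfl

/-- `G` is weakly divergence free with respect to `|y|^b` in the unit ball. -/
def WeakDivFree (b : ℝ) (G : Pt n → Pt n) : Prop :=
  ∀ φ : Pt n → ℝ, ContDiff ℝ ∞ φ → HasCompactSupport φ → tsupport φ ⊆ unitBall n →
    ∫ X, |yCoord X| ^ b * inner ℝ (G X) (gradient φ X) ∂(ballMeasure n) = 0

lemma WeakDivFree.add {b : ℝ} (hb : -1 < b) {G H : Pt n → Pt n}
    (hG : MemLp G 2 (weightedMeasure n b)) (hH : MemLp H 2 (weightedMeasure n b))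
    (hw : WeakDivFree b G) (hw' : WeakDivFree b H) : WeakDivFree b (fun X => G X + H X) := by
  intro φ h1 h2 h3
  have e1 := hw φ h1 h2 h3
  have e2 := hw' φ h1 h2 h3
  rw [integral_weak_form] at e1 e2 ⊢
  simp only [inner_add_left]
  rw [integral_add (integrable_inner_of_memLp hb hG (continuous_gradient h1))
    (integrable_inner_of_memLp hb hH (continuous_gradient h1)), e1, e2, add_zero]

lemma WeakDivFree.const_smul {b : ℝ} {G : Pt n → Pt n} (c : ℝ) (hw : WeakDivFree b G) :
    WeakDivFree b (fun X => c • G X) := by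
  intro φ h1 h2 h3
  have e1 := hw φ h1 h2 h3
  rw [integral_weak_form] at e1 ⊢
  simp only [inner_smul_left]
  rw [integral_const_mul, e1, mul_zero]

lemma WeakDivFree.reflect {b : ℝ} {G : Pt n → Pt n} (hw : WeakDivFree b G) :
    WeakDivFree b (fun X => reflectY (G (reflectY X))) := by
  intro φ h1 h2 h3
  have hc : Continuous (reflectY : Pt n → Pt n) := (contDiff_reflectY (k := 0)).continuous
  have hR := measurePreserving_reflectY_weighted (n := n) b
  have e1 := hw (fun X => φ (reflectY X)) (h1.comp contDiff_reflectY)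
    (by
      have := h2.comp_homeomorph (reflectEquiv n).toHomeomorph
      simpa [Function.comp_def, reflectEquiv_apply] using this)
    (by
      intro X hX
      have hs := tsupport_comp_subset_preimage φ hc hX
      exact reflectY_mem_unitBall.1 (h3 hs))
  rw [integral_weak_form] at e1 ⊢
  rw [← e1, ← hR.integral_comp (by
    rw [← coe_reflectEquiv]; exact (reflectEquiv n).toHomeomorph.measurableEmbedding)]
  refine integral_congr_ae (Eventually.of_forall fun X => ?_)
  simp only [gradient_comp_reflectY (h1.differentiable (by simp)), reflectY_reflectY]
  rw [inner_reflectY_right]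

lemma IsLHarmonic.congr {b : ℝ} {u u' : Pt n → ℝ} (h : IsLHarmonic b u)
    (he : u' =ᵐ[ballMeasure n] u) : IsLHarmonic b u' := by
  obtain ⟨G, hG, hw⟩ := h
  exact ⟨G, hG.congr he, hw⟩

lemma IsLHarmonic.add {b : ℝ} (hb : -1 < b) {u v : Pt n → ℝ} (hu : IsLHarmonic b u)
    (hv : IsLHarmonic b v) : IsLHarmonic b (fun X => u X + v X) := by
  obtain ⟨G, hG, hw⟩ := hu
  obtain ⟨H, hH, hw'⟩ := hv
  exact ⟨_, hG.add hb hH, WeakDivFree.add hb hG.2.1 hH.2.1 hw hw'⟩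

lemma IsLHarmonic.const_mul {b : ℝ} {u : Pt n → ℝ} (c : ℝ) (hu : IsLHarmonic b u) :
    IsLHarmonic b (fun X => c * u X) := by
  obtain ⟨G, hG, hw⟩ := hu
  exact ⟨_, hG.const_mul c, WeakDivFree.const_smul c hw⟩

lemma IsLHarmonic.reflect {b : ℝ} {u : Pt n → ℝ} (hu : IsLHarmonic b u) :
    IsLHarmonic b (fun X => u (reflectY X)) := by
  obtain ⟨G, hG, hw⟩ := hu
  exact ⟨_, hG.reflect, WeakDivFree.reflect hw⟩

lemma IsLHarmonic.const {b : ℝ} (hb : -1 < b) (c : ℝ) :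
    IsLHarmonic b (fun _ : Pt n => c) :=
  ⟨_, .of_contDiff hb contDiff_const, fun φ _ _ _ => by simp⟩

/-! ### Cutoffs near `{y = 0}` and regularized powers -/

/-- A smooth function of `y` vanishing for `(k+1)|y| ≤ 1` and equal to `1` for `(k+1)|y| ≥ 2`. -/
def cutoff (k : ℕ) (y : ℝ) : ℝ := Real.smoothTransition (((k + 1) * y) ^ 2 - 1)

lemma contDiff_cutoff (k : ℕ) : ContDiff ℝ ∞ (cutoff k) :=
  Real.smoothTransition.contDiff.comp (((contDiff_const.mul contDiff_id).pow 2).sub contDiff_const)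

lemma cutoff_nonneg (k : ℕ) (y : ℝ) : 0 ≤ cutoff k y := Real.smoothTransition.nonneg _

lemma cutoff_le_one (k : ℕ) (y : ℝ) : cutoff k y ≤ 1 := Real.smoothTransition.le_one _

lemma abs_cutoff_le_one (k : ℕ) (y : ℝ) : |cutoff k y| ≤ 1 := by
  rw [abs_of_nonneg (cutoff_nonneg k y)]; exact cutoff_le_one k y

lemma cutoff_eventuallyEq_zero (k : ℕ) : cutoff k =ᶠ[𝓝 0] fun _ => 0 := by
  have h : ContinuousAt (fun y : ℝ => (((k : ℝ) + 1) * y) ^ 2 - 1) 0 := by fun_prop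
  have : ∀ᶠ y in 𝓝 (0 : ℝ), (((k : ℝ) + 1) * y) ^ 2 - 1 < 0 :=
    h.eventually_lt continuousAt_const (by norm_num)
  filter_upwards [this] with y hy
  exact Real.smoothTransition.zero_of_nonpos hy.le

lemma cutoff_zero (k : ℕ) : cutoff k 0 = 0 := (cutoff_eventuallyEq_zero k).eq_of_nhds

lemma deriv_cutoff_zero (k : ℕ) : deriv (cutoff k) 0 = 0 := by
  rw [(cutoff_eventuallyEq_zero k).deriv_eq]; simp

lemma eventually_cutoff_eventuallyEq_one {y : ℝ} (hy : y ≠ 0) :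
    ∀ᶠ k : ℕ in atTop, cutoff k =ᶠ[𝓝 y] fun _ => 1 := by
  have hy' : 0 < |y| := abs_pos.2 hy
  obtain ⟨N, hN⟩ := exists_nat_gt (2 / |y|)
  filter_upwards [eventually_ge_atTop N] with k hk
  have h2 : 2 < ((k : ℝ) + 1) * |y| := by
    rw [div_lt_iff₀ hy'] at hN
    have : (N : ℝ) ≤ k := by exact_mod_cast hk
    nlinarith
  have h : ContinuousAt (fun z : ℝ => ((k : ℝ) + 1) * |z|) y := by fun_prop
  have : ∀ᶠ z in 𝓝 y, 2 < ((k : ℝ) + 1) * |z| :=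
    continuousAt_const.eventually_lt h h2
  filter_upwards [this] with z hz
  refine Real.smoothTransition.one_of_one_le ?_
  have : (((k : ℝ) + 1) * z) ^ 2 = (((k : ℝ) + 1) * |z|) ^ 2 := by
    rw [mul_pow, mul_pow, sq_abs]
  rw [this]; nlinarith

lemma tendsto_cutoff {y : ℝ} (hy : y ≠ 0) : Tendsto (fun k => cutoff k y) atTop (𝓝 1) :=
  tendsto_const_nhds.congr' <| (eventually_cutoff_eventuallyEq_one hy).mono fun _ h =>
    h.eq_of_nhds.symm

lemma tendsto_deriv_cutoff {y : ℝ} (hy : y ≠ 0) :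
    Tendsto (fun k => deriv (cutoff k) y) atTop (𝓝 0) :=
  tendsto_const_nhds.congr' <| (eventually_cutoff_eventuallyEq_one hy).mono fun _ h => by
    simpa using h.deriv_eq.symm

/-- Scale invariance: with `t = (k+1)y` one has `y η_k'(y) = t η_0'(t)`, and `η_0'` vanishes for
`|t| > 2`. The uniform bound lets the derivative of the cutoff be absorbed whenever it meets a
function that vanishes on `Σ`. -/
lemma exists_abs_deriv_cutoff_mul_le :
    ∃ C : ℝ, 0 ≤ C ∧ ∀ k y, |deriv (cutoff k) y * y| ≤ C := by
  have hc : Continuous fun t : ℝ => deriv (cutoff 0) t * t :=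
    ((contDiff_cutoff 0).continuous_deriv (by simp)).mul continuous_id
  obtain ⟨C, hC⟩ := (isCompact_Icc (a := (-2 : ℝ)) (b := 2)).exists_bound_of_continuousOn
    hc.continuousOn
  have hC0 : 0 ≤ C := (norm_nonneg _).trans (hC 0 (by norm_num))
  have key : ∀ t : ℝ, |deriv (cutoff 0) t * t| ≤ C := by
    intro t
    by_cases ht : t ∈ Set.Icc (-2 : ℝ) 2
    · exact hC t ht
    · have h2 : 2 < |t| := by
        by_contra! h
        exact ht (abs_le.1 h)
      have : cutoff 0 =ᶠ[𝓝 t] fun _ => 1 := by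
        filter_upwards [continuous_abs.continuousAt.eventually (lt_mem_nhds h2)] with z hz
        refine Real.smoothTransition.one_of_one_le ?_
        have hz' : z ^ 2 = |z| ^ 2 := (sq_abs z).symm
        simp only [Nat.cast_zero, zero_add, one_mul]
        rw [hz']
        have : 2 < |z| := hz
        nlinarith
      rw [this.deriv_eq]; simpa using hC0
  refine ⟨C, hC0, fun k y => ?_⟩
  have e : cutoff k = fun y => cutoff 0 (((k : ℝ) + 1) * y) := by
    ext y; simp [cutoff]
  have : deriv (cutoff k) y * y = deriv (cutoff 0) (((k : ℝ) + 1) * y) * (((k : ℝ) + 1) * y) := by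
    rw [e]
    have h1 : HasDerivAt (fun y : ℝ => ((k : ℝ) + 1) * y) ((k : ℝ) + 1) y := by
      simpa using (hasDerivAt_id y).const_mul ((k : ℝ) + 1)
    have h2 := (((contDiff_cutoff 0).differentiable (by simp)) (((k : ℝ) + 1) * y)).hasDerivAt.comp y h1
    have h3 : deriv (fun y => cutoff 0 (((k : ℝ) + 1) * y)) y = _ := h2.deriv
    rw [h3]; ring
  rw [this]; exact key _

lemma hasDerivAt_abs_rpow {y : ℝ} (hy : y ≠ 0) (c : ℝ) :
    HasDerivAt (fun y : ℝ => |y| ^ c) (c * |y| ^ c / y) y := by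
  have h := (hasDerivAt_abs hy).rpow_const (p := c) (Or.inl (abs_ne_zero.2 hy))
  convert h using 1
  have hy' : 0 < |y| := abs_pos.2 hy
  rw [Real.rpow_sub_one hy'.ne']
  rcases hy.lt_or_gt with h | h
  · rw [sign_neg h, abs_of_neg h]; simp; field_simp
  · rw [sign_pos h, abs_of_pos h]; simp; field_simp

lemma contDiffAt_abs_rpow {y : ℝ} (hy : y ≠ 0) (c : ℝ) :
    ContDiffAt ℝ ∞ (fun y : ℝ => |y| ^ c) y :=
  (contDiffAt_abs hy).rpow_const_of_ne (abs_ne_zero.2 hy)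

/-- The power `|y|^c`, cut off near `0`. -/
def cutPow (k : ℕ) (c : ℝ) (y : ℝ) : ℝ := cutoff k y * |y| ^ c

lemma contDiff_cutPow (k : ℕ) (c : ℝ) : ContDiff ℝ ∞ (cutPow k c) := by
  rw [contDiff_iff_contDiffAt]
  intro y
  by_cases hy : y = 0
  · subst hy
    refine (contDiffAt_const (c := (0 : ℝ))).congr_of_eventuallyEq ?_
    filter_upwards [cutoff_eventuallyEq_zero k] with z hz
    simp [cutPow, hz]
  · exact (contDiff_cutoff k).contDiffAt.mul (contDiffAt_abs_rpow hy c)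

/-- At `y = 0` the formula remains correct: the cutoff and its derivative vanish there and
annihilate the default values of the power and the quotient. -/
lemma hasDerivAt_cutPow (k : ℕ) (c y : ℝ) :
    HasDerivAt (cutPow k c) (deriv (cutoff k) y * |y| ^ c + cutoff k y * (c * |y| ^ c / y)) y := by
  by_cases hy : y = 0
  · subst hy
    rw [deriv_cutoff_zero, cutoff_zero]
    have : cutPow k c =ᶠ[𝓝 0] fun _ => 0 := by
      filter_upwards [cutoff_eventuallyEq_zero k] with z hz
      simp [cutPow, hz]
    simpa using (hasDerivAt_const (0 : ℝ) (0 : ℝ)).congr_of_eventuallyEq this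
  · exact (((contDiff_cutoff k).differentiable (by simp)) y).hasDerivAt.mul
      (hasDerivAt_abs_rpow hy c)

lemma gradient_cutPow_mul {φ : Pt n → ℝ} (hφ : Differentiable ℝ φ) (k : ℕ) (c : ℝ) (X : Pt n) :
    gradient (fun X => cutPow k c (yCoord X) * φ X) X
      = cutPow k c (yCoord X) • gradient φ X
        + (φ X * (deriv (cutoff k) (yCoord X) * |yCoord X| ^ c
          + cutoff k (yCoord X) * (c * |yCoord X| ^ c / yCoord X))) • eY n := by
  have h := hasDerivAt_cutPow k c (yCoord X)
  rw [gradient_mul' (φ := fun X => cutPow k c (yCoord X))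
    (hasFDerivAt_comp_yCoord h).differentiableAt (hφ X), gradient_comp_yCoord h, smul_smul]

lemma contDiff_cutPow_mul {φ : Pt n → ℝ} (hφ : ContDiff ℝ ∞ φ) (k : ℕ) (c : ℝ) :
    ContDiff ℝ ∞ (fun X => cutPow k c (yCoord X) * φ X) :=
  ((contDiff_cutPow k c).comp contDiff_yCoord).mul hφ

/-! ### Hardy's inequality in the variable `y` -/

lemma eLpNorm_two_sq {α E : Type*} [MeasurableSpace α] [NormedAddCommGroup E] (μ : Measure α)
    (f : α → E) : eLpNorm f 2 μ ^ 2 = ∫⁻ x, ‖f x‖ₑ ^ 2 ∂μ := by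
  rw [eLpNorm_eq_lintegral_rpow_enorm_toReal (by norm_num) (by norm_num)]
  rw [← ENNReal.rpow_natCast, ← ENNReal.rpow_mul]
  simp

lemma eLpNorm_two_le_iff {α E F : Type*} [MeasurableSpace α] [NormedAddCommGroup E]
    [NormedAddCommGroup F] {μ ν : Measure α} {f : α → E} {g : α → F} {K : ENNReal} :
    eLpNorm f 2 μ ≤ K * eLpNorm g 2 ν ↔ ∫⁻ x, ‖f x‖ₑ ^ 2 ∂μ ≤ K ^ 2 * ∫⁻ x, ‖g x‖ₑ ^ 2 ∂ν := by
  rw [← eLpNorm_two_sq, ← eLpNorm_two_sq, ← mul_pow]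
  exact (ENNReal.pow_le_pow_left_iff two_ne_zero).symm

/-- The dilation `(x, y) ↦ (x, t y)`. -/
def scaleY (t : ℝ) (X : Pt n) : Pt n := X + ((t - 1) * yCoord X) • eY n

lemma yCoord_add (X Y : Pt n) : yCoord (X + Y) = yCoord X + yCoord Y := rfl

lemma yCoord_smul (c : ℝ) (X : Pt n) : yCoord (c • X) = c * yCoord X := rfl

lemma yCoord_scaleY (t : ℝ) (X : Pt n) : yCoord (scaleY t X) = t * yCoord X := by
  rw [scaleY, yCoord_add, yCoord_smul, yCoord_eY]; ring

lemma norm_scaleY_le {t : ℝ} (h0 : 0 ≤ t) (h1 : t ≤ 1) (X : Pt n) : ‖scaleY t X‖ ≤ ‖X‖ := by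
  have : ‖scaleY t X‖ ^ 2 ≤ ‖X‖ ^ 2 := by
    rw [scaleY, norm_add_sq_real, inner_smul_right, inner_eY, norm_smul, norm_eY, mul_one,
      Real.norm_eq_abs, sq_abs]
    nlinarith [mul_nonneg (sub_nonneg.2 h1) (mul_nonneg (add_nonneg zero_le_one h0) (sq_nonneg (yCoord X)))]
  exact le_of_sq_le_sq this (norm_nonneg _) 

lemma continuous_scaleY : Continuous fun p : ℝ × Pt n => scaleY p.1 p.2 := by
  unfold scaleY
  have := continuous_yCoord (n := n)
  fun_prop

/-- The dilation is `id + (t-1) e_y ⊗ y`, a rank-one perturbation of the identity with determinant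
`t`. -/
lemma map_scaleY {t : ℝ} (ht : 0 < t) :
    Measure.map (scaleY t) (volume : Measure (Pt n)) = ENNReal.ofReal t⁻¹ • volume := by
  have e : (scaleY t : Pt n → Pt n)
      = LinearMap.transvection (yProj n).toLinearMap ((t - 1) • eY n) := by
    ext X : 1
    rw [LinearMap.transvection.apply, scaleY, smul_smul, mul_comm]
    rfl
  have hd : LinearMap.det (LinearMap.transvection (yProj n).toLinearMap ((t - 1) • eY n)) = t := by
    rw [LinearMap.transvection.det]
    have : (yProj n).toLinearMap ((t - 1) • eY n) = t - 1 := by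
      have : yCoord ((t - 1) • eY n) = t - 1 := by rw [yCoord_smul, yCoord_eY, mul_one]
      exact this
    rw [this]; ring
  rw [e, Measure.map_linearMap_addHaar_eq_smul_addHaar _ (by rw [hd]; exact ht.ne'), hd,
    abs_of_pos (inv_pos.2 ht)]

lemma lintegral_comp_scaleY {t : ℝ} (ht : 0 < t) {h : Pt n → ENNReal} (hh : Measurable h) :
    ∫⁻ X, h (scaleY t X) = ENNReal.ofReal t⁻¹ * ∫⁻ X, h X := by
  have hm : Measurable (scaleY t : Pt n → Pt n) :=
    (continuous_scaleY.comp (continuous_const.prodMk continuous_id)).measurable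
  rw [← lintegral_map hh hm, map_scaleY ht, lintegral_smul_measure, smul_eq_mul]

/-- The constant in Hardy's inequality. -/
def hardyConst (a : ℝ) : ENNReal := ∫⁻ t in Set.Ioc (0 : ℝ) 1, ENNReal.ofReal (t ^ (-((1 + a) / 2)))

lemma hardyConst_lt_top {a : ℝ} (ha : a < 1) : hardyConst a < ⊤ := by
  have h := intervalIntegral.intervalIntegrable_rpow' (a := 0) (b := 1)
    (r := -((1 + a) / 2)) (by linarith)
  exact ((intervalIntegrable_iff_integrableOn_Ioc_of_le zero_le_one).1 h).lintegral_lt_top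

/-- Fundamental theorem of calculus on the segment from `(x, 0)` to `(x, y)`: `φ(x,y)/y = ∫₀¹
∂_yφ(x,ty) dt`. On `Σ` the left side is `0` by the convention for inverses. -/
lemma enorm_inv_yCoord_mul_le {φ : Pt n → ℝ} (hφ : ContDiff ℝ ∞ φ)
    (h0 : ∀ X, yCoord X = 0 → φ X = 0) (X : Pt n) :
    ‖(yCoord X)⁻¹ * φ X‖ₑ ≤ ∫⁻ t in Set.Ioc (0 : ℝ) 1, ‖gradient φ (scaleY t X)‖ₑ := by
  by_cases hy : yCoord X = 0
  · simp [hy]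
  have hd : ∀ t : ℝ, HasDerivAt (fun t => φ (scaleY t X))
      (yCoord X * inner ℝ (gradient φ (scaleY t X)) (eY n)) t := by
    intro t
    have h1 : HasDerivAt (fun t : ℝ => scaleY t X) ((1 * yCoord X) • eY n) t :=
      ((((hasDerivAt_id t).sub_const 1).mul_const _).smul_const _).const_add _
    have h2 := ((hφ.differentiable (by simp)) (scaleY t X)).hasFDerivAt.comp_hasDerivAt t h1
    refine h2.congr_deriv ?_
    rw [inner_gradient_left, map_smul]; simp
  have hc : Continuous fun t : ℝ => inner ℝ (gradient φ (scaleY t X)) (eY n) :=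
    ((continuous_gradient hφ).comp (continuous_scaleY.comp
      (continuous_id.prodMk continuous_const))).inner continuous_const
  have hi := intervalIntegral.integral_eq_sub_of_hasDerivAt (a := 0) (b := 1)
    (fun t _ => hd t) ((continuous_const.mul hc).intervalIntegrable _ _)
  rw [h0 (scaleY 0 X) (by rw [yCoord_scaleY, zero_mul])] at hi
  have h1 : scaleY 1 X = X := by simp [scaleY]
  rw [h1, sub_zero, intervalIntegral.integral_const_mul] at hi
  have : (yCoord X)⁻¹ * φ X = ∫ t in Set.Ioc (0 : ℝ) 1, inner ℝ (gradient φ (scaleY t X)) (eY n) := by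
    rw [← hi, intervalIntegral.integral_of_le zero_le_one]; field_simp
  rw [this]
  refine (enorm_integral_le_lintegral_enorm _).trans (lintegral_mono fun t => ?_)
  rw [enorm_le_iff_norm_le]
  simpa [norm_eY] using norm_inner_le_norm (𝕜 := ℝ) (gradient φ (scaleY t X)) (eY n)

/-- Cauchy–Schwarz after writing `g = t^{-γ/2} · t^{γ/2} g`; the free exponent `γ` is chosen in
Hardy's inequality. -/
lemma sq_lintegral_Ioc_le (γ : ℝ) {g : ℝ → ENNReal} (hg : Measurable g) :
    (∫⁻ t in Set.Ioc (0 : ℝ) 1, g t) ^ 2 ≤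
      (∫⁻ t in Set.Ioc (0 : ℝ) 1, ENNReal.ofReal (t ^ (-γ))) *
        ∫⁻ t in Set.Ioc (0 : ℝ) 1, ENNReal.ofReal (t ^ γ) * g t ^ 2 := by
  have hm : ∀ c : ℝ, Measurable fun t : ℝ => ENNReal.ofReal (t ^ c) := fun c =>
    (measurable_id.pow_const c).ennreal_ofReal
  have h := ENNReal.lintegral_mul_le_Lp_mul_Lq (volume.restrict (Set.Ioc (0 : ℝ) 1))
    Real.HolderConjugate.two_two
    (f := fun t => ENNReal.ofReal (t ^ (-γ / 2)))
    (g := fun t => ENNReal.ofReal (t ^ (γ / 2)) * g t)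
    (hm _).aemeasurable ((hm _).mul hg).aemeasurable
  have e1 : ∫⁻ t in Set.Ioc (0 : ℝ) 1, g t = ∫⁻ t in Set.Ioc (0 : ℝ) 1,
      ((fun t => ENNReal.ofReal (t ^ (-γ / 2))) * fun t => ENNReal.ofReal (t ^ (γ / 2)) * g t) t := by
    refine setLIntegral_congr_fun measurableSet_Ioc fun t ht => ?_
    simp only [Pi.mul_apply]
    rw [← mul_assoc, ← ENNReal.ofReal_mul (Real.rpow_nonneg ht.1.le _), ← Real.rpow_add ht.1]
    have : -γ / 2 + γ / 2 = 0 := by ring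
    simp [this]
  have hsq : ∀ (c t : ℝ), 0 < t → ENNReal.ofReal (t ^ (c / 2)) ^ (2 : ℝ) = ENNReal.ofReal (t ^ c) := by
    intro c t ht
    rw [ENNReal.ofReal_rpow_of_nonneg (Real.rpow_nonneg ht.le _) (by norm_num),
      ← Real.rpow_mul ht.le]
    congr 2; ring
  have e2 : ∫⁻ t in Set.Ioc (0 : ℝ) 1, ENNReal.ofReal (t ^ (-γ / 2)) ^ (2 : ℝ)
      = ∫⁻ t in Set.Ioc (0 : ℝ) 1, ENNReal.ofReal (t ^ (-γ)) :=
    setLIntegral_congr_fun measurableSet_Ioc fun t ht => hsq _ t ht.1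
  have e3 : ∫⁻ t in Set.Ioc (0 : ℝ) 1, (ENNReal.ofReal (t ^ (γ / 2)) * g t) ^ (2 : ℝ)
      = ∫⁻ t in Set.Ioc (0 : ℝ) 1, ENNReal.ofReal (t ^ γ) * g t ^ 2 := by
    refine setLIntegral_congr_fun measurableSet_Ioc fun t ht => ?_
    rw [ENNReal.mul_rpow_of_nonneg _ _ (by norm_num), hsq _ t ht.1]
    congr 1
    exact ENNReal.rpow_natCast _ 2
  rw [← e1, e2, e3] at h
  calc _ ≤ _ := pow_le_pow_left' h 2
    _ = _ := by
      rw [mul_pow, ← ENNReal.rpow_natCast, ← ENNReal.rpow_natCast, ← ENNReal.rpow_mul,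
        ← ENNReal.rpow_mul]
      simp

/-- **Hardy's inequality** for smooth functions vanishing on `{y = 0}`. -/
lemma hardy_smooth {a : ℝ} {φ : Pt n → ℝ} (hφ : ContDiff ℝ ∞ φ)
    (h0 : ∀ X, yCoord X = 0 → φ X = 0) :
    eLpNorm (fun X => (yCoord X)⁻¹ * φ X) 2 (weightedMeasure n a)
      ≤ hardyConst a * eLpNorm (gradient φ) 2 (weightedMeasure n a) := by
  -- Rescaling costs `t^{-1-a} = t^{-2γ}`, so this `γ` makes both factors of the Cauchy–Schwarz
  -- bound equal to `∫₀¹ t^{-γ} dt`, finite when `a < 1`.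
  set γ : ℝ := (1 + a) / 2 with hγ
  have hgc : Continuous fun p : ℝ × Pt n => gradient φ (scaleY p.1 p.2) :=
    (continuous_gradient hφ).comp continuous_scaleY
  have hm : ∀ c : ℝ, Measurable fun t : ℝ => ENNReal.ofReal (t ^ c) := fun c =>
    (measurable_id.pow_const c).ennreal_ofReal
  have hGm : Measurable fun p : ℝ × Pt n =>
      ENNReal.ofReal (p.1 ^ γ) * ‖gradient φ (scaleY p.1 p.2)‖ₑ ^ 2 :=
    ((hm γ).comp measurable_fst).mul (hgc.measurable.enorm.pow_const 2)
  have hgm : ∀ X : Pt n, Measurable fun t => ‖gradient φ (scaleY t X)‖ₑ := fun X =>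
    (hgc.comp (continuous_id.prodMk continuous_const)).measurable.enorm
  rw [eLpNorm_two_le_iff]
  set W : Pt n → ENNReal := (unitBall n).indicator fun X =>
    ENNReal.ofReal (|yCoord X| ^ a) * ‖gradient φ X‖ₑ ^ 2 with hW
  have hWm : Measurable W := ((measurable_weight a).mul
    ((continuous_gradient hφ).measurable.enorm.pow_const 2)).indicator measurableSet_unitBall
  have hWint : ∫⁻ X, ‖gradient φ X‖ₑ ^ 2 ∂(weightedMeasure n a) = ∫⁻ X, W X := by
    rw [lintegral_weighted _ ((continuous_gradient hφ).measurable.enorm.pow_const 2).aemeasurable,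
      lintegral_indicator measurableSet_unitBall]
    rfl
  -- For `t ≤ 1` the dilation maps the ball into itself. The weight contributes `t^{-a}` and the
  -- Jacobian `t^{-1}`.
  have hscale : ∀ t ∈ Set.Ioc (0 : ℝ) 1,
      ∫⁻ X, ENNReal.ofReal (t ^ γ) * ‖gradient φ (scaleY t X)‖ₑ ^ 2 ∂(weightedMeasure n a)
        ≤ ENNReal.ofReal (t ^ (-γ)) * ∫⁻ X, W X := by
    intro t ht
    have hmt : Measurable fun X : Pt n => ‖gradient φ (scaleY t X)‖ₑ ^ 2 :=
      (hgc.comp (continuous_const.prodMk continuous_id)).measurable.enorm.pow_const 2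
    rw [lintegral_const_mul _ hmt, lintegral_weighted _ hmt.aemeasurable]
    have : ∫⁻ X, ENNReal.ofReal (|yCoord X| ^ a) * ‖gradient φ (scaleY t X)‖ₑ ^ 2 ∂(ballMeasure n)
        ≤ ∫⁻ X, ENNReal.ofReal (t ^ (-a)) * W (scaleY t X) := by
      rw [ballMeasure, ← lintegral_indicator measurableSet_unitBall]
      refine lintegral_mono fun X => ?_
      by_cases hX : X ∈ unitBall n
      · have hX' : scaleY t X ∈ unitBall n :=
          mem_unitBall.2 ((norm_scaleY_le ht.1.le ht.2 X).trans_lt (mem_unitBall.1 hX))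
        rw [hW, Set.indicator_of_mem hX, Set.indicator_of_mem hX', yCoord_scaleY, ← mul_assoc,
          ← ENNReal.ofReal_mul (Real.rpow_nonneg ht.1.le _), abs_mul, abs_of_pos ht.1,
          Real.mul_rpow ht.1.le (abs_nonneg _), ← mul_assoc, ← Real.rpow_add ht.1]
        simp
      · rw [Set.indicator_of_notMem hX]; exact zero_le
    have hWt : Measurable fun X : Pt n => W (scaleY t X) := hWm.comp
      (continuous_scaleY.comp (continuous_const.prodMk continuous_id)).measurable
    refine (mul_le_mul_right this _).trans_eq ?_
    rw [lintegral_const_mul _ hWt, lintegral_comp_scaleY ht.1 hWm,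
      ← mul_assoc, ← mul_assoc, ← ENNReal.ofReal_mul (Real.rpow_nonneg ht.1.le _),
      ← ENNReal.ofReal_mul (by have := ht.1.le; positivity), ← Real.rpow_neg_one t, ← Real.rpow_add ht.1,
      ← Real.rpow_add ht.1]
    congr 3
    rw [hγ]; ring
  calc ∫⁻ X, ‖(yCoord X)⁻¹ * φ X‖ₑ ^ 2 ∂(weightedMeasure n a)
      ≤ ∫⁻ X, hardyConst a * (∫⁻ t in Set.Ioc (0 : ℝ) 1,
          ENNReal.ofReal (t ^ γ) * ‖gradient φ (scaleY t X)‖ₑ ^ 2) ∂(weightedMeasure n a) :=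
        lintegral_mono fun X => (pow_le_pow_left' (enorm_inv_yCoord_mul_le hφ h0 X) 2).trans
          (sq_lintegral_Ioc_le γ (hgm X))
    _ = hardyConst a * ∫⁻ t in Set.Ioc (0 : ℝ) 1, ∫⁻ X,
          ENNReal.ofReal (t ^ γ) * ‖gradient φ (scaleY t X)‖ₑ ^ 2 ∂(weightedMeasure n a) := by
        have : SFinite (weightedMeasure n a) := by unfold weightedMeasure; infer_instance
        rw [lintegral_const_mul, lintegral_lintegral_swap]
        · exact (hGm.comp measurable_swap).aemeasurable
        · exact Measurable.lintegral_prod_right' (f := fun p : Pt n × ℝ =>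
            ENNReal.ofReal (p.2 ^ γ) * ‖gradient φ (scaleY p.2 p.1)‖ₑ ^ 2) (hGm.comp measurable_swap)
    _ ≤ hardyConst a * ∫⁻ t in Set.Ioc (0 : ℝ) 1, ENNReal.ofReal (t ^ (-γ)) * ∫⁻ X, W X :=
        mul_le_mul_right (setLIntegral_mono' measurableSet_Ioc hscale) _
    _ = hardyConst a ^ 2 * ∫⁻ X, ‖gradient φ X‖ₑ ^ 2 ∂(weightedMeasure n a) := by
        rw [lintegral_mul_const _ (hm _), hWint, ← mul_assoc, sq]
        rfl

/-! ### Division of antisymmetric functions by `y|y|^{-a}` -/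

lemma tendsto_eLpNorm_two_of_dominated {α E : Type*} [MeasurableSpace α] [NormedAddCommGroup E]
    {μ : Measure α} {f : ℕ → α → E} {g : α → ℝ} (hf : ∀ k, AEStronglyMeasurable (f k) μ)
    (hg : MemLp g 2 μ) (hle : ∀ k, ∀ᵐ x ∂μ, ‖f k x‖ ≤ g x)
    (hlim : ∀ᵐ x ∂μ, Tendsto (fun k => f k x) atTop (𝓝 0)) :
    Tendsto (fun k => eLpNorm (f k) 2 μ) atTop (𝓝 0) := by
  have h : Tendsto (fun k => ∫⁻ x, ‖f k x‖ₑ ^ 2 ∂μ) atTop (𝓝 (∫⁻ _, 0 ∂μ)) := by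
    refine tendsto_lintegral_of_dominated_convergence' (fun x => ‖g x‖ₑ ^ 2)
      (fun k => (hf k).enorm.pow_const 2) (fun k => ?_) ?_ ?_
    · filter_upwards [hle k] with x hx
      refine pow_le_pow_left' ?_ 2
      rw [enorm_le_iff_norm_le]
      exact hx.trans (le_abs_self _)
    · rw [← eLpNorm_two_sq]
      exact (ENNReal.pow_lt_top hg.2).ne
    · filter_upwards [hlim] with x hx
      have := (continuous_enorm.tendsto (0 : E)).comp hx
      have h2 := (ENNReal.continuous_pow 2).tendsto (‖(0 : E)‖ₑ)
      simpa [Function.comp_def] using h2.comp this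
  rw [lintegral_zero] at h
  have h2 := (ENNReal.continuous_rpow_const (y := (1 / 2 : ℝ))).tendsto 0 |>.comp h
  simp only [Function.comp_def] at h2
  rw [ENNReal.zero_rpow_of_pos (by norm_num)] at h2
  refine h2.congr fun k => ?_
  rw [← eLpNorm_two_sq, ← ENNReal.rpow_natCast, ← ENNReal.rpow_mul]
  simp

lemma eLpNorm_weighted_congr {b b' : ℝ} {E F : Type*} [NormedAddCommGroup E]
    [NormedAddCommGroup F] {f : Pt n → E} {g : Pt n → F}
    (hf : AEStronglyMeasurable f (ballMeasure n)) (hg : AEStronglyMeasurable g (ballMeasure n))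
    (h : ∀ X : Pt n, yCoord X ≠ 0 → |yCoord X| ^ b * ‖f X‖ ^ 2 = |yCoord X| ^ b' * ‖g X‖ ^ 2) :
    eLpNorm f 2 (weightedMeasure n b) = eLpNorm g 2 (weightedMeasure n b') := by
  refine (ENNReal.pow_right_strictMono two_ne_zero).injective ?_
  rw [eLpNorm_two_sq, eLpNorm_two_sq, lintegral_weighted _ (hf.enorm.pow_const 2),
    lintegral_weighted _ (hg.enorm.pow_const 2)]
  refine lintegral_congr_ae ?_
  filter_upwards [ae_yCoord_ne_zero] with X hX
  rw [← ofReal_norm, ← ofReal_norm, ← ENNReal.ofReal_pow (norm_nonneg _),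
    ← ENNReal.ofReal_pow (norm_nonneg _), ← ENNReal.ofReal_mul (by positivity),
    ← ENNReal.ofReal_mul (by positivity), h X hX]

lemma measurable_abs_rpow (c : ℝ) : Measurable fun X : Pt n => |yCoord X| ^ c :=
  (measurable_yCoord.abs).pow_const c

lemma memLp_abs_rpow {b c : ℝ} (h : -1 < b + 2 * c) :
    MemLp (fun X : Pt n => |yCoord X| ^ c) 2 (weightedMeasure n b) := by
  have hm := (measurable_abs_rpow (n := n) c).aestronglyMeasurable (μ := ballMeasure n)
  refine ⟨(aestronglyMeasurable_weighted_iff b).2 hm, ?_⟩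
  have := isFiniteMeasure_weighted (n := n) h
  rw [eLpNorm_weighted_congr (b' := b + 2 * c) (g := fun _ => (1 : ℝ)) hm
    aestronglyMeasurable_const]
  · exact (memLp_const 1).2
  · intro X hX
    have hX' : 0 < |yCoord X| := abs_pos.2 hX
    rw [Real.norm_of_nonneg (by positivity), ← Real.rpow_natCast, ← Real.rpow_mul hX'.le,
      ← Real.rpow_add hX']
    simp [mul_comm]

/-- **Hardy's inequality** for limits of smooth functions vanishing on `{y = 0}`. -/
lemma hardy_limit {a : ℝ} (ha : a < 1) {u : Pt n → ℝ} {G : Pt n → Pt n} {φ : ℕ → Pt n → ℝ}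
    (hu : AEStronglyMeasurable u (ballMeasure n)) (hG : AEStronglyMeasurable G (ballMeasure n))
    (hφ : ∀ k, ContDiff ℝ ∞ (φ k)) (h0 : ∀ k X, yCoord X = 0 → φ k X = 0)
    (h1 : Tendsto (fun k => eLpNorm (fun X => φ k X - u X) 2 (weightedMeasure n a)) atTop (𝓝 0))
    (h2 : Tendsto (fun k => eLpNorm (fun X => gradient (φ k) X - G X) 2 (weightedMeasure n a))
      atTop (𝓝 0)) :
    eLpNorm (fun X => (yCoord X)⁻¹ * u X) 2 (weightedMeasure n a)
      ≤ hardyConst a * eLpNorm G 2 (weightedMeasure n a) := by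
  have hu' := (aestronglyMeasurable_weighted_iff a).2 hu
  have hG' := (aestronglyMeasurable_weighted_iff a).2 hG
  -- Along an almost everywhere convergent subsequence, Fatou's lemma carries the inequality from
  -- the smooth functions to the limit.
  obtain ⟨ns, hns, hae⟩ := (tendstoInMeasure_of_tendsto_eLpNorm two_ne_zero
    (fun k => (hφ k).continuous.aestronglyMeasurable) hu' h1).exists_seq_tendsto_ae
  have hlim : ∀ᵐ X ∂(weightedMeasure n a),
      Tendsto (fun k => (yCoord X)⁻¹ * φ (ns k) X) atTop (𝓝 ((yCoord X)⁻¹ * u X)) := by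
    filter_upwards [hae] with X hX
    exact hX.const_mul _
  refine (Lp.eLpNorm_lim_le_liminf_eLpNorm (fun k =>
    (measurable_yCoord.inv.mul (hφ (ns k)).continuous.measurable).aestronglyMeasurable) _
    hlim).trans ?_
  have ht : Tendsto (fun k => hardyConst a * (eLpNorm (fun X => gradient (φ (ns k)) X - G X) 2
      (weightedMeasure n a) + eLpNorm G 2 (weightedMeasure n a))) atTop
      (𝓝 (hardyConst a * (0 + eLpNorm G 2 (weightedMeasure n a)))) :=
    ENNReal.Tendsto.const_mul ((h2.comp hns.tendsto_atTop).add tendsto_const_nhds)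
      (Or.inr (hardyConst_lt_top ha).ne)
  rw [zero_add] at ht
  rw [← ht.liminf_eq]
  refine liminf_le_liminf (Eventually.of_forall fun k => ?_)
  refine (hardy_smooth (hφ (ns k)) (h0 (ns k))).trans (mul_le_mul_right ?_ _)
  have e : gradient (φ (ns k)) = (fun X => gradient (φ (ns k)) X - G X) + G := by ext; simp
  conv_lhs => rw [e]
  exact eLpNorm_add_le ((continuous_gradient (hφ _)).aestronglyMeasurable.sub hG') hG' (by norm_num)

/-- Mean value inequality between `X` and its foot point `(x, 0)`, which also lies in the convex
ball. -/
lemma exists_bound_of_vanishing {φ : Pt n → ℝ} (hφ : ContDiff ℝ ∞ φ)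
    (h0 : ∀ X, yCoord X = 0 → φ X = 0) :
    ∃ K : ℝ, 0 ≤ K ∧ ∀ X ∈ unitBall n, |φ X| ≤ K * |yCoord X| ∧ ‖gradient φ X‖ ≤ K := by
  obtain ⟨K, hK⟩ := (isCompact_closedBall (0 : Pt n) 1).exists_bound_of_continuousOn
    (continuous_gradient hφ).continuousOn
  have hK0 : 0 ≤ K := (norm_nonneg _).trans (hK 0 (by simp))
  refine ⟨K, hK0, fun X hX => ⟨?_, hK X (Metric.ball_subset_closedBall hX)⟩⟩
  have hb : ∀ Y ∈ unitBall n, ‖fderiv ℝ φ Y‖ ≤ K := fun Y hY => by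
    have := hK Y (Metric.ball_subset_closedBall hY)
    rwa [gradient, LinearIsometryEquiv.norm_map] at this
  have hX' : scaleY 0 X ∈ unitBall n :=
    mem_unitBall.2 ((norm_scaleY_le le_rfl zero_le_one X).trans_lt (mem_unitBall.1 hX))
  have := (convex_ball (0 : Pt n) 1).norm_image_sub_le_of_norm_fderiv_le
    (fun Y _ => hφ.differentiable (by simp) Y) hb hX' hX
  rw [h0 (scaleY 0 X) (by rw [yCoord_scaleY, zero_mul]), sub_zero] at this
  refine this.trans_eq ?_
  simp [scaleY, norm_smul, norm_eY]

/-- The function `u / (y|y|^{-a})`. -/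
def divOdd (a : ℝ) (u : Pt n → ℝ) (X : Pt n) : ℝ := yCoord X * |yCoord X| ^ (a - 2) * u X

/-- The gradient of `u / (y|y|^{-a})`, in terms of `u` and its gradient `G`. -/
def divOddGrad (a : ℝ) (u : Pt n → ℝ) (G : Pt n → Pt n) (X : Pt n) : Pt n :=
  (yCoord X * |yCoord X| ^ (a - 2)) • G X + (((a - 1) * |yCoord X| ^ (a - 2)) * u X) • eY n

lemma aestronglyMeasurable_divOdd {a : ℝ} {u : Pt n → ℝ} {μ : Measure (Pt n)}
    (hu : AEStronglyMeasurable u μ) : AEStronglyMeasurable (divOdd a u) μ :=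
  (measurable_yCoord.mul (measurable_abs_rpow _)).aestronglyMeasurable.mul hu

lemma aestronglyMeasurable_divOddGrad {a : ℝ} {u : Pt n → ℝ} {G : Pt n → Pt n}
    {μ : Measure (Pt n)} (hu : AEStronglyMeasurable u μ) (hG : AEStronglyMeasurable G μ) :
    AEStronglyMeasurable (divOddGrad a u G) μ :=
  ((measurable_yCoord.mul (measurable_abs_rpow _)).aestronglyMeasurable.smul hG).add
    (((measurable_const.mul (measurable_abs_rpow _)).aestronglyMeasurable.mul hu).smul
      aestronglyMeasurable_const)

/-- Arranged so that `η'` occurs only in the product `η'(y) y`, which is bounded uniformly in `k`.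
It is used with `c = a - 2` for the quotient `v` and with `c = -a` for the test function `φ
y|y|^{-a}`. -/
lemma gradient_cutPow_mul_yCoord_mul {φ : Pt n → ℝ} (hφ : ContDiff ℝ ∞ φ) (k : ℕ) (c : ℝ)
    {X : Pt n} (hX : yCoord X ≠ 0) :
    gradient (fun X => cutPow k c (yCoord X) * (yCoord X * φ X)) X
      = (cutoff k (yCoord X) * (yCoord X * |yCoord X| ^ c)) • gradient φ X
        + (cutoff k (yCoord X) * ((c + 1) * |yCoord X| ^ c * φ X)
          + deriv (cutoff k) (yCoord X) * yCoord X * |yCoord X| ^ c * φ X) • eY n := by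
  have hd : Differentiable ℝ (fun X : Pt n => yCoord X) :=
    (contDiff_yCoord (k := ∞)).differentiable (by simp)
  have hφd := hφ.differentiable (by simp)
  rw [gradient_cutPow_mul (φ := fun X => yCoord X * φ X) (hd.mul hφd), gradient_mul' (hd X) (hφd X)]
  have : gradient (fun X : Pt n => yCoord X) X = eY n := by
    have := gradient_comp_yCoord (X := X) (hasDerivAt_id (yCoord X))
    simpa using this
  rw [this, cutPow, smul_add, smul_smul, smul_smul, add_assoc, ← add_smul]
  congr 2
  · ring
  · field_simp; ring

lemma abs_rpow_mul_abs {y : ℝ} (hy : y ≠ 0) (c : ℝ) : |y| ^ c * |y| = |y| ^ (c + 1) := by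
  rw [Real.rpow_add_one (abs_ne_zero.2 hy)]

/-- The approximants are the quotients cut off near `Σ`. Since `φ = O(|y|)`, the gradient errors are
dominated by a multiple of `|y|^{a-1}`, whose square against `|y|^{2-a}` is `|y|^a`. This is
integrable because `a > -1`, so dominated convergence applies. -/
lemma hasSobolevGradient_divOdd_smooth {a : ℝ} (ha₁ : -1 < a) (ha₂ : a < 1) {φ : Pt n → ℝ}
    (hφ : ContDiff ℝ ∞ φ) (h0 : ∀ X, yCoord X = 0 → φ X = 0) :
    HasSobolevGradient (2 - a) (divOdd a φ) (divOddGrad a φ (gradient φ)) := by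
  have hb : -1 < 2 - a := by linarith
  obtain ⟨K, hK0, hK⟩ := exists_bound_of_vanishing hφ h0
  obtain ⟨C, hC0, hC⟩ := exists_abs_deriv_cutoff_mul_le
  have hφm := hφ.continuous.aestronglyMeasurable (μ := weightedMeasure n (2 - a))
  have hGm := (continuous_gradient hφ).aestronglyMeasurable (μ := weightedMeasure n (2 - a))
  have hs : ∀ k, ContDiff ℝ ∞ (fun X : Pt n => cutPow k (a - 2) (yCoord X) * (yCoord X * φ X)) :=
    fun k => contDiff_cutPow_mul (contDiff_yCoord.mul hφ) k _
  have hmem : MemLp (fun X : Pt n => |yCoord X| ^ (a - 1)) 2 (weightedMeasure n (2 - a)) :=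
    memLp_abs_rpow (by linarith)
  have hpow : ∀ X : Pt n, yCoord X ≠ 0 → |yCoord X| ^ (a - 2) * |yCoord X| = |yCoord X| ^ (a - 1) :=
    fun X hX => by rw [abs_rpow_mul_abs hX]; ring_nf
  have hdiv : ∀ X ∈ unitBall n, yCoord X ≠ 0 → |divOdd a φ X| ≤ K * |yCoord X| ^ (a - 1) := by
    intro X hX hy
    rw [divOdd, abs_mul, abs_mul, abs_of_nonneg (Real.rpow_nonneg (abs_nonneg _) _),
      mul_comm |yCoord X|, hpow X hy, mul_comm]
    refine mul_le_mul_of_nonneg_right ((hK X hX).1.trans ?_) (by positivity)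
    have := (abs_yCoord_le X).trans (mem_unitBall.1 hX).le
    nlinarith
  have hterm : ∀ X ∈ unitBall n, yCoord X ≠ 0 →
      |yCoord X| ^ (a - 2) * |φ X| ≤ K * |yCoord X| ^ (a - 1) := by
    intro X hX hy
    rw [← hpow X hy]
    have := mul_le_mul_of_nonneg_left (hK X hX).1 (Real.rpow_nonneg (abs_nonneg (yCoord X)) (a - 2))
    linarith
  have hgrad : ∀ X ∈ unitBall n, yCoord X ≠ 0 →
      ‖divOddGrad a φ (gradient φ) X‖ ≤ (K + |a - 1| * K) * |yCoord X| ^ (a - 1) := by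
    intro X hX hy
    refine (norm_add_le _ _).trans ?_
    rw [norm_smul, norm_smul, norm_eY, mul_one, add_mul]
    refine add_le_add ?_ ?_
    · rw [norm_mul, Real.norm_eq_abs, Real.norm_of_nonneg (Real.rpow_nonneg (abs_nonneg _) _),
        mul_comm |yCoord X|, hpow X hy, mul_comm]
      exact mul_le_mul_of_nonneg_right (hK X hX).2 (by positivity)
    · rw [norm_mul, norm_mul, Real.norm_eq_abs, Real.norm_eq_abs (φ X),
        Real.norm_of_nonneg (Real.rpow_nonneg (abs_nonneg _) _), mul_assoc, mul_assoc]
      exact mul_le_mul_of_nonneg_left (hterm X hX hy) (abs_nonneg _)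
  refine .of_tendsto hb (aestronglyMeasurable_divOdd hφm)
    (aestronglyMeasurable_divOddGrad hφm hGm) (fun k => .of_contDiff hb (hs k)) ?_ ?_
  · refine tendsto_eLpNorm_two_of_dominated (fun k => (hs k).continuous.aestronglyMeasurable.sub
      (aestronglyMeasurable_divOdd hφm)) (hmem.const_mul K) (fun k => ?_) ?_
    · rw [ae_weighted_iff]
      filter_upwards [ae_mem_unitBall, ae_yCoord_ne_zero] with X hX hy
      refine le_trans ?_ (hdiv X hX hy)
      have : cutPow k (a - 2) (yCoord X) * (yCoord X * φ X) - divOdd a φ X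
          = (cutoff k (yCoord X) - 1) * divOdd a φ X := by
        simp only [cutPow, divOdd]; ring
      rw [this, norm_mul, Real.norm_eq_abs, Real.norm_eq_abs]
      refine mul_le_of_le_one_left (abs_nonneg _) ?_
      rw [abs_le]; constructor <;> linarith [cutoff_nonneg k (yCoord X), cutoff_le_one k (yCoord X)]
    · rw [ae_weighted_iff]
      filter_upwards [ae_yCoord_ne_zero] with X hy
      have := ((tendsto_cutoff hy).sub_const 1).mul_const (divOdd a φ X)
      rw [sub_self, zero_mul] at this
      refine this.congr fun k => ?_
      simp only [cutPow, divOdd]; ring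
  · have key : ∀ k (X : Pt n), yCoord X ≠ 0 →
        gradient (fun X => cutPow k (a - 2) (yCoord X) * (yCoord X * φ X)) X
          - divOddGrad a φ (gradient φ) X
        = (cutoff k (yCoord X) - 1) • divOddGrad a φ (gradient φ) X
          + (deriv (cutoff k) (yCoord X) * yCoord X * |yCoord X| ^ (a - 2) * φ X) • eY n := by
      intro k X hy
      rw [gradient_cutPow_mul_yCoord_mul hφ k _ hy, divOddGrad]
      module
    refine tendsto_eLpNorm_two_of_dominated (fun k =>
      (continuous_gradient (hs k)).aestronglyMeasurable.sub
      (aestronglyMeasurable_divOddGrad hφm hGm)) (hmem.const_mul ((K + |a - 1| * K) + C * K))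
      (fun k => ?_) ?_
    · rw [ae_weighted_iff]
      filter_upwards [ae_mem_unitBall, ae_yCoord_ne_zero] with X hX hy
      rw [key k X hy]
      refine (norm_add_le _ _).trans ?_
      rw [add_mul, norm_smul, norm_smul, norm_eY, mul_one]
      refine add_le_add ?_ ?_
      · refine le_trans (mul_le_of_le_one_left (norm_nonneg _) ?_) (hgrad X hX hy)
        rw [Real.norm_eq_abs, abs_le]
        constructor <;> linarith [cutoff_nonneg k (yCoord X), cutoff_le_one k (yCoord X)]
      · rw [norm_mul, norm_mul, Real.norm_of_nonneg (Real.rpow_nonneg (abs_nonneg _) _),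
          mul_assoc, mul_assoc]
        exact mul_le_mul (hC k _) (hterm X hX hy) (by positivity) hC0
    · rw [ae_weighted_iff]
      filter_upwards [ae_yCoord_ne_zero] with X hy
      have h1 := ((tendsto_cutoff hy).sub_const 1).smul_const (divOddGrad a φ (gradient φ) X)
      have h2 := ((((tendsto_deriv_cutoff hy).mul_const (yCoord X)).mul_const
        (|yCoord X| ^ (a - 2))).mul_const (φ X)).smul_const (eY n)
      have h3 := h1.add h2
      simp only [sub_self, zero_smul, zero_mul, add_zero] at h3
      exact h3.congr fun k => (key k X hy).symm

/-- The duality between the exponents `a` and `2 - a`: dividing by `y|y|^{-a}` exchanges the two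
weighted `L²` norms. -/
lemma abs_rpow_mul_sq {y : ℝ} (hy : y ≠ 0) (a : ℝ) :
    |y| ^ (2 - a) * (y * |y| ^ (a - 2)) ^ 2 = |y| ^ a := by
  have hy' : 0 < |y| := abs_pos.2 hy
  rw [mul_pow, ← sq_abs, ← Real.rpow_two |y|, ← Real.rpow_two (_ ^ (a - 2)), ← Real.rpow_mul hy'.le,
    ← Real.rpow_add hy', ← Real.rpow_add hy']
  congr 1
  ring

lemma eLpNorm_mul_abs_rpow {a : ℝ} {E : Type*} [NormedAddCommGroup E] [NormedSpace ℝ E]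
    {f : Pt n → E} (hf : AEStronglyMeasurable f (ballMeasure n)) :
    eLpNorm (fun X => (yCoord X * |yCoord X| ^ (a - 2)) • f X) 2 (weightedMeasure n (2 - a))
      = eLpNorm f 2 (weightedMeasure n a) := by
  refine eLpNorm_weighted_congr
    ((measurable_yCoord.mul (measurable_abs_rpow _)).aestronglyMeasurable.smul hf) hf
    fun X hX => ?_
  rw [norm_smul, mul_pow, Real.norm_eq_abs, sq_abs, ← mul_assoc]
  congr 1
  exact abs_rpow_mul_sq hX a

lemma eLpNorm_abs_rpow_mul {a : ℝ} {f : Pt n → ℝ} (hf : AEStronglyMeasurable f (ballMeasure n)) :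
    eLpNorm (fun X => |yCoord X| ^ (a - 2) * f X) 2 (weightedMeasure n (2 - a))
      = eLpNorm (fun X => (yCoord X)⁻¹ * f X) 2 (weightedMeasure n a) := by
  refine eLpNorm_weighted_congr
    ((measurable_abs_rpow _).aestronglyMeasurable.mul hf)
    (measurable_yCoord.inv.aestronglyMeasurable.mul hf) fun X hX => ?_
  rw [← abs_rpow_mul_sq hX a]
  rw [norm_mul, norm_mul, mul_pow, mul_pow, mul_pow, norm_inv, inv_pow,
    Real.norm_eq_abs (yCoord X), sq_abs, Real.norm_eq_abs (_ ^ _), sq_abs]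
  field_simp

/-- Division is continuous from the limits of smooth functions vanishing on `Σ` to the weighted
space of exponent `2 - a`: the terms without a derivative of the weight are handled by the isometry,
the remaining one by Hardy's inequality. -/
lemma hasSobolevGradient_divOdd {a : ℝ} (ha₁ : -1 < a) (ha₂ : a < 1) {u : Pt n → ℝ}
    {G : Pt n → Pt n} {φ : ℕ → Pt n → ℝ}
    (hu : AEStronglyMeasurable u (ballMeasure n)) (hG : AEStronglyMeasurable G (ballMeasure n))
    (hφ : ∀ k, ContDiff ℝ ∞ (φ k)) (h0 : ∀ k X, yCoord X = 0 → φ k X = 0)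
    (h1 : Tendsto (fun k => eLpNorm (fun X => φ k X - u X) 2 (weightedMeasure n a)) atTop (𝓝 0))
    (h2 : Tendsto (fun k => eLpNorm (fun X => gradient (φ k) X - G X) 2 (weightedMeasure n a))
      atTop (𝓝 0)) :
    HasSobolevGradient (2 - a) (divOdd a u) (divOddGrad a u G) := by
  have hb : -1 < 2 - a := by linarith
  have hu' := (aestronglyMeasurable_weighted_iff (2 - a)).2 hu
  have hG' := (aestronglyMeasurable_weighted_iff (2 - a)).2 hG
  have hφm : ∀ k, AEStronglyMeasurable (φ k) (ballMeasure n) := fun k =>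
    (hφ k).continuous.aestronglyMeasurable
  have hgm : ∀ k, AEStronglyMeasurable (gradient (φ k)) (ballMeasure n) := fun k =>
    (continuous_gradient (hφ k)).aestronglyMeasurable
  refine .of_tendsto hb (aestronglyMeasurable_divOdd hu') (aestronglyMeasurable_divOddGrad hu' hG')
    (fun k => hasSobolevGradient_divOdd_smooth ha₁ ha₂ (hφ k) (h0 k)) ?_ ?_
  · refine h1.congr fun k => ?_
    refine (eLpNorm_mul_abs_rpow ((hφm k).sub hu)).symm.trans ?_
    congr 1; ext X
    simp only [divOdd, smul_eq_mul, Pi.sub_apply]; ring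
  · have hH : Tendsto (fun k => eLpNorm (fun X => (yCoord X)⁻¹ * (φ k X - u X)) 2
        (weightedMeasure n a)) atTop (𝓝 0) := by
      have hlim : Tendsto (fun k => hardyConst a *
          eLpNorm (fun X => gradient (φ k) X - G X) 2 (weightedMeasure n a)) atTop (𝓝 0) := by
        have := ENNReal.Tendsto.const_mul (a := hardyConst a) h2
          (Or.inr (hardyConst_lt_top ha₂).ne)
        rwa [mul_zero] at this
      refine tendsto_of_tendsto_of_tendsto_of_le_of_le tendsto_const_nhds hlim
        (fun _ => zero_le) fun k => ?_
      -- Hardy's inequality is needed for the error `φ_k - u`, which is not smooth. It is the limit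
      -- in `j` of `φ_k - φ_j`, and these vanish on `Σ`.
      refine hardy_limit ha₂ (φ := fun j X => φ k X - φ j X) ((hφm k).sub hu) ((hgm k).sub hG)
        (fun j => (hφ k).sub (hφ j)) (fun j X hX => by simp [h0 _ X hX])
        (h1.congr fun j => ?_) (h2.congr fun j => ?_)
      · rw [← eLpNorm_neg]
        congr 1; ext X
        simp only [Pi.neg_apply]; ring
      · rw [← eLpNorm_neg]
        congr 1; funext X
        rw [gradient_sub' ((hφ k).differentiable (by simp) X) ((hφ j).differentiable (by simp) X)]
        simp only [Pi.neg_apply]; abel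
    have hsum := h2.add (ENNReal.Tendsto.const_mul (a := ‖a - 1‖ₑ) hH (Or.inr (by simp)))
    rw [mul_zero, add_zero] at hsum
    refine tendsto_of_tendsto_of_tendsto_of_le_of_le tendsto_const_nhds hsum
      (fun _ => zero_le) fun k => ?_
    have e1 : eLpNorm (fun X => |yCoord X| ^ (a - 2) * (φ k X - u X)) 2
        (weightedMeasure n (2 - a)) = eLpNorm (fun X => (yCoord X)⁻¹ * (φ k X - u X)) 2
        (weightedMeasure n a) := eLpNorm_abs_rpow_mul ((hφm k).sub hu)
    have e2 : eLpNorm (fun X => (yCoord X * |yCoord X| ^ (a - 2)) • (gradient (φ k) X - G X)) 2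
        (weightedMeasure n (2 - a)) = eLpNorm (fun X => gradient (φ k) X - G X) 2
        (weightedMeasure n a) := eLpNorm_mul_abs_rpow ((hgm k).sub hG)
    simp only
    rw [← e1, ← e2, ← eLpNorm_const_smul]
    have hm1 : AEStronglyMeasurable
        (fun X => (yCoord X * |yCoord X| ^ (a - 2)) • (gradient (φ k) X - G X))
        (weightedMeasure n (2 - a)) :=
      (measurable_yCoord.mul (measurable_abs_rpow _)).aestronglyMeasurable.smul
        ((aestronglyMeasurable_weighted_iff _).2 ((hgm k).sub hG))
    have hm2 : AEStronglyMeasurable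
        (fun X => ((a - 1) * (|yCoord X| ^ (a - 2) * (φ k X - u X))) • eY n)
        (weightedMeasure n (2 - a)) :=
      (((measurable_abs_rpow _).aestronglyMeasurable.mul
        ((aestronglyMeasurable_weighted_iff _).2 ((hφm k).sub hu))).const_mul _).smul
        aestronglyMeasurable_const
    have e : (fun X => divOddGrad a (φ k) (gradient (φ k)) X - divOddGrad a u G X)
        = (fun X => (yCoord X * |yCoord X| ^ (a - 2)) • (gradient (φ k) X - G X))
          + fun X => ((a - 1) * (|yCoord X| ^ (a - 2) * (φ k X - u X))) • eY n := by
      funext X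
      simp only [divOddGrad, Pi.add_apply]
      module
    rw [e]
    refine (eLpNorm_add_le hm1 hm2 (by norm_num)).trans (add_le_add le_rfl ?_)
    refine (eLpNorm_congr_norm_ae (Eventually.of_forall fun X => ?_)).le
    simp [norm_smul, norm_eY]

/-- Cauchy–Schwarz with `1 = |y|^{-a/2} |y|^{a/2}`. For `a < 1` the first factor is finite, so
weighted `L²` embeds in unweighted `L¹` and the weighted gradient can be used as an ordinary weak
derivative. -/
lemma lintegral_ball_le {a : ℝ} {E : Type*} [NormedAddCommGroup E] {f : Pt n → E}
    (hf : AEStronglyMeasurable f (ballMeasure n)) :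
    ∫⁻ X, ‖f X‖ₑ ∂(ballMeasure n) ≤
      (∫⁻ X, ENNReal.ofReal (|yCoord X| ^ (-a)) ∂(ballMeasure n)) ^ (1 / 2 : ℝ)
        * eLpNorm f 2 (weightedMeasure n a) := by
  have h := ENNReal.lintegral_mul_le_Lp_mul_Lq (ballMeasure n) Real.HolderConjugate.two_two
    (f := fun X => ENNReal.ofReal (|yCoord X| ^ (-a / 2)))
    (g := fun X => ENNReal.ofReal (|yCoord X| ^ (a / 2)) * ‖f X‖ₑ)
    (measurable_weight _).aemeasurable ((measurable_weight _).aemeasurable.mul hf.enorm)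
  have hsq : ∀ (c : ℝ) (X : Pt n),
      ENNReal.ofReal (|yCoord X| ^ (c / 2)) ^ (2 : ℝ) = ENNReal.ofReal (|yCoord X| ^ c) := by
    intro c X
    rw [ENNReal.ofReal_rpow_of_nonneg (Real.rpow_nonneg (abs_nonneg _) _) (by norm_num),
      ← Real.rpow_mul (abs_nonneg _)]
    congr 2; ring
  have e1 : ∫⁻ X, ‖f X‖ₑ ∂(ballMeasure n) = ∫⁻ X,
      ((fun X : Pt n => ENNReal.ofReal (|yCoord X| ^ (-a / 2))) *
        fun X : Pt n => ENNReal.ofReal (|yCoord X| ^ (a / 2)) * ‖f X‖ₑ) X ∂(ballMeasure n) := by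
    refine lintegral_congr_ae ?_
    filter_upwards [ae_yCoord_ne_zero] with X hX
    have : -a / 2 + a / 2 = 0 := by ring
    rw [Pi.mul_apply, ← mul_assoc, ← ENNReal.ofReal_mul (Real.rpow_nonneg (abs_nonneg _) _),
      ← Real.rpow_add (abs_pos.2 hX), this]
    simp
  rw [e1]
  refine h.trans_eq ?_
  congr 1
  · simp only [hsq]
  · have e : eLpNorm f 2 (weightedMeasure n a)
        = (eLpNorm f 2 (weightedMeasure n a) ^ 2) ^ (1 / 2 : ℝ) := by
      rw [← ENNReal.rpow_natCast, ← ENNReal.rpow_mul]; simp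
    rw [e, eLpNorm_two_sq, lintegral_weighted _ (hf.enorm.pow_const 2)]
    congr 1
    refine lintegral_congr fun X => ?_
    rw [ENNReal.mul_rpow_of_nonneg _ _ (by norm_num), hsq]
    congr 1
    exact ENNReal.rpow_natCast _ 2

lemma lintegral_abs_rpow_lt_top {c : ℝ} (hc : -1 < c) :
    ∫⁻ X, ENNReal.ofReal (|yCoord X| ^ c) ∂(ballMeasure n) < ⊤ :=
  (integrable_abs_rpow hc).lintegral_lt_top

lemma integrable_ball_of_memLp {a : ℝ} (ha : a < 1) {E : Type*} [NormedAddCommGroup E]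
    {f : Pt n → E} (hf : MemLp f 2 (weightedMeasure n a)) : Integrable f (ballMeasure n) := by
  have hm := (aestronglyMeasurable_weighted_iff a).1 hf.1
  refine ⟨hm, (lintegral_ball_le hm).trans_lt (ENNReal.mul_lt_top ?_ hf.2)⟩
  exact ENNReal.rpow_lt_top_of_nonneg (by norm_num)
    (lintegral_abs_rpow_lt_top (by linarith)).ne

lemma tendsto_lintegral_ball {a : ℝ} (ha : a < 1) {E : Type*} [NormedAddCommGroup E]
    {f : ℕ → Pt n → E} (hf : ∀ k, AEStronglyMeasurable (f k) (ballMeasure n))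
    (h : Tendsto (fun k => eLpNorm (f k) 2 (weightedMeasure n a)) atTop (𝓝 0)) :
    Tendsto (fun k => ∫⁻ X, ‖f k X‖ₑ ∂(ballMeasure n)) atTop (𝓝 0) := by
  have hK : (∫⁻ X, ENNReal.ofReal (|yCoord X| ^ (-a)) ∂(ballMeasure n)) ^ (1 / 2 : ℝ) ≠ ⊤ :=
    (ENNReal.rpow_lt_top_of_nonneg (by norm_num)
      (lintegral_abs_rpow_lt_top (by linarith)).ne).ne
  have := ENNReal.Tendsto.const_mul h (Or.inr hK)
  rw [mul_zero] at this
  exact tendsto_of_tendsto_of_tendsto_of_le_of_le tendsto_const_nhds this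
    (fun _ => zero_le) fun k => lintegral_ball_le (hf k)

lemma integral_ball_eq {f : Pt n → ℝ} (h : ∀ X, X ∉ unitBall n → f X = 0) :
    ∫ X, f X ∂(ballMeasure n) = ∫ X, f X :=
  setIntegral_eq_integral_of_forall_compl_eq_zero h

lemma gradient_eq_zero_of_notMem_tsupport {φ : Pt n → ℝ} {X : Pt n} (h : X ∉ tsupport φ) :
    gradient φ X = 0 := by
  have : fderiv ℝ φ X = 0 := by
    by_contra h'
    exact h (support_fderiv_subset ℝ h')
  rw [gradient, this, map_zero]

/-- Integration by parts of a smooth function against a test function. -/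
lemma integral_inner_gradient_mul_eq {ψ φ : Pt n → ℝ} (hψ : ContDiff ℝ ∞ ψ)
    (hφ : ContDiff ℝ ∞ φ) (hc : HasCompactSupport φ) (e : Pt n) :
    ∫ X, ψ X * inner ℝ (gradient φ X) e = -∫ X, inner ℝ (gradient ψ X) e * φ X := by
  simp only [inner_gradient_left]
  have hfd : ∀ {f : Pt n → ℝ}, ContDiff ℝ ∞ f → Continuous fun X => fderiv ℝ f X e := fun hf =>
    (hf.continuous_fderiv (by simp)).clm_apply continuous_const
  refine integral_mul_fderiv_eq_neg_fderiv_mul_of_integrable ?_ ?_ ?_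
    (fun X _ => hψ.differentiable (by simp) X) (fun X _ => hφ.differentiable (by simp) X)
  · exact ((hfd hψ).mul hφ.continuous).integrable_of_hasCompactSupport hc.mul_left
  · exact (hψ.continuous.mul (hfd hφ)).integrable_of_hasCompactSupport
      (hc.fderiv_apply ℝ e).mul_left
  · exact (hψ.continuous.mul hφ.continuous).integrable_of_hasCompactSupport hc.mul_left

lemma tendsto_integral_of_lintegral_sub {α E : Type*} [MeasurableSpace α] [NormedAddCommGroup E]
    {μ : Measure α} {f : ℕ → α → ℝ} {g : α → ℝ} {h : ℕ → α → E} (C : ℝ)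
    (hf : ∀ k, Integrable (f k) μ) (hg : Integrable g μ)
    (hle : ∀ k, ∀ᵐ x ∂μ, |f k x - g x| ≤ C * ‖h k x‖)
    (hh : Tendsto (fun k => ∫⁻ x, ‖h k x‖ₑ ∂μ) atTop (𝓝 0)) :
    Tendsto (fun k => ∫ x, f k x ∂μ) atTop (𝓝 (∫ x, g x ∂μ)) := by
  refine tendsto_integral_of_L1 g hg.aestronglyMeasurable (Eventually.of_forall hf) ?_
  have := ENNReal.Tendsto.const_mul (a := ENNReal.ofReal C) hh (Or.inr (by simp))
  rw [mul_zero] at this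
  refine tendsto_of_tendsto_of_tendsto_of_le_of_le tendsto_const_nhds this
    (fun _ => zero_le) fun k => ?_
  simp only
  rw [← lintegral_const_mul' _ _ (by simp)]
  refine lintegral_mono_ae ?_
  filter_upwards [hle k] with x hx
  rw [← ofReal_norm, ← ofReal_norm]
  by_cases hC : 0 ≤ C
  · rw [← ENNReal.ofReal_mul hC]
    exact ENNReal.ofReal_le_ofReal hx
  · have h1 : ‖f k x - g x‖ ≤ 0 := hx.trans (mul_nonpos_of_nonpos_of_nonneg (not_le.1 hC).le
      (norm_nonneg _))
    rw [ENNReal.ofReal_of_nonpos h1]; exact zero_le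

/-- Weak derivatives in the classical sense, for `a < 1`. -/
lemma HasSobolevGradient.integral_yCoord_mul {a : ℝ} (ha : a < 1) {u : Pt n → ℝ}
    {G : Pt n → Pt n} (h : HasSobolevGradient a u G) {φ : Pt n → ℝ} (hφ : ContDiff ℝ ∞ φ)
    (hc : HasCompactSupport φ) (hs : tsupport φ ⊆ unitBall n) :
    ∫ X, u X * yCoord (gradient φ X) ∂(ballMeasure n)
      = -∫ X, φ X * yCoord (G X) ∂(ballMeasure n) := by
  obtain ⟨h1, h2, ψ, hψ, h3, h4⟩ := h
  obtain ⟨C, hC⟩ := hc.exists_bound_of_continuous hφ.continuous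
  obtain ⟨D, hD⟩ := (hc.fderiv ℝ).exists_bound_of_continuous (hφ.continuous_fderiv (by simp))
  have hD' : ∀ X, |yCoord (gradient φ X)| ≤ D := fun X =>
    (abs_yCoord_le _).trans (by rw [gradient, LinearIsometryEquiv.norm_map]; exact hD X)
  have hyg : Continuous fun X => yCoord (gradient φ X) :=
    continuous_yCoord.comp (continuous_gradient hφ)
  have hu := integrable_ball_of_memLp ha h1
  have hG := integrable_ball_of_memLp ha h2
  have hψi : ∀ k, Integrable (ψ k) (ballMeasure n) := fun k => by
    have hk := memLp_weighted_of_continuous (n := n) (b := 0) (by norm_num) (hψ k).continuous 2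
    exact integrable_ball_of_memLp (by norm_num) hk
  have hgi : ∀ k, Integrable (gradient (ψ k)) (ballMeasure n) := fun k => by
    have hk := memLp_weighted_of_continuous (n := n) (b := 0) (by norm_num)
      (continuous_gradient (hψ k)) 2
    exact integrable_ball_of_memLp (by norm_num) hk
  have int1 : ∀ {f : Pt n → ℝ}, Integrable f (ballMeasure n) →
      Integrable (fun X => f X * yCoord (gradient φ X)) (ballMeasure n) := fun hf =>
    hf.mul_bdd hyg.aestronglyMeasurable (Eventually.of_forall hD')
  have int2 : ∀ {F : Pt n → Pt n}, Integrable F (ballMeasure n) →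
      Integrable (fun X => φ X * yCoord (F X)) (ballMeasure n) := fun hF =>
    ((yProj n).integrable_comp hF).bdd_mul hφ.continuous.aestronglyMeasurable
      (Eventually.of_forall hC)
  have lim1 : Tendsto (fun k => ∫ X, ψ k X * yCoord (gradient φ X) ∂(ballMeasure n)) atTop
      (𝓝 (∫ X, u X * yCoord (gradient φ X) ∂(ballMeasure n))) := by
    refine tendsto_integral_of_lintegral_sub (h := fun k X => ψ k X - u X) D
      (fun k => int1 (hψi k)) (int1 hu) (fun k => Eventually.of_forall fun X => ?_)
      (tendsto_lintegral_ball ha (fun k => (hψi k).1.sub hu.1) h3)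
    rw [← sub_mul, abs_mul, mul_comm]
    exact mul_le_mul_of_nonneg_right (hD' X) (abs_nonneg _)
  have lim2 : Tendsto (fun k => ∫ X, φ X * yCoord (gradient (ψ k) X) ∂(ballMeasure n)) atTop
      (𝓝 (∫ X, φ X * yCoord (G X) ∂(ballMeasure n))) := by
    refine tendsto_integral_of_lintegral_sub (h := fun k X => gradient (ψ k) X - G X) C
      (fun k => int2 (hgi k)) (int2 hG) (fun k => Eventually.of_forall fun X => ?_)
      (tendsto_lintegral_ball ha (fun k => (hgi k).1.sub hG.1) h4)
    rw [← mul_sub, abs_mul]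
    exact mul_le_mul (hC X) (abs_yCoord_le (gradient (ψ k) X - G X)) (abs_nonneg _)
      ((norm_nonneg _).trans (hC X))
  refine tendsto_nhds_unique lim1 (lim2.neg.congr fun k => ?_)
  rw [integral_ball_eq fun X hX => ?_, integral_ball_eq fun X hX => ?_]
  · have := integral_inner_gradient_mul_eq (hψ k) hφ hc (eY n)
    simp only [inner_eY] at this
    rw [this]
    congr 2; ext X; ring
  · rw [gradient_eq_zero_of_notMem_tsupport fun h => hX (hs h)]
    simp [yCoord]
  · rw [image_eq_zero_of_notMem_tsupport fun h => hX (hs h), zero_mul]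

/-- In the flux `|y|^{2-a}∇v = y∇u + (a-1)u e_y` all singular powers cancel. The equation tested
with `φ y|y|^{-a}` and the unweighted integration by parts in `y` then combine to zero. No parity is
needed here. -/
lemma weakDivFree_divOddGrad {a : ℝ} (ha₂ : a < 1) {u : Pt n → ℝ}
    {G : Pt n → Pt n} (h : HasSobolevGradient a u G) (hw : WeakDivFree a G) :
    WeakDivFree (2 - a) (divOddGrad a u G) := by
  intro φ hφ hc hs
  obtain ⟨C, hC0, hC⟩ := exists_abs_deriv_cutoff_mul_le
  obtain ⟨K, hK⟩ := hc.exists_bound_of_continuous hφ.continuous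
  obtain ⟨D, hD⟩ := (hc.fderiv ℝ).exists_bound_of_continuous (hφ.continuous_fderiv (by simp))
  have hD' : ∀ X, ‖gradient φ X‖ ≤ D := fun X => by
    rw [gradient, LinearIsometryEquiv.norm_map]; exact hD X
  have hK0 : 0 ≤ K := (norm_nonneg _).trans (hK 0)
  have hD0 : 0 ≤ D := (norm_nonneg _).trans (hD' 0)
  have hu := integrable_ball_of_memLp ha₂ h.1
  have hG := integrable_ball_of_memLp ha₂ h.2.1
  have hgc := continuous_gradient hφ
  have hyg : Continuous fun X => yCoord (gradient φ X) := continuous_yCoord.comp hgc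
  -- The equation for `u`, tested with `φ y|y|^{-a}`.
  let F : Pt n → ℝ := fun X => yCoord X * inner ℝ (G X) (gradient φ X)
    + (1 - a) * (φ X * yCoord (G X))
  have hFm : AEStronglyMeasurable F (ballMeasure n) :=
    (measurable_yCoord.aestronglyMeasurable.mul (hG.1.inner hgc.aestronglyMeasurable)).add
      ((hφ.continuous.aestronglyMeasurable.mul
        (continuous_yCoord.comp_aestronglyMeasurable hG.1)).const_mul _)
  have hFle : ∀ X ∈ unitBall n, |F X| ≤ (D + |1 - a| * K) * ‖G X‖ := by
    intro X hX
    refine (abs_add_le _ _).trans ?_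
    rw [add_mul]
    refine add_le_add ?_ ?_
    · rw [abs_mul]
      have h1 := (abs_yCoord_le X).trans (mem_unitBall.1 hX).le
      have h2 : |inner ℝ (G X) (gradient φ X)| ≤ ‖G X‖ * D := (abs_real_inner_le_norm _ _).trans
        (mul_le_mul_of_nonneg_left (hD' X) (norm_nonneg _))
      calc _ ≤ 1 * (‖G X‖ * D) := mul_le_mul h1 h2 (abs_nonneg _) zero_le_one
        _ = _ := by ring
    · rw [abs_mul, abs_mul, mul_assoc]
      exact mul_le_mul_of_nonneg_left (mul_le_mul (hK X) (abs_yCoord_le _) (abs_nonneg _) hK0)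
        (abs_nonneg _)
  have hF0 : ∫ X, F X ∂(ballMeasure n) = 0 := by
    have hs' : ∀ k, ContDiff ℝ ∞ (fun X : Pt n => cutPow k (-a) (yCoord X) * (yCoord X * φ X)) :=
      fun k => contDiff_cutPow_mul (contDiff_yCoord.mul hφ) k _
    have hz : ∀ k, ∫ X, |yCoord X| ^ a * inner ℝ (G X) (gradient
        (fun X : Pt n => cutPow k (-a) (yCoord X) * (yCoord X * φ X)) X) ∂(ballMeasure n) = 0 := by
      intro k
      refine hw _ (hs' k) ?_ ?_
      · have h1 : HasCompactSupport fun X => yCoord X * φ X := hc.mul_left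
        exact h1.mul_left
      · refine (tsupport_mul_subset_right (f := fun X => cutPow k (-a) (yCoord X))
          (g := fun X => yCoord X * φ X)).trans ?_
        exact (tsupport_mul_subset_right (f := yCoord) (g := φ)).trans hs
    -- The cutoff makes `φ y|y|^{-a}` an admissible smooth test function. Its derivative enters only
    -- through `η_k'(y) y`, bounded and tending to zero off `Σ`, so the extra term disappears in the
    -- limit.
    have key : ∀ k (X : Pt n), yCoord X ≠ 0 → |yCoord X| ^ a * inner ℝ (G X) (gradient
        (fun X : Pt n => cutPow k (-a) (yCoord X) * (yCoord X * φ X)) X)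
        = cutoff k (yCoord X) * F X
          + deriv (cutoff k) (yCoord X) * yCoord X * (φ X * yCoord (G X)) := by
      intro k X hX
      rw [gradient_cutPow_mul_yCoord_mul hφ k _ hX, inner_add_right, inner_smul_right,
        inner_smul_right, inner_eY]
      have hp : |yCoord X| ^ a * |yCoord X| ^ (-a) = 1 := by
        rw [← Real.rpow_add (abs_pos.2 hX)]; simp
      simp only [F]
      linear_combination (cutoff k (yCoord X) * yCoord X * inner ℝ (G X) (gradient φ X)
        + (cutoff k (yCoord X) * (1 - a) * φ X + deriv (cutoff k) (yCoord X) * yCoord X * φ X)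
          * yCoord (G X)) * hp
    have hlim := tendsto_integral_of_dominated_convergence (μ := ballMeasure n)
      (F := fun k X => |yCoord X| ^ a * inner ℝ (G X) (gradient
        (fun X : Pt n => cutPow k (-a) (yCoord X) * (yCoord X * φ X)) X)) (f := F)
      (fun X => ((D + |1 - a| * K) + C * K) * ‖G X‖)
      (fun k => (measurable_abs_rpow a).aestronglyMeasurable.mul
        (hG.1.inner (continuous_gradient (hs' k)).aestronglyMeasurable))
      (hG.norm.const_mul _) (fun k => ?_) ?_
    · simp only [hz] at hlim
      exact tendsto_nhds_unique hlim tendsto_const_nhds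
    · filter_upwards [ae_mem_unitBall, ae_yCoord_ne_zero] with X hX hy
      rw [key k X hy]
      refine (norm_add_le _ _).trans ?_
      rw [add_mul]
      refine add_le_add ?_ ?_
      · rw [norm_mul]
        exact (mul_le_of_le_one_left (norm_nonneg _) (abs_cutoff_le_one k _)).trans (hFle X hX)
      · rw [norm_mul, norm_mul (φ X), mul_assoc]
        exact mul_le_mul (hC k _) (mul_le_mul (hK X) (abs_yCoord_le _) (abs_nonneg _) hK0)
          (by positivity) hC0
    · filter_upwards [ae_yCoord_ne_zero] with X hy
      have h1 := (tendsto_cutoff hy).mul_const (F X)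
      have h2 := ((tendsto_deriv_cutoff hy).mul_const (yCoord X)).mul_const (φ X * yCoord (G X))
      have h3 := h1.add h2
      simp only [one_mul, zero_mul, add_zero] at h3
      exact h3.congr fun k => (key k X hy).symm
  have hibp := h.integral_yCoord_mul ha₂ hφ hc hs
  have hFi : Integrable F (ballMeasure n) := by
    refine (hG.norm.const_mul (D + |1 - a| * K)).mono' hFm ?_
    filter_upwards [ae_mem_unitBall] with X hX
    exact hFle X hX
  have int1 : Integrable (fun X => u X * yCoord (gradient φ X)) (ballMeasure n) :=
    hu.mul_bdd hyg.aestronglyMeasurable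
      (Eventually.of_forall fun X => (abs_yCoord_le _).trans (hD' X))
  have int2 : Integrable (fun X => φ X * yCoord (G X)) (ballMeasure n) :=
    ((yProj n).integrable_comp hG).bdd_mul hφ.continuous.aestronglyMeasurable
      (Eventually.of_forall hK)
  have int3 : Integrable (fun X => (1 - a) * (φ X * yCoord (G X) + u X * yCoord (gradient φ X)))
      (ballMeasure n) := (int2.add int1).const_mul _
  have hfin : ∫ X, |yCoord X| ^ (2 - a) * inner ℝ (divOddGrad a u G X) (gradient φ X)
      ∂(ballMeasure n) = ∫ X, (F X - (1 - a) * (φ X * yCoord (G X)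
        + u X * yCoord (gradient φ X))) ∂(ballMeasure n) := by
    refine integral_congr_ae ?_
    filter_upwards [ae_yCoord_ne_zero] with X hX
    have hp : |yCoord X| ^ (2 - a) * |yCoord X| ^ (a - 2) = 1 := by
      rw [← Real.rpow_add (abs_pos.2 hX)]; simp
    rw [divOddGrad, inner_add_left, inner_smul_left, inner_smul_left, inner_eY_left]
    simp only [F, RCLike.conj_to_real]
    linear_combination (yCoord X * inner ℝ (G X) (gradient φ X)
      + (a - 1) * u X * yCoord (gradient φ X)) * hp
  rw [hfin, integral_sub hFi int3, hF0, integral_const_mul,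
    integral_add int2 int1, hibp]
  ring

/-- The quotient of an antisymmetric `L_a`-harmonic function by `y|y|^{-a}` is `L_{2-a}`-harmonic. -/
lemma isLHarmonic_divOdd {a : ℝ} (ha₁ : -1 < a) (ha₂ : a < 1) {u : Pt n → ℝ}
    (hu : IsLHarmonic a u) (ho : IsAntisymmetricInY u) : IsLHarmonic (2 - a) (divOdd a u) := by
  obtain ⟨G, hG, hw⟩ := hu
  have hR := measurePreserving_reflectY_weighted (n := n) a
  have hGr := hG.reflect
  have hGr' := hGr.const_mul (-(1 / 2))
  have hGh := hG.const_mul (1 / 2)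
  -- The odd parts of the approximants vanish on `Σ`, and their gradients converge to `G'`. Working
  -- with `G'` instead of `G` avoids proving that the weighted gradient is unique.
  let G' : Pt n → Pt n := fun X => (1 / 2 : ℝ) • G X + (-(1 / 2) : ℝ) • reflectY (G (reflectY X))
  have hsum := hGh.add ha₁ hGr'
  have hue : u =ᵐ[ballMeasure n] fun X => 1 / 2 * u X + -(1 / 2) * u (reflectY X) := by
    filter_upwards [ho] with X hX
    rw [hX]; ring
  have hu' : HasSobolevGradient a u G' := hsum.congr hue
  have hw' : WeakDivFree a G' := WeakDivFree.add ha₁ hGh.2.1 hGr'.2.1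
    (WeakDivFree.const_smul _ hw) (WeakDivFree.const_smul _ (WeakDivFree.reflect hw))
  obtain ⟨h1, h2, φ, hφ, h3, h4⟩ := hG
  refine ⟨divOddGrad a u G', ?_, weakDivFree_divOddGrad ha₂ hu' hw'⟩
  have hd : ∀ k, Differentiable ℝ (φ k) := fun k => (hφ k).differentiable (by simp)
  have hφr : ∀ k, ContDiff ℝ ∞ fun X => φ k (reflectY X) := fun k =>
    (hφ k).comp contDiff_reflectY
  have hdr : ∀ k, Differentiable ℝ (fun X => φ k (reflectY X)) := fun k =>
    (hφr k).differentiable (by simp)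
  have halves : ∀ {E : Type} [NormedAddCommGroup E] [NormedSpace ℝ E] (f g : Pt n → E),
      AEStronglyMeasurable f (weightedMeasure n a) → AEStronglyMeasurable g (weightedMeasure n a) →
      eLpNorm (fun X => (1 / 2 : ℝ) • f X + (-(1 / 2) : ℝ) • g X) 2 (weightedMeasure n a)
      ≤ eLpNorm f 2 (weightedMeasure n a) + eLpNorm g 2 (weightedMeasure n a) := by
    intro E _ _ f g hf hg
    refine (eLpNorm_add_le (hf.const_smul _) (hg.const_smul _) (by norm_num)).trans
      (add_le_add ?_ ?_)
    · refine eLpNorm_mono fun X => ?_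
      rw [Pi.smul_apply, norm_smul]
      refine mul_le_of_le_one_left (norm_nonneg _) ?_
      norm_num
    · refine eLpNorm_mono fun X => ?_
      rw [Pi.smul_apply, norm_smul]
      refine mul_le_of_le_one_left (norm_nonneg _) ?_
      norm_num
  have hc : Continuous (reflectY : Pt n → Pt n) := (contDiff_reflectY (k := 0)).continuous
  refine hasSobolevGradient_divOdd ha₁ ha₂
    (φ := fun k X => 1 / 2 * φ k X + -(1 / 2) * φ k (reflectY X))
    ((aestronglyMeasurable_weighted_iff a).1 hu'.1.1)
    ((aestronglyMeasurable_weighted_iff a).1 hu'.2.1.1)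
    (fun k => (contDiff_const.mul (hφ k)).add (contDiff_const.mul (hφr k))) ?_ ?_ ?_
  · intro k X hX
    rw [reflectY_eq_sub, hX]; simp
  · have ht := h3.add h3
    rw [add_zero] at ht
    refine tendsto_of_tendsto_of_tendsto_of_le_of_le tendsto_const_nhds ht
      (fun _ => zero_le) fun k => ?_
    have hm := (hφ k).continuous.aestronglyMeasurable.sub h1.1
    have e : (fun X => 1 / 2 * φ k X + -(1 / 2) * φ k (reflectY X) - u X)
        =ᵐ[weightedMeasure n a] fun X => (1 / 2 : ℝ) • (φ k X - u X)
          + (-(1 / 2) : ℝ) • (φ k (reflectY X) - u (reflectY X)) := by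
      rw [EventuallyEq, ae_weighted_iff]
      filter_upwards [hue] with X hX
      rw [smul_eq_mul, smul_eq_mul]
      linear_combination -hX
    simp only
    rw [eLpNorm_congr_ae e]
    refine (halves _ _ hm (hm.comp_measurePreserving hR)).trans (add_le_add le_rfl ?_)
    exact (eLpNorm_comp_measurePreserving hm hR).le
  · have ht := h4.add h4
    rw [add_zero] at ht
    refine tendsto_of_tendsto_of_tendsto_of_le_of_le tendsto_const_nhds ht
      (fun _ => zero_le) fun k => ?_
    have hm := (continuous_gradient (hφ k)).aestronglyMeasurable.sub h2.1
    have hm' : AEStronglyMeasurable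
        (fun X => reflectY (gradient (φ k) (reflectY X) - G (reflectY X))) (weightedMeasure n a) :=
      hc.comp_aestronglyMeasurable (hm.comp_measurePreserving hR)
    have e : (fun X => gradient (fun X => 1 / 2 * φ k X + -(1 / 2) * φ k (reflectY X)) X - G' X)
        = fun X => (1 / 2 : ℝ) • (gradient (φ k) X - G X)
          + (-(1 / 2) : ℝ) • reflectY (gradient (φ k) (reflectY X) - G (reflectY X)) := by
      funext X
      rw [gradient_add' ((hd k X).const_mul _) ((hdr k X).const_mul _),
        gradient_const_mul' _ (hd k X), gradient_const_mul' _ (hdr k X),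
        gradient_comp_reflectY (hd k), reflectY_sub]
      simp only [G']
      module
    simp only
    rw [e]
    refine (halves _ _ hm hm').trans (add_le_add le_rfl ?_)
    refine (eLpNorm_congr_norm_ae (g := fun X => gradient (φ k) (reflectY X) - G (reflectY X))
      (Eventually.of_forall fun X => by simp)).le.trans ?_
    exact (eLpNorm_comp_measurePreserving hm hR).le

lemma divOdd_mul_oddPower {a : ℝ} {u : Pt n → ℝ} {X : Pt n} (hX : yCoord X ≠ 0) :
    divOdd a u X * oddPower a X = u X := by
  have h := abs_rpow_mul_sq hX a
  have hp : |yCoord X| ^ (-a) * |yCoord X| ^ (a - 2) * yCoord X ^ 2 = 1 := by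
    rw [← sq_abs, ← Real.rpow_two, ← Real.rpow_add (abs_pos.2 hX), ← Real.rpow_add (abs_pos.2 hX)]
    ring_nf; simp
  rw [divOdd, oddPower]
  linear_combination u X * hp

lemma oddPower_ne_zero {a : ℝ} {X : Pt n} (hX : yCoord X ≠ 0) : oddPower a X ≠ 0 :=
  mul_ne_zero hX (Real.rpow_pos_of_pos (abs_pos.2 hX) _).ne'

lemma oddPower_reflectY (a : ℝ) (X : Pt n) : oddPower a (reflectY X) = -oddPower a X := by
  simp [oddPower]

lemma isSymmetricInY_divOdd {a : ℝ} {u : Pt n → ℝ} (ho : IsAntisymmetricInY u) :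
    IsSymmetricInY (divOdd a u) := by
  filter_upwards [ho] with X hX
  simp [divOdd, hX]

/-! ### Smoothness of parametric integrals -/

lemma integrable_smul_of_continuous {F G : Type} [NormedAddCommGroup F]
    [SecondCountableTopology F] [MeasurableSpace F] [OpensMeasurableSpace F]
    [NormedAddCommGroup G] [NormedSpace ℝ G] {μ : Measure F} {K : Set F} {h : F → ℝ}
    (hK : IsCompact K) (hμ : ∀ᵐ z ∂μ, z ∈ K) (hh : Integrable h μ) {f : F → G}
    (hf : Continuous f) : Integrable (fun z => h z • f z) μ := by
  obtain ⟨C, hC⟩ := hK.exists_bound_of_continuousOn hf.continuousOn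
  exact hh.smul_bdd C hf.aestronglyMeasurable (hμ.mono fun z hz => hC z hz)

section Parametric

variable {E F : Type} [NormedAddCommGroup E] [NormedSpace ℝ E] [FiniteDimensional ℝ E]
  [NormedAddCommGroup F] [NormedSpace ℝ F] [SecondCountableTopology F] [MeasurableSpace F]
  [OpensMeasurableSpace F] {μ : Measure F} {K : Set F} {h : F → ℝ}

lemma hasFDerivAt_parametric_integral {G : Type} [NormedAddCommGroup G] [NormedSpace ℝ G]
    (hK : IsCompact K) (hμ : ∀ᵐ z ∂μ, z ∈ K) (hh : Integrable h μ) {f : E × F → G}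
    (hf : ContDiff ℝ 1 f) (x : E) :
    HasFDerivAt (fun x => ∫ z, h z • f (x, z) ∂μ)
      (∫ z, h z • (fderiv ℝ f (x, z)).comp (ContinuousLinearMap.inl ℝ E F) ∂μ) x := by
  have hd : Continuous fun p : E × F =>
      (fderiv ℝ f p).comp (ContinuousLinearMap.inl ℝ E F) :=
    (hf.continuous_fderiv one_ne_zero).clm_comp continuous_const
  have hs : ∀ x : E, Continuous fun z : F => ((x, z) : E × F) := fun x =>
    continuous_const.prodMk continuous_id
  obtain ⟨C, hC⟩ := ((isCompact_closedBall x 1).prod hK).exists_bound_of_continuousOn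
    hd.continuousOn
  refine hasFDerivAt_integral_of_dominated_of_fderiv_le (s := Metric.closedBall x 1)
    (bound := fun z => ‖h z‖ * C)
    (F' := fun x z => h z • (fderiv ℝ f (x, z)).comp (ContinuousLinearMap.inl ℝ E F))
    (Metric.closedBall_mem_nhds x one_pos)
    (Eventually.of_forall fun y =>
      (integrable_smul_of_continuous hK hμ hh (hf.continuous.comp (hs y))).1)
    (integrable_smul_of_continuous hK hμ hh (hf.continuous.comp (hs x)))
    (integrable_smul_of_continuous hK hμ hh (hd.comp (hs x))).1 ?_ (hh.norm.mul_const C) ?_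
  · filter_upwards [hμ] with z hz y hy
    rw [norm_smul]
    exact mul_le_mul_of_nonneg_left (hC (y, z) ⟨hy, hz⟩) (norm_nonneg _)
  · refine Eventually.of_forall fun z y _ => ?_
    have h1 : HasFDerivAt (fun y : E => (y, z)) (ContinuousLinearMap.inl ℝ E F) y :=
      hasFDerivAt_prodMk_left y z
    exact ((hf.differentiable one_ne_zero (y, z)).hasFDerivAt.comp y h1).const_smul (h z)

/-- Induction on the order of differentiability. The target space is quantified inside because each
derivative takes values in a new space. Only integrability is asked of `h`; the smoothness comes
from `f`. -/
lemma contDiff_parametric_integral_nat (hK : IsCompact K) (hμ : ∀ᵐ z ∂μ, z ∈ K)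
    (hh : Integrable h μ) (m : ℕ) : ∀ {G : Type} [NormedAddCommGroup G] [NormedSpace ℝ G]
    {f : E × F → G}, ContDiff ℝ ∞ f → ContDiff ℝ m (fun x => ∫ z, h z • f (x, z) ∂μ) := by
  induction m with
  | zero =>
    intro G _ _ f hf
    refine contDiff_zero.2 (continuous_iff_continuousAt.2 fun x => ?_)
    exact (hasFDerivAt_parametric_integral hK hμ hh (hf.of_le (by simp)) x).continuousAt
  | succ m ih =>
    intro G _ _ f hf
    refine contDiff_succ_iff_hasFDerivAt.2 ⟨_, ih (f := fun p : E × F =>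
      (fderiv ℝ f p).comp (ContinuousLinearMap.inl ℝ E F)) ?_, fun x =>
      hasFDerivAt_parametric_integral hK hμ hh (hf.of_le (by simp)) x⟩
    exact (hf.fderiv_right (m := ∞) (by simp)).clm_comp contDiff_const

/-- Integrals over compactly supported measures depend smoothly on parameters. -/
lemma contDiff_parametric_integral {G : Type} [NormedAddCommGroup G] [NormedSpace ℝ G]
    (hK : IsCompact K) (hμ : ∀ᵐ z ∂μ, z ∈ K) (hh : Integrable h μ) {f : E × F → G}
    (hf : ContDiff ℝ ∞ f) : ContDiff ℝ ∞ (fun x => ∫ z, h z • f (x, z) ∂μ) :=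
  contDiff_infty.2 fun m => contDiff_parametric_integral_nat hK hμ hh m hf

lemma fderiv_parametric_integral {G : Type} [NormedAddCommGroup G] [NormedSpace ℝ G]
    [CompleteSpace G]
    (hK : IsCompact K) (hμ : ∀ᵐ z ∂μ, z ∈ K) (hh : Integrable h μ) {f : E × F → G}
    (hf : ContDiff ℝ ∞ f) (x e : E) :
    fderiv ℝ (fun x => ∫ z, h z • f (x, z) ∂μ) x e
      = ∫ z, h z • fderiv ℝ (fun x => f (x, z)) x e ∂μ := by
  have hf1 : ContDiff ℝ 1 f := hf.of_le (by simp)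
  have hd : Continuous fun z : F =>
      (fderiv ℝ f (x, z)).comp (ContinuousLinearMap.inl ℝ E F) :=
    ((hf1.continuous_fderiv one_ne_zero).clm_comp continuous_const).comp
      (continuous_const.prodMk continuous_id)
  rw [(hasFDerivAt_parametric_integral hK hμ hh hf1 x).fderiv,
    ContinuousLinearMap.integral_apply (integrable_smul_of_continuous hK hμ hh hd)]
  refine integral_congr_ae (Eventually.of_forall fun z => ?_)
  have h1 : HasFDerivAt (fun y : E => (y, z)) (ContinuousLinearMap.inl ℝ E F) x :=
    hasFDerivAt_prodMk_left x z
  have h2 : HasFDerivAt (fun y => f (y, z)) _ x :=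
    (hf1.differentiable one_ne_zero (x, z)).hasFDerivAt.comp x h1
  simp only [h2.fderiv]
  rfl

end Parametric

/-! ### The measure `(1 - t²)^{b/2} dt` on `(-1, 1)` -/

/-- The measure `(1 - t²)^{b/2} dt` on `(-1, 1)`. -/
def gegenbauerMeasure (b : ℝ) : Measure ℝ :=
  (volume.restrict (Set.Ioo (-1) 1)).withDensity fun t => ENNReal.ofReal ((1 - t ^ 2) ^ (b / 2))

lemma one_sub_sq_rpow_le (c : ℝ) {t : ℝ} (h0 : 0 ≤ t) (h1 : t < 1) :
    (1 - t ^ 2) ^ c ≤ 2 ^ |c| * (1 - t) ^ c := by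
  have e : 1 - t ^ 2 = (1 + t) * (1 - t) := by ring
  rw [e, Real.mul_rpow (by linarith) (by linarith)]
  refine mul_le_mul_of_nonneg_right ?_ (Real.rpow_nonneg (by linarith) _)
  calc (1 + t) ^ c ≤ (1 + t) ^ |c| := Real.rpow_le_rpow_of_exponent_le (by linarith) (le_abs_self c)
    _ ≤ 2 ^ |c| := Real.rpow_le_rpow (by linarith) (by linarith) (abs_nonneg c)

lemma measurable_gegenbauerWeight (b : ℝ) :
    Measurable fun t : ℝ => ENNReal.ofReal ((1 - t ^ 2) ^ (b / 2)) :=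
  ((measurable_const.sub (measurable_id.pow_const 2)).pow_const _).ennreal_ofReal

lemma ae_gegenbauer_mem (b : ℝ) : ∀ᵐ t ∂(gegenbauerMeasure b), t ∈ Set.Ioo (-1 : ℝ) 1 :=
  (withDensity_absolutelyContinuous _ _).ae_le (ae_restrict_mem measurableSet_Ioo)

lemma measurePreserving_neg_gegenbauer (b : ℝ) :
    MeasurePreserving (Neg.neg : ℝ → ℝ) (gegenbauerMeasure b) (gegenbauerMeasure b) := by
  have h0 : MeasurePreserving (Neg.neg : ℝ → ℝ) (volume.restrict (Set.Ioo (-1) 1))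
      (volume.restrict (Set.Ioo (-1) 1)) := by
    have := (Measure.measurePreserving_neg (volume : Measure ℝ)).restrict_preimage
      (measurableSet_Ioo (a := (-1 : ℝ)) (b := 1))
    have e : (Neg.neg : ℝ → ℝ) ⁻¹' Set.Ioo (-1) 1 = Set.Ioo (-1) 1 := by simp
    rwa [e] at this
  refine ⟨measurable_neg, ?_⟩
  ext s hs
  rw [Measure.map_apply measurable_neg hs, gegenbauerMeasure, withDensity_apply _ hs,
    withDensity_apply _ (measurable_neg hs),
    ← h0.setLIntegral_comp_preimage hs (measurable_gegenbauerWeight b)]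
  simp

/-- The mass near `t = 1`. -/
lemma exists_gegenbauer_le {b : ℝ} (hb : -1 < b) : ∃ C : ℝ, 0 ≤ C ∧ ∀ κ : ℝ, 0 ≤ κ → κ ≤ 1 →
    gegenbauerMeasure b {t | 1 - t ≤ κ} ≤ ENNReal.ofReal (C * κ ^ (b / 2 + 1)) := by
  refine ⟨2 ^ |b / 2| / (b / 2 + 1), div_nonneg (by positivity) (by linarith), fun κ h0 h1 => ?_⟩
  have hm : MeasurableSet {t : ℝ | 1 - t ≤ κ} :=
    measurableSet_le (measurable_const.sub measurable_id) measurable_const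
  have hint : IntervalIntegrable (fun t : ℝ => 2 ^ |b / 2| * (1 - t) ^ (b / 2)) volume (1 - κ) 1 := by
    have := (intervalIntegral.intervalIntegrable_rpow' (a := κ) (b := 0)
      (r := b / 2) (by linarith)).comp_sub_left 1
    simpa using this.const_mul _
  have hval : ∫ t in (1 - κ)..1, 2 ^ |b / 2| * (1 - t) ^ (b / 2)
      = 2 ^ |b / 2| / (b / 2 + 1) * κ ^ (b / 2 + 1) := by
    rw [intervalIntegral.integral_const_mul,
      intervalIntegral.integral_comp_sub_left (fun t => t ^ (b / 2)) 1]
    rw [sub_self, sub_sub_cancel, integral_rpow (Or.inl (by linarith)),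
      Real.zero_rpow (by linarith), sub_zero]
    ring
  rw [gegenbauerMeasure, withDensity_apply _ hm, Measure.restrict_restrict hm, ← hval,
    intervalIntegral.integral_of_le (by linarith)]
  rw [ofReal_integral_eq_lintegral_ofReal]
  · have hsub : {t : ℝ | 1 - t ≤ κ} ∩ Set.Ioo (-1) 1 ⊆ Set.Icc (1 - κ) 1 := fun t ht =>
      ⟨by have := ht.1; simp only [Set.mem_ofPred_eq] at this; linarith, ht.2.2.le⟩
    rw [← Measure.restrict_congr_set (Ioc_ae_eq_Icc (μ := volume) (a := 1 - κ) (b := 1)).symm]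
    refine le_trans ?_ (lintegral_mono_set hsub)
    refine setLIntegral_mono' (hm.inter measurableSet_Ioo) fun t ht => ENNReal.ofReal_le_ofReal ?_
    have := hsub ht
    exact one_sub_sq_rpow_le _ (by linarith [this.1]) ht.2.2
  · exact (intervalIntegrable_iff_integrableOn_Ioc_of_le (by linarith)).1 hint
  · filter_upwards [ae_restrict_mem measurableSet_Ioc] with t ht
    exact mul_nonneg (by positivity) (Real.rpow_nonneg (by linarith [ht.2]) _)

lemma isFiniteMeasure_gegenbauer {b : ℝ} (hb : -1 < b) :
    IsFiniteMeasure (gegenbauerMeasure b) := by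
  obtain ⟨C, -, hC⟩ := exists_gegenbauer_le hb
  have h1 : gegenbauerMeasure b {t | 1 - t ≤ 1} < ⊤ :=
    (hC 1 zero_le_one le_rfl).trans_lt ENNReal.ofReal_lt_top
  have h2 : gegenbauerMeasure b {t | 1 - -t ≤ 1} < ⊤ := by
    have := (measurePreserving_neg_gegenbauer b).measure_preimage
      (s := {t : ℝ | 1 - t ≤ 1})
      (measurableSet_le (measurable_const.sub measurable_id) measurable_const).nullMeasurableSet
    have e : {t : ℝ | 1 - -t ≤ 1} = (Neg.neg : ℝ → ℝ) ⁻¹' {t : ℝ | 1 - t ≤ 1} := rfl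
    rw [e, this]; exact h1
  refine ⟨lt_of_le_of_lt (measure_mono fun t _ => ?_) (measure_union_lt_top h1 h2)⟩
  rcases le_total 0 t with h | h
  · exact Or.inl (by simpa using h)
  · exact Or.inr (by simpa using h)

lemma gegenbauer_univ_ne_zero (b : ℝ) : gegenbauerMeasure b ≠ 0 := by
  intro h
  have h1 := congrArg (fun μ : Measure ℝ => μ Set.univ) h
  simp only [gegenbauerMeasure, withDensity_apply _ MeasurableSet.univ, Measure.restrict_univ,
    Measure.coe_zero, Pi.zero_apply] at h1
  rw [lintegral_eq_zero_iff (measurable_gegenbauerWeight b)] at h1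
  have h2 : ∀ᵐ t ∂(volume.restrict (Set.Ioo (-1 : ℝ) 1)), False := by
    filter_upwards [h1, ae_restrict_mem measurableSet_Ioo] with t ht hm
    have : 0 < 1 - t ^ 2 := by nlinarith [hm.1, hm.2]
    simp only [Pi.zero_apply, ENNReal.ofReal_eq_zero] at ht
    exact absurd (Real.rpow_pos_of_pos this (b / 2)) (not_lt.2 ht)
  have h3 : volume.restrict (Set.Ioo (-1 : ℝ) 1) Set.univ = 0 :=
    measure_mono_null (fun _ _ => not_false) (ae_iff.1 h2)
  rw [Measure.restrict_apply_univ, Real.volume_Ioo] at h3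
  norm_num at h3

lemma integrable_gegenbauer {b : ℝ} (hb : -1 < b) {f : ℝ → ℝ} (hf : Continuous f) :
    Integrable f (gegenbauerMeasure b) := by
  have := isFiniteMeasure_gegenbauer hb
  obtain ⟨C, hC⟩ := (isCompact_Icc (a := (-1 : ℝ)) (b := 1)).exists_bound_of_continuousOn
    hf.continuousOn
  exact Integrable.of_bound hf.aestronglyMeasurable C
    ((ae_gegenbauer_mem b).mono fun t ht => hC t (Set.Ioo_subset_Icc_self ht))

lemma integral_gegenbauer (b : ℝ) (f : ℝ → ℝ) :
    ∫ t, f t ∂(gegenbauerMeasure b) = ∫ t in Set.Ioo (-1 : ℝ) 1, (1 - t ^ 2) ^ (b / 2) * f t := by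
  rw [gegenbauerMeasure, integral_withDensity_eq_integral_toReal_smul
    (measurable_gegenbauerWeight b) (by simp)]
  refine setIntegral_congr_fun measurableSet_Ioo fun t ht => ?_
  have : 0 ≤ 1 - t ^ 2 := by nlinarith [ht.1, ht.2]
  rw [ENNReal.toReal_ofReal (Real.rpow_nonneg this _), smul_eq_mul]

lemma integrableOn_gegenbauer {b : ℝ} (hb : -1 < b) {f : ℝ → ℝ} (hf : Continuous f) :
    IntegrableOn (fun t => (1 - t ^ 2) ^ (b / 2) * f t) (Set.Ioo (-1 : ℝ) 1) := by
  have h := integrable_gegenbauer hb hf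
  rw [gegenbauerMeasure, integrable_withDensity_iff_integrable_smul'
    (measurable_gegenbauerWeight b) (by simp)] at h
  refine IntegrableOn.congr_fun h (fun t ht => ?_) measurableSet_Ioo
  have : 0 ≤ 1 - t ^ 2 := by nlinarith [ht.1, ht.2]
  rw [ENNReal.toReal_ofReal (Real.rpow_nonneg this _), smul_eq_mul]

/-- A total derivative with respect to the Gegenbauer weight integrates to zero. -/
lemma integral_gegenbauer_total_derivative {b : ℝ} (hb : -1 < b) {g g' g'' : ℝ → ℝ}
    (hg : ∀ t, HasDerivAt g (g' t) t) (hg' : ∀ t, HasDerivAt g' (g'' t) t)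
    (hg'' : Continuous g'') :
    ∫ t, (t * (1 - t ^ 2) * g'' t + (1 + b) * (1 - t ^ 2) * g' t - (2 + b) * t ^ 2 * g' t
      - b * (2 + b) * t * g t) ∂(gegenbauerMeasure b) = 0 := by
  have cg : Continuous g := continuous_iff_continuousAt.2 fun t => (hg t).continuousAt
  have cg' : Continuous g' := continuous_iff_continuousAt.2 fun t => (hg' t).continuousAt
  -- This is the primitive of the weighted integrand. It vanishes at `t = ±1` because `b/2 + 1 > 0`.
  have hcont : Continuous fun t => (1 - t ^ 2) ^ (b / 2 + 1) * (t * g' t + b * g t) := by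
    refine Continuous.mul ?_ (by fun_prop)
    exact (by fun_prop : Continuous fun t : ℝ => 1 - t ^ 2).rpow_const fun _ =>
      Or.inr (by linarith)
  rw [integral_gegenbauer, ← integral_Ioc_eq_integral_Ioo,
    ← intervalIntegral.integral_of_le (by norm_num)]
  rw [intervalIntegral.integral_eq_sub_of_hasDerivAt_of_le (by norm_num) hcont.continuousOn]
  · have : (1 - (1 : ℝ) ^ 2) ^ (b / 2 + 1) = 0 := by
      rw [one_pow, sub_self, Real.zero_rpow (by linarith)]
    have h2 : (1 - (-1 : ℝ) ^ 2) ^ (b / 2 + 1) = 0 := by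
      rw [neg_one_sq, sub_self, Real.zero_rpow (by linarith)]
    rw [this, h2]; ring
  · intro t ht
    have hpos : 0 < 1 - t ^ 2 := by nlinarith [ht.1, ht.2]
    have h1 : HasDerivAt (fun t : ℝ => 1 - t ^ 2) (-(2 * t)) t := by
      simpa using ((hasDerivAt_id t).pow 2).const_sub 1
    have h2 := h1.rpow_const (p := b / 2 + 1) (Or.inl hpos.ne')
    have h3 := ((hasDerivAt_id t).mul (hg' t)).add ((hg t).const_mul b)
    refine (h2.mul h3).congr_deriv ?_
    rw [add_sub_cancel_right, Real.rpow_add_one hpos.ne']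
    simp only [Pi.add_apply, Pi.mul_apply, id_eq]
    ring
  · rw [intervalIntegrable_iff_integrableOn_Ioo_of_le (by norm_num)]
    exact integrableOn_gegenbauer hb (by fun_prop)

/-! ### Weak solutions tested against even functions -/

/-- The standard orthonormal basis. -/
def stdBasis (n : ℕ) : OrthonormalBasis (Fin (n + 1)) ℝ (Pt n) :=
  EuclideanSpace.basisFun (Fin (n + 1)) ℝ

/-- The Laplacian, as the sum of pure second derivatives. -/
def lap (φ : Pt n → ℝ) (Z : Pt n) : ℝ :=
  ∑ i, fderiv ℝ (fun Y => fderiv ℝ φ Y (stdBasis n i)) Z (stdBasis n i)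

lemma sum_inner_stdBasis (X Y : Pt n) :
    ∑ i, inner ℝ X (stdBasis n i) * inner ℝ Y (stdBasis n i) = inner ℝ X Y := by
  rw [← (stdBasis n).sum_inner_mul_inner X Y]
  exact Finset.sum_congr rfl fun i _ => by rw [real_inner_comm (stdBasis n i) Y]

lemma contDiff_fderiv_apply {φ : Pt n → ℝ} (hφ : ContDiff ℝ ∞ φ) (e : Pt n) :
    ContDiff ℝ ∞ fun Z => fderiv ℝ φ Z e :=
  (hφ.fderiv_right (m := ∞) (by simp)).clm_apply contDiff_const

lemma yCoord_gradient (φ : Pt n → ℝ) (Z : Pt n) :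
    yCoord (gradient φ Z) = fderiv ℝ φ Z (eY n) := by
  rw [← inner_eY, inner_gradient_left]

/-- Integration by parts in each coordinate direction against `W ∂_iφ`, with `W` the weight cut off
near `Σ` and hence smooth. Differentiating `W` produces the `∂_yφ` term. -/
lemma integral_cutPow_mul_inner_gradient {ψ φ : Pt n → ℝ} (hψ : ContDiff ℝ ∞ ψ)
    (hφ : ContDiff ℝ ∞ φ) (hc : HasCompactSupport φ) (k : ℕ) (b : ℝ) :
    ∫ X, cutPow k b (yCoord X) * inner ℝ (gradient ψ X) (gradient φ X)
      = -∫ X, ψ X * (cutPow k b (yCoord X) * lap φ X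
        + (deriv (cutoff k) (yCoord X) * |yCoord X| ^ b
          + cutoff k (yCoord X) * (b * |yCoord X| ^ b / yCoord X)) * yCoord (gradient φ X)) := by
  set W : Pt n → ℝ := fun X => cutPow k b (yCoord X) with hW
  set W' : Pt n → ℝ := fun X => deriv (cutoff k) (yCoord X) * |yCoord X| ^ b
          + cutoff k (yCoord X) * (b * |yCoord X| ^ b / yCoord X) with hW'
  have hβ : ∀ i, ContDiff ℝ ∞ fun X => W X * fderiv ℝ φ X (stdBasis n i) := fun i =>
    contDiff_cutPow_mul (contDiff_fderiv_apply hφ _) k b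
  have hβc : ∀ i, HasCompactSupport fun X => W X * fderiv ℝ φ X (stdBasis n i) := fun i =>
    (hc.fderiv_apply ℝ _).mul_left
  have hgβ : ∀ i X, inner ℝ (gradient (fun X => W X * fderiv ℝ φ X (stdBasis n i)) X) (stdBasis n i)
      = W X * fderiv ℝ (fun Y => fderiv ℝ φ Y (stdBasis n i)) X (stdBasis n i)
        + W' X * (inner ℝ (eY n) (stdBasis n i) * inner ℝ (gradient φ X) (stdBasis n i)) := by
    intro i X
    rw [hW, gradient_cutPow_mul ((contDiff_fderiv_apply hφ _).differentiable (by simp)),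
      inner_add_left, inner_smul_left, inner_smul_left, inner_gradient_left, inner_gradient_left]
    simp only [RCLike.conj_to_real, hW']
    ring
  have hint : ∀ i, Integrable fun X =>
      inner ℝ (gradient ψ X) (stdBasis n i) * (W X * fderiv ℝ φ X (stdBasis n i)) := fun i =>
    (((continuous_gradient hψ).inner continuous_const).mul
      (hβ i).continuous).integrable_of_hasCompactSupport (hβc i).mul_left
  have hint' : ∀ i, Integrable fun X => ψ X *
      inner ℝ (gradient (fun X => W X * fderiv ℝ φ X (stdBasis n i)) X) (stdBasis n i) := fun i => by
    simp only [inner_gradient_left]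
    exact (hψ.continuous.mul (contDiff_fderiv_apply (hβ i)
      _).continuous).integrable_of_hasCompactSupport ((hβc i).fderiv_apply ℝ _).mul_left
  calc ∫ X, W X * inner ℝ (gradient ψ X) (gradient φ X)
      = ∫ X, ∑ i, inner ℝ (gradient ψ X) (stdBasis n i) * (W X * fderiv ℝ φ X (stdBasis n i)) := by
        congr 1; ext X
        rw [← sum_inner_stdBasis, Finset.mul_sum]
        refine Finset.sum_congr rfl fun i _ => ?_
        rw [inner_gradient_left (f := φ)]; ring
    _ = ∑ i, -∫ X, ψ X *
          inner ℝ (gradient (fun X => W X * fderiv ℝ φ X (stdBasis n i)) X) (stdBasis n i) := by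
        rw [integral_finsetSum _ fun i _ => hint i]
        refine Finset.sum_congr rfl fun i _ => ?_
        rw [integral_inner_gradient_mul_eq hψ (hβ i) (hβc i), neg_neg]
    _ = _ := by
        rw [Finset.sum_neg_distrib, ← integral_finsetSum _ fun i _ => hint' i]
        congr 2; ext X
        rw [← Finset.mul_sum]
        congr 1
        simp only [hgβ]
        rw [Finset.sum_add_distrib, ← Finset.mul_sum, ← Finset.mul_sum, sum_inner_stdBasis,
          inner_eY_left]
        rfl

/-- The cutoff is removed by dominated convergence. Evenness of `φ` ensures that no boundary term
survives on `Σ`; `P` is the continuous extension of `|y|^{-b}L_bφ` across `Σ`. -/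
lemma integral_inner_gradient_weighted {b : ℝ} (hb : -1 < b) {ψ φ P : Pt n → ℝ}
    (hψ : ContDiff ℝ ∞ ψ) (hφ : ContDiff ℝ ∞ φ) (hc : HasCompactSupport φ)
    (hs : tsupport φ ⊆ unitBall n) (he : ∀ Z, φ (reflectY Z) = φ Z) (hP : Continuous P)
    (hPφ : ∀ Z, yCoord Z ≠ 0 → lap φ Z + b / yCoord Z * yCoord (gradient φ Z) = P Z) :
    ∫ X, inner ℝ (gradient ψ X) (gradient φ X) ∂(weightedMeasure n b)
      = -∫ X, ψ X * P X ∂(weightedMeasure n b) := by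
  -- The normal derivative of an even function is odd, hence zero on `Σ`. So `∂_yφ = O(|y|)` and
  -- `η_k' ∂_yφ` stays bounded.
  have hyφ : ∀ X, yCoord X = 0 → yCoord (gradient φ X) = 0 := by
    intro X hX
    have h1 : reflectY X = X := by rw [reflectY_eq_sub, hX]; simp
    have h2 := gradient_comp_reflectY (hφ.differentiable (by simp)) X
    simp only [he] at h2
    rw [h1] at h2
    have h3 := congrArg yCoord h2
    rw [yCoord_reflectY] at h3
    have h4 : gradient (fun X => φ X) X = gradient φ X := rfl
    rw [h4] at h3
    linarith
  have hyc : ContDiff ℝ ∞ fun X => yCoord (gradient φ X) := by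
    simp only [yCoord_gradient]; exact contDiff_fderiv_apply hφ _
  obtain ⟨K, hK0, hK⟩ := exists_bound_of_vanishing hyc hyφ
  obtain ⟨C, hC0, hC⟩ := exists_abs_deriv_cutoff_mul_le
  have hK' : ∀ k, ∀ X ∈ unitBall n, yCoord X ≠ 0 →
      |deriv (cutoff k) (yCoord X) * yCoord (gradient φ X)| ≤ C * K := by
    intro k X hX hy
    have h1 := hC k (yCoord X)
    have h2 := (hK X hX).1
    rw [abs_mul] at h1 ⊢
    calc _ ≤ |deriv (cutoff k) (yCoord X)| * (K * |yCoord X|) :=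
          mul_le_mul_of_nonneg_left h2 (abs_nonneg _)
      _ = |deriv (cutoff k) (yCoord X)| * |yCoord X| * K := by ring
      _ ≤ C * K := mul_le_mul_of_nonneg_right h1 hK0
  have hout : ∀ X, X ∉ unitBall n → gradient φ X = 0 := fun X hX =>
    gradient_eq_zero_of_notMem_tsupport fun h => hX (hs h)
  have hlapout : ∀ X, X ∉ unitBall n → lap φ X = 0 := by
    intro X hX
    refine Finset.sum_eq_zero fun i _ => ?_
    have h1 : X ∉ tsupport fun Y => fderiv ℝ φ Y (stdBasis n i) := fun h =>
      hX (hs (tsupport_fderiv_apply_subset ℝ (stdBasis n i) h))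
    have h2 := gradient_eq_zero_of_notMem_tsupport h1
    rw [← inner_gradient_left, h2, inner_zero_left]
  set I : Pt n → ℝ := fun X => inner ℝ (gradient ψ X) (gradient φ X) with hI
  have hIc : Continuous I := (continuous_gradient hψ).inner (continuous_gradient hφ)
  have hstep : ∀ k, ∫ X, cutoff k (yCoord X) * I X ∂(weightedMeasure n b)
      = -∫ X, (cutoff k (yCoord X) * (ψ X * P X)
          + deriv (cutoff k) (yCoord X) * (ψ X * yCoord (gradient φ X)))
            ∂(weightedMeasure n b) := by
    intro k
    have h := integral_cutPow_mul_inner_gradient hψ hφ hc k b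
    rw [← integral_ball_eq fun X hX => by rw [hout X hX, inner_zero_right, mul_zero],
      ← integral_ball_eq fun X hX => by
        rw [hout X hX, hlapout X hX]; simp [yCoord]] at h
    rw [integral_weighted, integral_weighted]
    have e1 : ∫ X, |yCoord X| ^ b • (cutoff k (yCoord X) * I X) ∂(ballMeasure n)
        = ∫ X, cutPow k b (yCoord X) * I X ∂(ballMeasure n) := by
      congr 1; ext X; simp only [cutPow, smul_eq_mul]; ring
    rw [e1, h]
    congr 1
    refine integral_congr_ae ?_
    filter_upwards [ae_yCoord_ne_zero] with X hX
    rw [← hPφ X hX, cutPow, smul_eq_mul]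
    ring
  have := isFiniteMeasure_weighted (n := n) hb
  have hm1 : ∀ k, Continuous fun X : Pt n => cutoff k (yCoord X) := fun k =>
    (contDiff_cutoff k).continuous.comp continuous_yCoord
  have hm2 : ∀ k, Continuous fun X : Pt n => deriv (cutoff k) (yCoord X) := fun k =>
    ((contDiff_cutoff k).continuous_deriv (by simp)).comp continuous_yCoord
  have hint : ∀ {f : Pt n → ℝ}, Continuous f → Integrable f (weightedMeasure n b) := fun hf =>
    memLp_one_iff_integrable.1 (memLp_weighted_of_continuous hb hf 1)
  have hlim1 : Tendsto (fun k => ∫ X, cutoff k (yCoord X) * I X ∂(weightedMeasure n b)) atTop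
      (𝓝 (∫ X, I X ∂(weightedMeasure n b))) := by
    refine tendsto_integral_of_dominated_convergence (fun X => ‖I X‖)
      (fun k => ((hm1 k).mul hIc).aestronglyMeasurable) (hint hIc).norm
      (fun k => Eventually.of_forall fun X => ?_) ?_
    · rw [norm_mul]
      exact mul_le_of_le_one_left (norm_nonneg _) (abs_cutoff_le_one k _)
    · rw [ae_weighted_iff]
      filter_upwards [ae_yCoord_ne_zero] with X hX
      simpa using (tendsto_cutoff hX).mul_const (I X)
  have hlim2 : Tendsto (fun k => ∫ X, (cutoff k (yCoord X) * (ψ X * P X)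
          + deriv (cutoff k) (yCoord X) * (ψ X * yCoord (gradient φ X)))
            ∂(weightedMeasure n b)) atTop (𝓝 (∫ X, ψ X * P X ∂(weightedMeasure n b))) := by
    refine tendsto_integral_of_dominated_convergence
      (fun X => ‖ψ X * P X‖ + C * K * ‖ψ X‖)
      (fun k => (((hm1 k).mul (hψ.continuous.mul hP)).add ((hm2 k).mul
        (hψ.continuous.mul hyc.continuous))).aestronglyMeasurable)
      ((hint (hψ.continuous.mul hP)).norm.add ((hint hψ.continuous).norm.const_mul _))
      (fun k => ?_) ?_
    · rw [ae_weighted_iff]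
      filter_upwards [ae_mem_unitBall, ae_yCoord_ne_zero] with X hX hy
      refine (norm_add_le _ _).trans (add_le_add ?_ ?_)
      · rw [norm_mul]
        exact mul_le_of_le_one_left (norm_nonneg _) (abs_cutoff_le_one k _)
      · have e : deriv (cutoff k) (yCoord X) * (ψ X * yCoord (gradient φ X))
            = deriv (cutoff k) (yCoord X) * yCoord (gradient φ X) * ψ X := by ring
        rw [e, norm_mul]
        exact mul_le_mul_of_nonneg_right (hK' k X hX hy) (norm_nonneg _)
    · rw [ae_weighted_iff]
      filter_upwards [ae_yCoord_ne_zero] with X hX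
      simpa using ((tendsto_cutoff hX).mul_const (ψ X * P X)).add
        ((tendsto_deriv_cutoff hX).mul_const (ψ X * yCoord (gradient φ X)))
  exact tendsto_nhds_unique hlim1 (hlim2.neg.congr fun k => (hstep k).symm)

/-- A weak solution is orthogonal to `|y|^{-b} L_b φ`, for every even test function `φ`. -/
lemma IsLHarmonic.integral_mul_eq_zero {b : ℝ} (hb : -1 < b) {u φ P : Pt n → ℝ}
    (hu : IsLHarmonic b u) (hφ : ContDiff ℝ ∞ φ) (hc : HasCompactSupport φ)
    (hs : tsupport φ ⊆ unitBall n) (he : ∀ Z, φ (reflectY Z) = φ Z) (hP : Continuous P)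
    (hPφ : ∀ Z, yCoord Z ≠ 0 → lap φ Z + b / yCoord Z * yCoord (gradient φ Z) = P Z) :
    ∫ X, u X * P X ∂(weightedMeasure n b) = 0 := by
  obtain ⟨G, ⟨h1, h2, ψ, hψ, h3, h4⟩, hw⟩ := hu
  have hw' := hw φ hφ hc hs
  rw [integral_weak_form] at hw'
  have := isFiniteMeasure_weighted (n := n) hb
  have hL1 : ∀ {E : Type} [NormedAddCommGroup E] {f : ℕ → Pt n → E},
      (∀ k, AEStronglyMeasurable (f k) (weightedMeasure n b)) →
      Tendsto (fun k => eLpNorm (f k) 2 (weightedMeasure n b)) atTop (𝓝 0) →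
      Tendsto (fun k => ∫⁻ X, ‖f k X‖ₑ ∂(weightedMeasure n b)) atTop (𝓝 0) := by
    intro E _ f hf h
    have h' := ENNReal.Tendsto.mul_const (b := weightedMeasure n b Set.univ
      ^ (1 / (1 : ENNReal).toReal - 1 / (2 : ENNReal).toReal)) h
      (Or.inr (ENNReal.rpow_lt_top_of_nonneg (by norm_num) (measure_ne_top _ _)).ne)
    rw [zero_mul] at h'
    refine tendsto_of_tendsto_of_tendsto_of_le_of_le tendsto_const_nhds h'
      (fun _ => zero_le) fun k => ?_
    simp only
    rw [← eLpNorm_one_eq_lintegral_enorm]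
    exact eLpNorm_le_eLpNorm_mul_rpow_measure_univ (by norm_num) (hf k)
  obtain ⟨D, hD⟩ := (isCompact_closedBall (0 : Pt n) 1).exists_bound_of_continuousOn
    (continuous_gradient hφ).continuousOn
  obtain ⟨M, hM⟩ := (isCompact_closedBall (0 : Pt n) 1).exists_bound_of_continuousOn
    hP.continuousOn
  have hball : ∀ᵐ X ∂(weightedMeasure n b), X ∈ Metric.closedBall (0 : Pt n) 1 := by
    rw [ae_weighted_iff]
    exact ae_mem_unitBall.mono fun X hX => Metric.ball_subset_closedBall hX
  have ui := h1.integrable (by norm_num)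
  have ψi : ∀ k, Integrable (ψ k) (weightedMeasure n b) := fun k =>
    memLp_one_iff_integrable.1 (memLp_weighted_of_continuous hb (hψ k).continuous 1)
  have int1 : ∀ {f : Pt n → ℝ}, Integrable f (weightedMeasure n b) →
      Integrable (fun X => f X * P X) (weightedMeasure n b) := fun hf =>
    hf.mul_bdd hP.aestronglyMeasurable (hball.mono hM)
  have lim1 : Tendsto (fun k => ∫ X, inner ℝ (gradient (ψ k) X) (gradient φ X)
      ∂(weightedMeasure n b)) atTop (𝓝 0) := by
    rw [← hw']
    refine tendsto_integral_of_lintegral_sub (h := fun k X => gradient (ψ k) X - G X) D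
      (fun k => integrable_inner_of_memLp hb (memLp_weighted_of_continuous hb
        (continuous_gradient (hψ k)) 2) (continuous_gradient hφ))
      (integrable_inner_of_memLp hb h2 (continuous_gradient hφ)) (fun k => ?_)
      (hL1 (fun k => (continuous_gradient (hψ k)).aestronglyMeasurable.sub h2.1) h4)
    filter_upwards [hball] with X hX
    rw [← inner_sub_left, mul_comm]
    exact (abs_real_inner_le_norm _ _).trans (mul_le_mul_of_nonneg_left (hD X hX) (norm_nonneg _))
  have lim2 : Tendsto (fun k => ∫ X, ψ k X * P X ∂(weightedMeasure n b)) atTop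
      (𝓝 (∫ X, u X * P X ∂(weightedMeasure n b))) := by
    refine tendsto_integral_of_lintegral_sub (h := fun k X => ψ k X - u X) M
      (fun k => int1 (ψi k)) (int1 ui) (fun k => ?_)
      (hL1 (fun k => (hψ k).continuous.aestronglyMeasurable.sub h1.1) h3)
    filter_upwards [hball] with X hX
    rw [← sub_mul, abs_mul, mul_comm]
    exact mul_le_mul_of_nonneg_right (hM X hX) (abs_nonneg _)
  have lim3 : Tendsto (fun k => ∫ X, ψ k X * P X ∂(weightedMeasure n b)) atTop (𝓝 (-0)) :=
    lim1.neg.congr fun k => by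
      rw [integral_inner_gradient_weighted hb (hψ k) hφ hc hs he hP hPφ, neg_neg]
  rw [neg_zero] at lim3
  exact tendsto_nhds_unique lim2 lim3

/-! ### Generalized translates of radial functions -/

/-- The argument `|x - x'|² + y² + y'² - 2yy't` of the generalized translation. -/
def translArg (X Z : Pt n) (t : ℝ) : ℝ :=
  ‖X - Z‖ ^ 2 + 2 * (yCoord X * yCoord Z) * (1 - t)

/-- The integrand of the generalized translation. The term with the derivative of `Φ` makes the
translation meaningful for all `b > -1`. -/
def translKernel (b : ℝ) (Φ : ℝ → ℝ) (l : ℝ) (X Z : Pt n) (t : ℝ) : ℝ :=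
  (1 + b) * Φ (l * translArg X Z t)
    - 2 * (yCoord X * yCoord Z) * t * l * deriv Φ (l * translArg X Z t)

/-- The generalized translate to `X` of the function `Φ(l |·|²)`. -/
def transl (b : ℝ) (Φ : ℝ → ℝ) (l : ℝ) (X Z : Pt n) : ℝ :=
  ∫ t, translKernel b Φ l X Z t ∂(gegenbauerMeasure b)

lemma contDiff_deriv_of_contDiff {Φ : ℝ → ℝ} (h : ContDiff ℝ ∞ Φ) : ContDiff ℝ ∞ (deriv Φ) :=
  (contDiff_infty_iff_deriv.1 h).2

section ContDiff

variable {E : Type} [NormedAddCommGroup E] [NormedSpace ℝ E] {l : E → ℝ} {X Z : E → Pt n}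
  {t : E → ℝ}

lemma contDiff_translArg (hX : ContDiff ℝ ∞ X) (hZ : ContDiff ℝ ∞ Z) (ht : ContDiff ℝ ∞ t) :
    ContDiff ℝ ∞ fun p => translArg (X p) (Z p) (t p) :=
  ((hX.sub hZ).norm_sq ℝ).add ((contDiff_const.mul
    ((contDiff_yCoord.comp hX).mul (contDiff_yCoord.comp hZ))).mul (contDiff_const.sub ht))

lemma contDiff_translKernel {Φ : ℝ → ℝ} (hΦ : ContDiff ℝ ∞ Φ) (b : ℝ) (hl : ContDiff ℝ ∞ l)
    (hX : ContDiff ℝ ∞ X) (hZ : ContDiff ℝ ∞ Z) (ht : ContDiff ℝ ∞ t) :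
    ContDiff ℝ ∞ fun p => translKernel b Φ (l p) (X p) (Z p) (t p) := by
  have hr := hl.mul (contDiff_translArg hX hZ ht)
  exact (contDiff_const.mul (hΦ.comp hr)).sub ((((contDiff_const.mul
    ((contDiff_yCoord.comp hX).mul (contDiff_yCoord.comp hZ))).mul ht).mul hl).mul
    ((contDiff_deriv_of_contDiff hΦ).comp hr))

end ContDiff

lemma ae_gegenbauer_mem_Icc (b : ℝ) : ∀ᵐ t ∂(gegenbauerMeasure b), t ∈ Set.Icc (-1 : ℝ) 1 :=
  (ae_gegenbauer_mem b).mono fun _ h => Set.Ioo_subset_Icc_self h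

lemma contDiff_gegenbauer_integral {b : ℝ} (hb : -1 < b) {f : Pt n × ℝ → ℝ}
    (hf : ContDiff ℝ ∞ f) : ContDiff ℝ ∞ fun Z => ∫ t, f (Z, t) ∂(gegenbauerMeasure b) := by
  have := isFiniteMeasure_gegenbauer hb
  simpa using contDiff_parametric_integral (isCompact_Icc (a := (-1 : ℝ)) (b := 1))
    (ae_gegenbauer_mem_Icc b) (integrable_const (1 : ℝ)) hf

lemma fderiv_gegenbauer_integral {b : ℝ} (hb : -1 < b) {f : Pt n × ℝ → ℝ}
    (hf : ContDiff ℝ ∞ f) (Z e : Pt n) :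
    fderiv ℝ (fun Z => ∫ t, f (Z, t) ∂(gegenbauerMeasure b)) Z e
      = ∫ t, fderiv ℝ (fun Z => f (Z, t)) Z e ∂(gegenbauerMeasure b) := by
  have := isFiniteMeasure_gegenbauer hb
  simpa using fderiv_parametric_integral (isCompact_Icc (a := (-1 : ℝ)) (b := 1))
    (ae_gegenbauer_mem_Icc b) (integrable_const (1 : ℝ)) hf Z e

lemma contDiff_transl {b : ℝ} (hb : -1 < b) {Φ : ℝ → ℝ} (hΦ : ContDiff ℝ ∞ Φ) (l : ℝ)
    (X : Pt n) : ContDiff ℝ ∞ (transl b Φ l X) :=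
  contDiff_gegenbauer_integral hb (f := fun p => translKernel b Φ l X p.1 p.2)
    (contDiff_translKernel hΦ b contDiff_const contDiff_const contDiff_fst contDiff_snd)

/-- Reflecting `Z` amounts to `t ↦ -t`, so symmetry of the `t`-measure makes every generalized
translate even in `y`, hence admissible as an even test function. -/
lemma translArg_reflectY (X Z : Pt n) (t : ℝ) :
    translArg X (reflectY Z) t = translArg X Z (-t) := by
  have : X - reflectY Z = X - Z + (2 * yCoord Z) • eY n := by rw [reflectY_eq_sub]; abel
  rw [translArg, translArg, this, norm_add_sq_real, inner_smul_right, inner_eY, norm_smul,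
    norm_eY, mul_one, Real.norm_eq_abs, sq_abs, yCoord_reflectY]
  have h2 : yCoord (X - Z) = yCoord X - yCoord Z := rfl
  rw [h2]; ring

lemma transl_reflectY (b : ℝ) (Φ : ℝ → ℝ) (l : ℝ) (X Z : Pt n) :
    transl b Φ l X (reflectY Z) = transl b Φ l X Z := by
  rw [transl, transl, ← (measurePreserving_neg_gegenbauer b).integral_comp
    (Homeomorph.neg ℝ).measurableEmbedding]
  congr 1; ext t
  rw [translKernel, translKernel, translArg_reflectY, yCoord_reflectY]
  ring_nf

/-- For `t ∈ [-1,1]` the argument is the convex combination, with weights `(1±t)/2`, of the squared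
distances from `X` to `Z` and to its reflection; both are at least `(‖Z‖ - ‖X‖)²`. -/
lemma sq_norm_sub_le_translArg {X Z : Pt n} {t : ℝ} (ht : t ∈ Set.Icc (-1 : ℝ) 1) :
    (‖Z‖ - ‖X‖) ^ 2 ≤ translArg X Z t := by
  have h1 : ∀ Y : Pt n, (‖Y‖ - ‖X‖) ^ 2 ≤ ‖X - Y‖ ^ 2 := fun Y => by
    rw [norm_sub_rev X Y, ← sq_abs (‖Y‖ - ‖X‖)]
    exact pow_le_pow_left₀ (abs_nonneg _) (abs_norm_sub_norm_le Y X) 2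
  have h2 := h1 Z
  have h3 := h1 (reflectY Z)
  rw [norm_reflectY] at h3
  have h4 : ‖X - reflectY Z‖ ^ 2 = ‖X - Z‖ ^ 2 + 4 * (yCoord X * yCoord Z) := by
    have := translArg_reflectY X Z 1
    simp only [translArg] at this
    linarith
  rw [translArg]
  rcases le_total 0 (yCoord X * yCoord Z) with h | h
  · nlinarith [ht.2]
  · nlinarith [ht.1]

lemma translKernel_eq_zero {b : ℝ} {Φ : ℝ → ℝ} (hΦ : ∀ r, 1 ≤ r → Φ r = 0)
    (hΦ' : ∀ r, 1 ≤ r → deriv Φ r = 0) {l : ℝ} {X Z : Pt n} {t : ℝ}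
    (h : 1 ≤ l * translArg X Z t) : translKernel b Φ l X Z t = 0 := by
  rw [translKernel, hΦ _ h, hΦ' _ h]; ring

lemma transl_eq_zero {b : ℝ} {Φ : ℝ → ℝ} (hΦ : ∀ r, 1 ≤ r → Φ r = 0)
    (hΦ' : ∀ r, 1 ≤ r → deriv Φ r = 0) {l : ℝ} (hl : 0 < l) {X Z : Pt n}
    (h : ‖X‖ + 1 / √l ≤ ‖Z‖) : transl b Φ l X Z = 0 := by
  refine integral_eq_zero_of_ae ?_
  filter_upwards [ae_gegenbauer_mem_Icc b] with t ht
  refine translKernel_eq_zero hΦ hΦ' ?_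
  have h1 := sq_norm_sub_le_translArg (X := X) (Z := Z) ht
  have h2 : (1 / √l) ^ 2 ≤ (‖Z‖ - ‖X‖) ^ 2 :=
    pow_le_pow_left₀ (by positivity) (by linarith) 2
  rw [div_pow, one_pow, Real.sq_sqrt hl.le] at h2
  have h3 := h2.trans h1
  rw [div_le_iff₀ hl] at h3
  linarith

lemma fderiv_apply_of_line {g : Pt n → ℝ} {Z e : Pt n} {d : ℝ} (hg : DifferentiableAt ℝ g Z)
    (h : HasDerivAt (fun τ : ℝ => g (Z + τ • e)) d 0) : fderiv ℝ g Z e = d :=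
  (hg.hasFDerivAt.hasLineDerivAt e).unique h

/-- The directional derivative of `translArg` in its second argument. -/
def translArgDeriv (X Z e : Pt n) (t : ℝ) : ℝ :=
  2 * inner ℝ (Z - X) e + 2 * (yCoord X * yCoord e) * (1 - t)

lemma hasDerivAt_translArg_line (X Z e : Pt n) (t : ℝ) :
    HasDerivAt (fun τ : ℝ => translArg X (Z + τ • e) t) (translArgDeriv X Z e t) 0 := by
  have e1 : (fun τ : ℝ => translArg X (Z + τ • e) t) = fun τ =>
      translArg X Z t + τ * translArgDeriv X Z e t + τ ^ 2 * ‖e‖ ^ 2 := by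
    ext τ
    have : X - (Z + τ • e) = -((Z - X) + τ • e) := by abel
    rw [translArg, this, norm_neg, norm_add_sq_real, inner_smul_right, norm_smul, mul_pow,
      Real.norm_eq_abs, sq_abs, yCoord_add, yCoord_smul, translArg, translArgDeriv, norm_sub_rev]
    ring
  rw [e1]
  have h1 := ((hasDerivAt_id (0 : ℝ)).mul_const (translArgDeriv X Z e t)).const_add
    (translArg X Z t)
  have h2 := ((hasDerivAt_id (0 : ℝ)).pow 2).mul_const (‖e‖ ^ 2)
  refine (h1.add h2).congr_deriv ?_
  simp

lemma hasDerivAt_translArgDeriv_line (X Z e : Pt n) (t : ℝ) :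
    HasDerivAt (fun τ : ℝ => translArgDeriv X (Z + τ • e) e t) (2 * ‖e‖ ^ 2) 0 := by
  have e1 : (fun τ : ℝ => translArgDeriv X (Z + τ • e) e t) = fun τ =>
      translArgDeriv X Z e t + τ * (2 * ‖e‖ ^ 2) := by
    ext τ
    have : Z + τ • e - X = (Z - X) + τ • e := by abel
    rw [translArgDeriv, this, inner_add_left, inner_smul_left, real_inner_self_eq_norm_sq,
      translArgDeriv]
    simp only [RCLike.conj_to_real]
    ring
  rw [e1]
  simpa using ((hasDerivAt_id (0 : ℝ)).mul_const (2 * ‖e‖ ^ 2)).const_add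
    (translArgDeriv X Z e t)

lemma hasDerivAt_comp_translArg_line {f : ℝ → ℝ} (hf : ContDiff ℝ ∞ f) (l : ℝ) (X Z e : Pt n)
    (t : ℝ) : HasDerivAt (fun τ : ℝ => f (l * translArg X (Z + τ • e) t))
      (deriv f (l * translArg X Z t) * (l * translArgDeriv X Z e t)) 0 := by
  have h1 := (hasDerivAt_translArg_line X Z e t).const_mul l
  have h2 : HasDerivAt f (deriv f (l * translArg X Z t)) (l * translArg X (Z + (0 : ℝ) • e) t) := by
    rw [zero_smul, add_zero]
    exact (hf.differentiable (by simp) _).hasDerivAt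
  exact h2.comp (0 : ℝ) h1

lemma hasDerivAt_yCoord_line (c : ℝ) (Z e : Pt n) :
    HasDerivAt (fun τ : ℝ => c * yCoord (Z + τ • e)) (c * yCoord e) 0 := by
  have e1 : (fun τ : ℝ => c * yCoord (Z + τ • e)) = fun τ => c * yCoord Z + τ * (c * yCoord e) := by
    ext τ; rw [yCoord_add, yCoord_smul]; ring
  rw [e1]
  simpa using ((hasDerivAt_id (0 : ℝ)).mul_const (c * yCoord e)).const_add (c * yCoord Z)

/-- The directional derivative of `translKernel` in its second argument. -/
def translKernelDeriv (b : ℝ) (Ψ : ℝ → ℝ) (l : ℝ) (X e Z : Pt n) (t : ℝ) : ℝ :=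
  (1 + b) * (deriv Ψ (l * translArg X Z t) * (l * translArgDeriv X Z e t))
    - (2 * yCoord X * t * l * yCoord e * deriv Ψ (l * translArg X Z t)
      + 2 * yCoord X * t * l * yCoord Z
        * (deriv (deriv Ψ) (l * translArg X Z t) * (l * translArgDeriv X Z e t)))

lemma fderiv_translKernel {Ψ : ℝ → ℝ} (hΨ : ContDiff ℝ ∞ Ψ) (b l : ℝ) (X e Z : Pt n) (t : ℝ) :
    fderiv ℝ (fun Z => translKernel b Ψ l X Z t) Z e = translKernelDeriv b Ψ l X e Z t := by
  refine fderiv_apply_of_line ((contDiff_translKernel hΨ b contDiff_const contDiff_const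
    contDiff_id contDiff_const).differentiable (by simp) Z) ?_
  have h1 := (hasDerivAt_comp_translArg_line hΨ l X Z e t).const_mul (1 + b)
  have h2 := (hasDerivAt_yCoord_line (2 * yCoord X * t * l) Z e).mul
    (hasDerivAt_comp_translArg_line (contDiff_deriv_of_contDiff hΨ) l X Z e t)
  have h3 := h1.sub h2
  simp only [zero_smul, add_zero] at h3
  refine h3.congr_of_eventuallyEq (Eventually.of_forall fun τ => ?_)
  simp only [translKernel, Pi.sub_apply, Pi.mul_apply]
  ring

lemma contDiff_translKernelDeriv {Ψ : ℝ → ℝ} (hΨ : ContDiff ℝ ∞ Ψ) (b l : ℝ) (X e : Pt n) :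
    ContDiff ℝ ∞ fun p : Pt n × ℝ => translKernelDeriv b Ψ l X e p.1 p.2 := by
  have h0 : ContDiff ℝ ∞ fun p : Pt n × ℝ => l * translArg X p.1 p.2 :=
    contDiff_const.mul (contDiff_translArg contDiff_const contDiff_fst contDiff_snd)
  have h1 := (contDiff_deriv_of_contDiff hΨ).comp h0
  have h2 := (contDiff_deriv_of_contDiff (contDiff_deriv_of_contDiff hΨ)).comp h0
  have h3 : ContDiff ℝ ∞ fun p : Pt n × ℝ => l * translArgDeriv X p.1 e p.2 := by
    unfold translArgDeriv
    exact contDiff_const.mul ((contDiff_const.mul ((contDiff_fst.sub contDiff_const).inner ℝ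
      contDiff_const)).add (contDiff_const.mul (contDiff_const.sub contDiff_snd)))
  have h4 : ContDiff ℝ ∞ fun p : Pt n × ℝ => yCoord p.1 := contDiff_yCoord.comp contDiff_fst
  have h5 : ContDiff ℝ ∞ fun p : Pt n × ℝ => 2 * yCoord X * p.2 * l :=
    (contDiff_const.mul contDiff_snd).mul contDiff_const
  exact (contDiff_const.mul (h1.mul h3)).sub (((h5.mul contDiff_const).mul h1).add
    ((h5.mul h4).mul (h2.mul h3)))

lemma fderiv_translKernelDeriv {Ψ : ℝ → ℝ} (hΨ : ContDiff ℝ ∞ Ψ) (b l : ℝ) (X e Z : Pt n)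
    (t : ℝ) :
    fderiv ℝ (fun Z => translKernelDeriv b Ψ l X e Z t) Z e
      = (1 + b) * (deriv (deriv Ψ) (l * translArg X Z t) * (l * translArgDeriv X Z e t) ^ 2
          + deriv Ψ (l * translArg X Z t) * (l * (2 * ‖e‖ ^ 2)))
        - 4 * yCoord X * t * l * yCoord e
          * (deriv (deriv Ψ) (l * translArg X Z t) * (l * translArgDeriv X Z e t))
        - 2 * yCoord X * t * l * yCoord Z
          * (deriv (deriv (deriv Ψ)) (l * translArg X Z t) * (l * translArgDeriv X Z e t) ^ 2
          + deriv (deriv Ψ) (l * translArg X Z t) * (l * (2 * ‖e‖ ^ 2))) := by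
  have hΨ1 := contDiff_deriv_of_contDiff hΨ
  have hΨ2 := contDiff_deriv_of_contDiff hΨ1
  refine fderiv_apply_of_line (((contDiff_translKernelDeriv hΨ b l X e).comp
    (contDiff_id.prodMk contDiff_const)).differentiable (by simp) Z) ?_
  have d0 := (hasDerivAt_translArgDeriv_line X Z e t).const_mul l
  have d1 := hasDerivAt_comp_translArg_line hΨ1 l X Z e t
  have d2 := hasDerivAt_comp_translArg_line hΨ2 l X Z e t
  have h1 := (d1.mul d0).const_mul (1 + b)
  have h2 := d1.const_mul (2 * yCoord X * t * l * yCoord e)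
  have h3 := (hasDerivAt_yCoord_line (2 * yCoord X * t * l) Z e).mul (d2.mul d0)
  have h4 := h1.sub (h2.add h3)
  simp only [Pi.mul_apply, zero_smul, add_zero] at h4
  refine (h4.congr_deriv ?_)
  ring

/-- The operator `r ↦ r Φ' + (N/2) Φ` on profiles, with `N = n + 1 + b`. -/
def eulerProfile (n : ℕ) (b : ℝ) (Φ : ℝ → ℝ) (r : ℝ) : ℝ :=
  r * deriv Φ r + (n + 1 + b) / 2 * Φ r

lemma contDiff_eulerProfile {Φ : ℝ → ℝ} (hΦ : ContDiff ℝ ∞ Φ) (b : ℝ) :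
    ContDiff ℝ ∞ (eulerProfile n b Φ) :=
  (contDiff_id.mul (contDiff_deriv_of_contDiff hΦ)).add (contDiff_const.mul hΦ)

lemma deriv_eulerProfile {Φ : ℝ → ℝ} (hΦ : ContDiff ℝ ∞ Φ) (b r : ℝ) :
    deriv (eulerProfile n b Φ) r = r * deriv (deriv Φ) r + ((n + 1 + b) / 2 + 1) * deriv Φ r := by
  have h1 := ((hΦ.differentiable (by simp)) r).hasDerivAt
  have h2 := (((contDiff_deriv_of_contDiff hΦ).differentiable (by simp)) r).hasDerivAt
  have h3 : HasDerivAt (eulerProfile n b Φ) _ r :=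
    ((hasDerivAt_id r).mul h2).add (h1.const_mul ((n + 1 + b) / 2))
  rw [h3.deriv]
  simp only [id_eq]; ring

/-- The gradient of the argument in `Z` is `2(Z - X + y_X(1-t)e_y)`. Its square differs from four
times the argument by a multiple of `1 - t²`, the defect later removed by the integration in `t`. -/
lemma sum_translArgDeriv_sq (X Z : Pt n) (t : ℝ) :
    ∑ i, translArgDeriv X Z (stdBasis n i) t ^ 2
      = 4 * (translArg X Z t - yCoord X ^ 2 * (1 - t ^ 2)) := by
  have e : ∀ i, translArgDeriv X Z (stdBasis n i) t
      = 2 * inner ℝ ((Z - X) + (yCoord X * (1 - t)) • eY n) (stdBasis n i) := by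
    intro i
    rw [translArgDeriv, inner_add_left, inner_smul_left, inner_eY_left]
    simp only [RCLike.conj_to_real]
    ring
  have h := sum_inner_stdBasis ((Z - X) + (yCoord X * (1 - t)) • eY n)
    ((Z - X) + (yCoord X * (1 - t)) • eY n)
  rw [real_inner_self_eq_norm_sq, norm_add_sq_real, inner_smul_right, inner_eY, norm_smul,
    norm_eY, mul_one, Real.norm_eq_abs, sq_abs] at h
  have h2 : yCoord (Z - X) = yCoord Z - yCoord X := rfl
  calc ∑ i, translArgDeriv X Z (stdBasis n i) t ^ 2
      = 4 * ∑ i, inner ℝ ((Z - X) + (yCoord X * (1 - t)) • eY n) (stdBasis n i)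
          * inner ℝ ((Z - X) + (yCoord X * (1 - t)) • eY n) (stdBasis n i) := by
        rw [Finset.mul_sum]
        exact Finset.sum_congr rfl fun i _ => by rw [e]; ring
    _ = _ := by rw [h, translArg, norm_sub_rev X Z, h2]; ring

lemma sum_yCoord_mul_translArgDeriv (X Z : Pt n) (t : ℝ) :
    ∑ i, yCoord (stdBasis n i) * translArgDeriv X Z (stdBasis n i) t
      = 2 * (yCoord Z - yCoord X * t) := by
  have e : ∀ i, yCoord (stdBasis n i) * translArgDeriv X Z (stdBasis n i) t
      = 2 * (inner ℝ ((Z - X) + (yCoord X * (1 - t)) • eY n) (stdBasis n i)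
        * inner ℝ (eY n) (stdBasis n i)) := by
    intro i
    rw [translArgDeriv, inner_add_left, inner_smul_left, inner_eY_left]
    simp only [RCLike.conj_to_real]
    ring
  simp only [e]
  rw [← Finset.mul_sum, sum_inner_stdBasis, inner_eY]
  have h2 : yCoord ((Z - X) + (yCoord X * (1 - t)) • eY n)
      = (yCoord Z - yCoord X) + yCoord X * (1 - t) * yCoord (eY n) := rfl
  rw [h2, yCoord_eY]; ring

/-- Generalized translation commutes with the operator `|y|^{-b} L_b`. -/
lemma lap_transl {b : ℝ} (hb : -1 < b) {Ψ : ℝ → ℝ} (hΨ : ContDiff ℝ ∞ Ψ) (l : ℝ) (X : Pt n)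
    {Z : Pt n} (hZ : yCoord Z ≠ 0) :
    lap (transl b Ψ l X) Z + b / yCoord Z * yCoord (gradient (transl b Ψ l X) Z)
      = 4 * l * transl b (eulerProfile n b (deriv Ψ)) l X Z := by
  have hΨ1 := contDiff_deriv_of_contDiff hΨ
  have hΨ2 := contDiff_deriv_of_contDiff hΨ1
  have hΨ3 := contDiff_deriv_of_contDiff hΨ2
  have hk : ContDiff ℝ ∞ fun p : Pt n × ℝ => translKernel b Ψ l X p.1 p.2 :=
    contDiff_translKernel hΨ b contDiff_const contDiff_const contDiff_fst contDiff_snd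
  have f1 : ∀ e Z, fderiv ℝ (transl b Ψ l X) Z e
      = ∫ t, translKernelDeriv b Ψ l X e Z t ∂(gegenbauerMeasure b) := by
    intro e Z
    refine (fderiv_gegenbauer_integral hb hk Z e).trans ?_
    simp only [fderiv_translKernel hΨ]
  have f2 : ∀ e Z, fderiv ℝ (fun Z => fderiv ℝ (transl b Ψ l X) Z e) Z e
      = ∫ t, fderiv ℝ (fun Z => translKernelDeriv b Ψ l X e Z t) Z e ∂(gegenbauerMeasure b) := by
    intro e Z
    simp only [f1]
    exact fderiv_gegenbauer_integral hb (contDiff_translKernelDeriv hΨ b l X e) Z e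
  have c2 : ∀ e, Continuous fun t => fderiv ℝ (fun Z => translKernelDeriv b Ψ l X e Z t) Z e := by
    intro e
    have ha : Continuous fun t => l * translArg X Z t := by unfold translArg; fun_prop
    have hd : Continuous fun t => translArgDeriv X Z e t := by unfold translArgDeriv; fun_prop
    have g1 := hΨ1.continuous.comp ha
    have g2 := hΨ2.continuous.comp ha
    have g3 := hΨ3.continuous.comp ha
    simp only [Function.comp_def] at g1 g2 g3
    simp only [fderiv_translKernelDeriv hΨ]
    fun_prop
  have c1 : Continuous fun t => translKernelDeriv b Ψ l X (eY n) Z t :=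
    ((contDiff_translKernelDeriv hΨ b l X (eY n)).comp
      (contDiff_const.prodMk contDiff_id)).continuous
  have hΘ := contDiff_eulerProfile (n := n) hΨ1 b
  have c3 : Continuous fun t => translKernel b (eulerProfile n b (deriv Ψ)) l X Z t :=
    (contDiff_translKernel (l := fun _ : ℝ => l) (X := fun _ => X) (Z := fun _ => Z) hΘ b
      contDiff_const contDiff_const contDiff_const contDiff_id).continuous
  have hlin : ∀ t, HasDerivAt (fun t => l * translArg X Z t)
      (-(2 * l * (yCoord X * yCoord Z))) t := by
    intro t
    have := ((((hasDerivAt_id t).const_sub 1).const_mul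
      (2 * (yCoord X * yCoord Z))).const_add (‖X - Z‖ ^ 2)).const_mul l
    refine this.congr_deriv ?_
    ring
  have hcomp : ∀ {f : ℝ → ℝ}, ContDiff ℝ ∞ f → ∀ t, HasDerivAt
      (fun t => f (l * translArg X Z t))
      (deriv f (l * translArg X Z t) * -(2 * l * (yCoord X * yCoord Z))) t := fun hf t =>
    (hf.differentiable (by simp) _).hasDerivAt.comp t (hlin t)
  have htd := integral_gegenbauer_total_derivative hb
    (g := fun t => deriv Ψ (l * translArg X Z t))
    (g' := fun t => deriv (deriv Ψ) (l * translArg X Z t) * -(2 * l * (yCoord X * yCoord Z)))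
    (g'' := fun t => deriv (deriv (deriv Ψ)) (l * translArg X Z t)
      * -(2 * l * (yCoord X * yCoord Z)) * -(2 * l * (yCoord X * yCoord Z)))
    (hcomp hΨ1) (fun t => (hcomp hΨ2 t).mul_const _)
    ((((hΨ3.continuous.comp (by unfold translArg; fun_prop)).mul continuous_const).mul
      continuous_const))
  have hsum : lap (transl b Ψ l X) Z = ∫ t, ∑ i, fderiv ℝ
      (fun Z => translKernelDeriv b Ψ l X (stdBasis n i) Z t) Z (stdBasis n i)
      ∂(gegenbauerMeasure b) := by
    rw [integral_finsetSum _ fun i _ => integrable_gegenbauer hb (c2 _)]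
    exact Finset.sum_congr rfl fun i _ => f2 _ _
  have cs : Continuous fun t => ∑ i, fderiv ℝ
      (fun Z => translKernelDeriv b Ψ l X (stdBasis n i) Z t) Z (stdBasis n i) :=
    continuous_finsetSum _ fun i _ => c2 _
  have i1 := (integrable_gegenbauer hb c1).const_mul (b / yCoord Z)
  have i3 := (integrable_gegenbauer hb c3).const_mul (4 * l)
  have is := integrable_gegenbauer hb cs
  have is1 : Integrable (fun t => (∑ i, fderiv ℝ
      (fun Z => translKernelDeriv b Ψ l X (stdBasis n i) Z t) Z (stdBasis n i))
      + b / yCoord Z * translKernelDeriv b Ψ l X (eY n) Z t) (gegenbauerMeasure b) := is.add i1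
  rw [hsum, yCoord_gradient, f1, transl, ← integral_const_mul, ← integral_const_mul,
    ← integral_add is i1, ← sub_eq_zero, ← integral_sub is1 i3]
  -- The two sides do not agree pointwise in `t`: their integrands differ by this factor times the
  -- total derivative belonging to `g(t) = Ψ'(l · translArg X Z t)`, which integrates to zero.
  rw [← mul_zero (2 * yCoord X / yCoord Z * l), ← htd, ← integral_const_mul]
  congr 1; ext t
  have hs1 := sum_translArgDeriv_sq X Z t
  have hs2 := sum_yCoord_mul_translArgDeriv X Z t
  have hsumt : ∑ i, fderiv ℝ
      (fun Z => translKernelDeriv b Ψ l X (stdBasis n i) Z t) Z (stdBasis n i)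
      = (1 + b) * (deriv (deriv Ψ) (l * translArg X Z t) * (l ^ 2 *
            (4 * (translArg X Z t - yCoord X ^ 2 * (1 - t ^ 2))))
          + deriv Ψ (l * translArg X Z t) * (l * (2 * (n + 1))))
        - 4 * yCoord X * t * l
          * (deriv (deriv Ψ) (l * translArg X Z t) * (l * (2 * (yCoord Z - yCoord X * t))))
        - 2 * yCoord X * t * l * yCoord Z
          * (deriv (deriv (deriv Ψ)) (l * translArg X Z t) * (l ^ 2 *
            (4 * (translArg X Z t - yCoord X ^ 2 * (1 - t ^ 2))))
          + deriv (deriv Ψ) (l * translArg X Z t) * (l * (2 * (n + 1)))) := by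
    rw [← hs1, ← hs2]
    have hcard : (n + 1 : ℝ) = ∑ i : Fin (n + 1), ‖stdBasis n i‖ ^ 2 := by
      simp [(stdBasis n).norm_eq_one]
    rw [hcard]
    simp only [fderiv_translKernelDeriv hΨ, Finset.mul_sum, ← Finset.sum_add_distrib,
      ← Finset.sum_sub_distrib]
    exact Finset.sum_congr rfl fun i _ => by ring
  rw [hsumt, translKernel, deriv_eulerProfile hΨ1, translKernelDeriv, eulerProfile,
    translArgDeriv, inner_eY, yCoord_eY]
  have h2 : yCoord (Z - X) = yCoord Z - yCoord X := rfl
  rw [h2]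
  field_simp
  ring

/-! ### Generalized convolutions -/

/-- The right-hand derivative suffices, which includes the endpoint `r = 1`. -/
lemma deriv_eq_zero_of_vanishing {f : ℝ → ℝ} (hf : ContDiff ℝ ∞ f) (h : ∀ r, 1 ≤ r → f r = 0)
    (r : ℝ) (hr : 1 ≤ r) : deriv f r = 0 := by
  have h1 := (hf.differentiable (by simp) r).hasDerivAt.hasDerivWithinAt (s := Set.Ici r)
  have h2 : HasDerivWithinAt f 0 (Set.Ici r) r :=
    (hasDerivWithinAt_const r (Set.Ici r) (0 : ℝ)).congr (fun x hx => h x (hr.trans hx)) (h r hr)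
  exact (uniqueDiffWithinAt_Ici r).eq_deriv _ h1 h2

/-- The integral of `u` against the generalized translate of the profile `Φ(l |·|²)` to `X`. -/
def translConv (b : ℝ) (Φ : ℝ → ℝ) (u : Pt n → ℝ) (l : ℝ) (X : Pt n) : ℝ :=
  ∫ p : Pt n × ℝ, u p.1 • translKernel b Φ l X p.1 p.2
    ∂((weightedMeasure n b).prod (gegenbauerMeasure b))

section

variable {b : ℝ} {Φ : ℝ → ℝ} {u : Pt n → ℝ}

lemma ae_prod_mem (hb : -1 < b) : ∀ᵐ p ∂((weightedMeasure n b).prod (gegenbauerMeasure b)),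
    p ∈ Metric.closedBall (0 : Pt n) 1 ×ˢ Set.Icc (-1 : ℝ) 1 := by
  have := isFiniteMeasure_weighted (n := n) hb
  have := isFiniteMeasure_gegenbauer hb
  have h1 : ∀ᵐ X ∂(weightedMeasure n b), X ∈ Metric.closedBall (0 : Pt n) 1 := by
    rw [ae_weighted_iff]
    exact ae_mem_unitBall.mono fun X hX => Metric.ball_subset_closedBall hX
  filter_upwards [Measure.quasiMeasurePreserving_fst.ae h1,
    Measure.quasiMeasurePreserving_snd.ae (ae_gegenbauer_mem_Icc b)] with p h h'
  exact ⟨h, h'⟩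

lemma isCompact_ball_prod : IsCompact (Metric.closedBall (0 : Pt n) 1 ×ˢ Set.Icc (-1 : ℝ) 1) :=
  (isCompact_closedBall _ _).prod isCompact_Icc

lemma integrable_comp_fst (hb : -1 < b) (hu : Integrable u (weightedMeasure n b)) :
    Integrable (fun p : Pt n × ℝ => u p.1) ((weightedMeasure n b).prod (gegenbauerMeasure b)) := by
  have := isFiniteMeasure_weighted (n := n) hb
  have := isFiniteMeasure_gegenbauer hb
  exact hu.comp_fst _

lemma contDiff_translKernel_param (hΦ : ContDiff ℝ ∞ Φ) (b : ℝ) :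
    ContDiff ℝ ∞ fun q : (ℝ × Pt n) × (Pt n × ℝ) =>
      translKernel b Φ q.1.1 q.1.2 q.2.1 q.2.2 :=
  contDiff_translKernel hΦ b (contDiff_fst.comp contDiff_fst) (contDiff_snd.comp contDiff_fst)
    (contDiff_fst.comp contDiff_snd) (contDiff_snd.comp contDiff_snd)

/-- Source of all regularity: `u` is merely integrable, while the kernel is smooth in the scale and
the centre jointly, also across `Σ`. -/
lemma contDiff_translConv (hb : -1 < b) (hu : Integrable u (weightedMeasure n b))
    (hΦ : ContDiff ℝ ∞ Φ) : ContDiff ℝ ∞ fun q : ℝ × Pt n => translConv b Φ u q.1 q.2 :=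
  contDiff_parametric_integral isCompact_ball_prod (ae_prod_mem hb) (integrable_comp_fst hb hu)
    (contDiff_translKernel_param hΦ b)

lemma integrable_translConv (hb : -1 < b) (hu : Integrable u (weightedMeasure n b))
    (hΦ : ContDiff ℝ ∞ Φ) (l : ℝ) (X : Pt n) :
    Integrable (fun p : Pt n × ℝ => u p.1 • translKernel b Φ l X p.1 p.2)
      ((weightedMeasure n b).prod (gegenbauerMeasure b)) :=
  integrable_smul_of_continuous isCompact_ball_prod (ae_prod_mem hb) (integrable_comp_fst hb hu)
    (contDiff_translKernel hΦ b contDiff_const contDiff_const contDiff_fst contDiff_snd).continuous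

lemma translConv_eq (hb : -1 < b) (hu : Integrable u (weightedMeasure n b))
    (hΦ : ContDiff ℝ ∞ Φ) (l : ℝ) (X : Pt n) :
    translConv b Φ u l X = ∫ Z, u Z * transl b Φ l X Z ∂(weightedMeasure n b) := by
  have := isFiniteMeasure_weighted (n := n) hb
  have := isFiniteMeasure_gegenbauer hb
  rw [translConv, integral_prod _ (integrable_translConv hb hu hΦ l X)]
  congr 1; ext Z
  simp only [smul_eq_mul]
  rw [integral_const_mul, transl]

/-- With the factor `l^{N/2}`, `N = n+1+b`, the operator `l d/dl` acts on the average by replacing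
`Φ` with `rΦ' + (N/2)Φ`, the operator that also governs `lap_transl`. -/
lemma hasDerivAt_translConv (hb : -1 < b) (hu : Integrable u (weightedMeasure n b))
    (hΦ : ContDiff ℝ ∞ Φ) {l : ℝ} (hl : 0 < l) (X : Pt n) :
    HasDerivAt (fun l => l ^ ((n + 1 + b) / 2) * translConv b Φ u l X)
      (l ^ ((n + 1 + b) / 2 - 1) * translConv b (eulerProfile n b Φ) u l X) l := by
  have hΦ1 := contDiff_deriv_of_contDiff hΦ
  have hk : ContDiff ℝ ∞ fun q : ℝ × (Pt n × ℝ) => translKernel b Φ q.1 X q.2.1 q.2.2 :=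
    contDiff_translKernel hΦ b contDiff_fst contDiff_const (contDiff_fst.comp contDiff_snd)
      (contDiff_snd.comp contDiff_snd)
  have hd : ContDiff ℝ ∞ fun l => translConv b Φ u l X :=
    contDiff_parametric_integral isCompact_ball_prod (ae_prod_mem hb) (integrable_comp_fst hb hu) hk
  have hfd := fderiv_parametric_integral isCompact_ball_prod (ae_prod_mem hb)
    (integrable_comp_fst hb hu) hk l 1
  have hker : ∀ p : Pt n × ℝ, HasDerivAt (fun l => translKernel b Φ l X p.1 p.2)
      ((1 + b) * (deriv Φ (l * translArg X p.1 p.2) * translArg X p.1 p.2)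
        - 2 * (yCoord X * yCoord p.1) * p.2 * (deriv Φ (l * translArg X p.1 p.2)
          + l * (deriv (deriv Φ) (l * translArg X p.1 p.2) * translArg X p.1 p.2))) l := by
    intro p
    have h0 : HasDerivAt (fun l => l * translArg X p.1 p.2) (translArg X p.1 p.2) l := by
      simpa using (hasDerivAt_id l).mul_const (translArg X p.1 p.2)
    have h1 := ((hΦ.differentiable (by simp) (l * translArg X p.1 p.2)).hasDerivAt.comp l
      h0).const_mul (1 + b)
    have h2 := ((hasDerivAt_id l).const_mul (2 * (yCoord X * yCoord p.1) * p.2)).mul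
      ((hΦ1.differentiable (by simp) (l * translArg X p.1 p.2)).hasDerivAt.comp l h0)
    refine (h1.sub h2).congr_deriv ?_
    simp only [Function.comp, id]
    ring
  have hw := ((hd.differentiable (by simp)) l).hasDerivAt
  have hwd : deriv (fun l => translConv b Φ u l X) l
      = ∫ p : Pt n × ℝ, u p.1 • fderiv ℝ (fun l => translKernel b Φ l X p.1 p.2) l 1
        ∂((weightedMeasure n b).prod (gegenbauerMeasure b)) := by
    rw [← hfd, ← fderiv_apply_one_eq_deriv]; rfl
  have hpow : HasDerivAt (fun l : ℝ => l ^ (((n : ℝ) + 1 + b) / 2))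
      (((n : ℝ) + 1 + b) / 2 * l ^ (((n : ℝ) + 1 + b) / 2 - 1)) l :=
    Real.hasDerivAt_rpow_const (Or.inl hl.ne')
  have hint1 := integrable_translConv hb hu hΦ l X
  have hint2 : Integrable (fun p : Pt n × ℝ =>
      u p.1 • fderiv ℝ (fun l => translKernel b Φ l X p.1 p.2) l 1)
      ((weightedMeasure n b).prod (gegenbauerMeasure b)) := by
    refine integrable_smul_of_continuous isCompact_ball_prod (ae_prod_mem hb)
      (integrable_comp_fst hb hu) ?_
    have hc : Continuous fun p : Pt n × ℝ => translArg X p.1 p.2 :=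
      (contDiff_translArg contDiff_const contDiff_fst contDiff_snd).continuous
    have hy : Continuous fun p : Pt n × ℝ => yCoord p.1 := continuous_yCoord.comp continuous_fst
    have g1 := hΦ1.continuous.comp (continuous_const.mul hc : Continuous fun p => l * _)
    have g2 := (contDiff_deriv_of_contDiff hΦ1).continuous.comp
      (continuous_const.mul hc : Continuous fun p => l * _)
    simp only [Function.comp_def] at g1 g2
    simp only [fderiv_apply_one_eq_deriv, (hker _).deriv]
    fun_prop
  have key : (n + 1 + b) / 2 * translConv b Φ u l X + l * deriv (fun l => translConv b Φ u l X) l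
      = translConv b (eulerProfile n b Φ) u l X := by
    rw [hwd, translConv, translConv, ← integral_const_mul, ← integral_const_mul,
      ← integral_add (hint1.const_mul _) (hint2.const_mul _)]
    congr 1; ext p
    rw [fderiv_apply_one_eq_deriv, (hker p).deriv, translKernel, translKernel,
      deriv_eulerProfile hΦ, eulerProfile]
    simp only [smul_eq_mul]
    ring
  refine (hpow.mul hw).congr_deriv ?_
  rw [← key]
  have : l ^ (((n : ℝ) + 1 + b) / 2) = l ^ (((n : ℝ) + 1 + b) / 2 - 1) * l := by
    rw [← Real.rpow_add_one hl.ne', sub_add_cancel]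
  rw [this]; ring

/-- Up to the factor `4l`, the kernel is `|y|^{-b}L_b` applied to the translate of `Ψ`. That
translate is an even test function, and `‖X‖ + 1/√l < 1` keeps its support inside the ball. -/
lemma translConv_eulerProfile_eq_zero (hb : -1 < b) (hu : IsLHarmonic b u) {Ψ : ℝ → ℝ}
    (hΨ : ContDiff ℝ ∞ Ψ) (h0 : ∀ r, 1 ≤ r → Ψ r = 0) {l : ℝ} (hl : 0 < l) {X : Pt n}
    (hX : ‖X‖ + 1 / √l < 1) : translConv b (eulerProfile n b (deriv Ψ)) u l X = 0 := by
  have := isFiniteMeasure_weighted (n := n) hb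
  have hΨ1 := contDiff_deriv_of_contDiff hΨ
  have hΘ := contDiff_eulerProfile (n := n) hΨ1 b
  have hui : Integrable u (weightedMeasure n b) := by
    obtain ⟨G, hG, -⟩ := hu
    exact hG.1.integrable (by norm_num)
  have hsupp : Function.support (transl b Ψ l X) ⊆ Metric.closedBall 0 (‖X‖ + 1 / √l) := by
    intro Z hZ
    rw [mem_closedBall_zero_iff]
    by_contra! h
    exact hZ (transl_eq_zero h0 (deriv_eq_zero_of_vanishing hΨ h0) hl h.le)
  have hts : tsupport (transl b Ψ l X) ⊆ Metric.closedBall 0 (‖X‖ + 1 / √l) :=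
    closure_minimal hsupp Metric.isClosed_closedBall
  have h := hu.integral_mul_eq_zero hb (contDiff_transl hb hΨ l X)
    (P := fun Z => 4 * l * transl b (eulerProfile n b (deriv Ψ)) l X Z)
    (HasCompactSupport.of_support_subset_isCompact (isCompact_closedBall _ _) hsupp)
    (hts.trans (Metric.closedBall_subset_ball hX)) (transl_reflectY b Ψ l X)
    (continuous_const.mul (contDiff_transl hb hΘ l X).continuous)
    (fun Z hZ => lap_transl hb hΨ l X hZ)
  have e : ∀ Z, u Z * (4 * l * transl b (eulerProfile n b (deriv Ψ)) l X Z)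
      = 4 * l * (u Z * transl b (eulerProfile n b (deriv Ψ)) l X Z) := fun Z => by ring
  simp only [e] at h
  rw [integral_const_mul, ← translConv_eq hb hui hΘ] at h
  exact (mul_eq_zero.1 h).resolve_left (by positivity)

lemma norm_add_one_div_sqrt_lt {X : Pt n} (hX : ‖X‖ < 1) {l : ℝ} (hl : 1 / (1 - ‖X‖) ^ 2 < l) :
    0 < l ∧ ‖X‖ + 1 / √l < 1 := by
  have h1 : 0 < 1 - ‖X‖ := by linarith
  have hl0 : 0 < l := lt_trans (by positivity) hl
  refine ⟨hl0, ?_⟩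
  have h2 : 1 / (1 - ‖X‖) < √l := by
    rw [Real.lt_sqrt (by positivity), div_pow, one_pow]; exact hl
  have h3 : 1 / √l < 1 - ‖X‖ := by
    rw [div_lt_iff₀ (Real.sqrt_pos.2 hl0)]
    rw [div_lt_iff₀ h1] at h2
    linarith
  linarith

/-- The scale-invariant generalized averages of a weak solution do not depend on the scale. -/
lemma rpow_mul_translConv_eq (hb : -1 < b) (hu : IsLHarmonic b u) {Ψ : ℝ → ℝ}
    (hΨ : ContDiff ℝ ∞ Ψ) (h0 : ∀ r, 1 ≤ r → Ψ r = 0) {X : Pt n} (hX : ‖X‖ < 1) {l l' : ℝ}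
    (hl : 1 / (1 - ‖X‖) ^ 2 < l) (hl' : 1 / (1 - ‖X‖) ^ 2 < l') :
    l ^ ((n + 1 + b) / 2) * translConv b (deriv Ψ) u l X
      = l' ^ ((n + 1 + b) / 2) * translConv b (deriv Ψ) u l' X := by
  have := isFiniteMeasure_weighted (n := n) hb
  have hui : Integrable u (weightedMeasure n b) := by
    obtain ⟨G, hG, -⟩ := hu
    exact hG.1.integrable (by norm_num)
  have hd : ∀ m ∈ Set.Ioi (1 / (1 - ‖X‖) ^ 2), HasDerivAt
      (fun l => l ^ (((n : ℝ) + 1 + b) / 2) * translConv b (deriv Ψ) u l X) 0 m := by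
    intro m hm
    obtain ⟨hm0, hm1⟩ := norm_add_one_div_sqrt_lt hX hm
    have h := hasDerivAt_translConv hb hui (contDiff_deriv_of_contDiff hΨ) hm0 X
    rwa [translConv_eulerProfile_eq_zero hb hu hΨ h0 hm0 hm1, mul_zero] at h
  exact isOpen_Ioi.is_const_of_deriv_eq_zero isPreconnected_Ioi
    (fun m hm => (hd m hm).differentiableAt.differentiableWithinAt)
    (fun m hm => (hd m hm).deriv) hl hl'

end

/-! ### The normalizing constant -/

/-- A smooth profile equal to `1` on `(-∞, 0]` and to `0` on `[1, ∞)`. -/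
def baseProfile (r : ℝ) : ℝ := Real.smoothTransition (1 - r)

lemma contDiff_baseProfile : ContDiff ℝ ∞ baseProfile :=
  Real.smoothTransition.contDiff.comp (contDiff_const.sub contDiff_id)

lemma baseProfile_eq_zero (r : ℝ) (hr : 1 ≤ r) : baseProfile r = 0 :=
  Real.smoothTransition.zero_of_nonpos (by linarith)

lemma antitone_baseProfile : Antitone baseProfile := fun r s h =>
  Real.smoothTransition.monotone (by linarith)

lemma deriv_baseProfile_nonpos (r : ℝ) : deriv baseProfile r ≤ 0 :=
  antitone_baseProfile.deriv_nonpos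

lemma exists_deriv_baseProfile_ne_zero : ∃ r ∈ Set.Ioo (0 : ℝ) 1, deriv baseProfile r ≠ 0 := by
  obtain ⟨r, hr, h⟩ := exists_deriv_eq_slope baseProfile (zero_lt_one)
    contDiff_baseProfile.continuous.continuousOn
    (contDiff_baseProfile.differentiable (by simp)).differentiableOn
  refine ⟨r, hr, ?_⟩
  rw [h, baseProfile_eq_zero 1 le_rfl, baseProfile, sub_zero, Real.smoothTransition.one]
  norm_num

lemma translArg_smul (c : ℝ) (X Z : Pt n) (t : ℝ) :
    translArg (c • X) (c • Z) t = c ^ 2 * translArg X Z t := by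
  rw [translArg, translArg, ← smul_sub, norm_smul, mul_pow, Real.norm_eq_abs, sq_abs, yCoord_smul,
    yCoord_smul]
  ring

lemma transl_smul (b : ℝ) (Φ : ℝ → ℝ) (l : ℝ) {c : ℝ} (hc : c ≠ 0) (X Z : Pt n) :
    transl b Φ (l / c ^ 2) (c • X) (c • Z) = transl b Φ l X Z := by
  rw [transl, transl]
  congr 1; ext t
  have h : l / c ^ 2 * translArg (c • X) (c • Z) t = l * translArg X Z t := by
    rw [translArg_smul]; field_simp
  rw [translKernel, translKernel, h, yCoord_smul, yCoord_smul]
  field_simp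

section

variable {b : ℝ} {Φ : ℝ → ℝ}

lemma translConv_one_eq_volume (hb : -1 < b) (hΦ : ContDiff ℝ ∞ Φ) (h0 : ∀ r, 1 ≤ r → Φ r = 0)
    {l : ℝ} (hl : 0 < l) {X : Pt n} (hX : ‖X‖ + 1 / √l < 1) :
    translConv b Φ (fun _ => 1) l X = ∫ Z : Pt n, |yCoord Z| ^ b * transl b Φ l X Z := by
  have := isFiniteMeasure_weighted (n := n) hb
  rw [translConv_eq hb (integrable_const _) hΦ, integral_weighted]
  simp only [one_mul, smul_eq_mul]
  refine integral_ball_eq fun Z hZ => ?_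
  rw [mem_unitBall, not_lt] at hZ
  rw [transl_eq_zero h0 (deriv_eq_zero_of_vanishing hΦ h0) hl (hX.le.trans hZ), mul_zero]

/-- Change of variables `Z ↦ cZ` in the whole space: volume and weight contribute `c^{n+1} c^b =
c^N`, exactly compensating `(l/c²)^{N/2}`. -/
lemma translConv_one_scale (hb : -1 < b) (hΦ : ContDiff ℝ ∞ Φ) (h0 : ∀ r, 1 ≤ r → Φ r = 0)
    {l : ℝ} (hl : 0 < l) {X : Pt n} (hX : ‖X‖ + 1 / √l < 1) {c : ℝ} (hc : 0 < c) (hc1 : c ≤ 1) :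
    (l / c ^ 2) ^ ((n + 1 + b) / 2) * translConv b Φ (fun _ => 1) (l / c ^ 2) (c • X)
      = l ^ ((n + 1 + b) / 2) * translConv b Φ (fun _ => 1) l X := by
  have hl' : 0 < l / c ^ 2 := by positivity
  have hX' : ‖c • X‖ + 1 / √(l / c ^ 2) < 1 := by
    rw [Real.sqrt_div hl.le, Real.sqrt_sq hc.le, norm_smul, Real.norm_of_nonneg hc.le, one_div_div]
    have : c * ‖X‖ + c / √l = c * (‖X‖ + 1 / √l) := by ring
    rw [this]
    have h2 : 0 ≤ ‖X‖ + 1 / √l := by positivity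
    nlinarith
  rw [translConv_one_eq_volume hb hΦ h0 hl' hX', translConv_one_eq_volume hb hΦ h0 hl hX]
  have h := Measure.integral_comp_smul (volume : Measure (Pt n))
    (fun Z => |yCoord Z| ^ b * transl b Φ (l / c ^ 2) (c • X) Z) c
  simp only [transl_smul b Φ l hc.ne', yCoord_smul, abs_mul, abs_of_pos hc,
    Real.mul_rpow hc.le (abs_nonneg _), finrank_euclideanSpace, Fintype.card_fin, smul_eq_mul,
    mul_assoc, integral_const_mul] at h
  rw [abs_of_pos (by positivity)] at h
  have h2 : ∫ Z : Pt n, |yCoord Z| ^ b * transl b Φ (l / c ^ 2) (c • X) Z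
      = c ^ (n + 1) * (c ^ b * ∫ Z : Pt n, |yCoord Z| ^ b * transl b Φ l X Z) := by
    rw [h]; field_simp
  rw [h2, Real.div_rpow hl.le (by positivity), ← mul_assoc, ← mul_assoc]
  congr 1
  have h3 : (c ^ 2) ^ (((n : ℝ) + 1 + b) / 2) = c ^ (n + 1) * c ^ b := by
    rw [← Real.rpow_natCast c 2, ← Real.rpow_mul hc.le, ← Real.rpow_natCast c (n + 1),
      ← Real.rpow_add hc]
    congr 1
    push_cast; ring
  rw [h3]
  have : c ^ b ≠ 0 := (Real.rpow_pos_of_pos hc b).ne'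
  field_simp

end

/-- The normalizing constant of the generalized averages. -/
def avgConst (n : ℕ) (b : ℝ) : ℝ :=
  (4 : ℝ) ^ (((n : ℝ) + 1 + b) / 2) * translConv b (deriv baseProfile) (fun _ => 1) 4 (0 : Pt n)

/-- Independence of the centre: dilation moves `X` to `cX` at scale `l/c²`, the constant solution
allows returning to a fixed scale, and `c → 0` brings the centre to the origin by continuity. -/
lemma rpow_mul_translConv_one {b : ℝ} (hb : -1 < b) {X : Pt n} (hX : ‖X‖ < 1) {l : ℝ}
    (hl : 1 / (1 - ‖X‖) ^ 2 < l) :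
    l ^ ((n + 1 + b) / 2) * translConv b (deriv baseProfile) (fun _ => 1) l X = avgConst n b := by
  have := isFiniteMeasure_weighted (n := n) hb
  have hΦ := contDiff_deriv_of_contDiff contDiff_baseProfile
  have h0 := deriv_eq_zero_of_vanishing contDiff_baseProfile baseProfile_eq_zero
  obtain ⟨hl0, hl1⟩ := norm_add_one_div_sqrt_lt hX hl
  -- The factor `1/(k+2)` puts the centre in the ball of radius `1/2`, where every scale above `4`
  -- is admissible; `16` serves for all `k`.
  have hconst : ∀ k : ℕ, (16 : ℝ) ^ (((n : ℝ) + 1 + b) / 2) *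
      translConv b (deriv baseProfile) (fun _ => 1) 16 ((1 / (k + 2) : ℝ) • X)
      = l ^ ((n + 1 + b) / 2) * translConv b (deriv baseProfile) (fun _ => 1) l X := by
    intro k
    have hc : (0 : ℝ) < 1 / (k + 2) := by positivity
    have hc1 : (1 : ℝ) / (k + 2) ≤ 1 / 2 := by
      apply one_div_le_one_div_of_le <;> linarith [(Nat.cast_nonneg k : (0 : ℝ) ≤ k)]
    have hn : ‖(1 / (k + 2) : ℝ) • X‖ = 1 / (k + 2) * ‖X‖ := by
      rw [norm_smul, Real.norm_of_nonneg hc.le]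
    have hn1 : 1 / (k + 2) * ‖X‖ < 1 / 2 := by nlinarith [norm_nonneg X]
    rw [← translConv_one_scale hb hΦ h0 hl0 hl1 hc (hc1.trans (by norm_num))]
    refine rpow_mul_translConv_eq hb (IsLHarmonic.const hb 1) contDiff_baseProfile
      baseProfile_eq_zero (by rw [hn]; linarith) ?_ ?_
    · rw [hn, div_lt_iff₀ (by nlinarith)]
      nlinarith
    · rw [hn]
      have h1 : (1 - ‖X‖) * (1 / (k + 2)) ≤ (1 - 1 / (k + 2) * ‖X‖) := by
        nlinarith [norm_nonneg X]
      have h2 : 0 < (1 - ‖X‖) * (1 / (k + 2)) := mul_pos (by linarith) hc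
      calc 1 / (1 - 1 / ((k : ℝ) + 2) * ‖X‖) ^ 2 ≤ 1 / ((1 - ‖X‖) * (1 / (k + 2))) ^ 2 :=
            one_div_le_one_div_of_le (by positivity) (pow_le_pow_left₀ h2.le h1 2)
        _ = 1 / (1 - ‖X‖) ^ 2 / (1 / (k + 2)) ^ 2 := by rw [mul_pow, div_div]
        _ < _ := div_lt_div_of_pos_right hl (by positivity)
  have hlim : Tendsto (fun k : ℕ => (16 : ℝ) ^ (((n : ℝ) + 1 + b) / 2) *
      translConv b (deriv baseProfile) (fun _ => 1) 16 ((1 / (k + 2) : ℝ) • X)) atTop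
      (𝓝 ((16 : ℝ) ^ (((n : ℝ) + 1 + b) / 2) *
        translConv b (deriv baseProfile) (fun _ => 1) 16 ((0 : ℝ) • X))) := by
    have hc : Continuous fun c : ℝ => (16 : ℝ) ^ (((n : ℝ) + 1 + b) / 2) *
        translConv b (deriv baseProfile) (fun _ => 1) 16 (c • X) :=
      continuous_const.mul ((contDiff_translConv hb (integrable_const _) hΦ).continuous.comp
        (continuous_const.prodMk (continuous_id.smul continuous_const)))
    refine (hc.tendsto 0).comp ?_
    have := (tendsto_add_atTop_iff_nat 1).2 (tendsto_one_div_add_atTop_nhds_zero_nat (𝕜 := ℝ))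
    refine this.congr fun k => ?_
    push_cast; ring
  simp only [hconst, zero_smul] at hlim
  rw [tendsto_nhds_unique tendsto_const_nhds hlim, avgConst]
  exact rpow_mul_translConv_eq hb (IsLHarmonic.const hb 1) contDiff_baseProfile
    baseProfile_eq_zero (by simp) (by norm_num) (by norm_num)

/-- At the origin the translated kernel is a positive multiple of `Φ(4‖Z‖²)`, with `Φ` the
derivative of the decreasing base profile: it has one sign and is nonzero on an open set. -/
lemma avgConst_ne_zero {b : ℝ} (hb : -1 < b) : avgConst n b ≠ 0 := by
  have := isFiniteMeasure_weighted (n := n) hb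
  have := isFiniteMeasure_gegenbauer hb
  have hΦ := contDiff_deriv_of_contDiff contDiff_baseProfile
  rw [avgConst, translConv_eq hb (integrable_const _) hΦ]
  have e : ∀ Z : Pt n, (1 : ℝ) * transl b (deriv baseProfile) 4 0 Z
      = -((1 + b) * (gegenbauerMeasure b).real Set.univ) * -deriv baseProfile (4 * ‖Z‖ ^ 2) := by
    intro Z
    have h1 : ∀ t, translKernel b (deriv baseProfile) 4 0 Z t
        = (1 + b) * deriv baseProfile (4 * ‖Z‖ ^ 2) := by
      intro t
      have : yCoord (0 : Pt n) = 0 := rfl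
      simp [translKernel, translArg, this]
    rw [transl]
    simp only [h1, integral_const, smul_eq_mul]
    ring
  simp only [e]
  rw [integral_const_mul]
  have hν : (gegenbauerMeasure b).real Set.univ ≠ 0 := by
    rw [measureReal_ne_zero_iff]
    exact fun h => gegenbauer_univ_ne_zero b (Measure.measure_univ_eq_zero.1 h)
  refine mul_ne_zero (by positivity) (mul_ne_zero (neg_ne_zero.2 (mul_ne_zero (by linarith) hν)) ?_)
  have hc : Continuous fun Z : Pt n => -deriv baseProfile (4 * ‖Z‖ ^ 2) :=
    (hΦ.continuous.comp (by fun_prop)).neg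
  intro h
  rw [integral_eq_zero_iff_of_nonneg (fun Z => neg_nonneg.2 (deriv_baseProfile_nonpos _))
    (memLp_one_iff_integrable.1 (memLp_weighted_of_continuous hb hc 1)), EventuallyEq,
    ae_weighted_iff, ballMeasure, ae_restrict_iff' measurableSet_unitBall, ae_iff] at h
  obtain ⟨r, ⟨hr0, hr1⟩, hr⟩ := exists_deriv_baseProfile_ne_zero
  have hopen : IsOpen (unitBall n ∩ {Z : Pt n | -deriv baseProfile (4 * ‖Z‖ ^ 2) ≠ 0}) :=
    Metric.isOpen_ball.inter (isOpen_ne_fun hc continuous_const)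
  have hne : (unitBall n ∩ {Z : Pt n | -deriv baseProfile (4 * ‖Z‖ ^ 2) ≠ 0}).Nonempty := by
    have hn : ‖(√(r / 4)) • eY n‖ = √(r / 4) := by
      rw [norm_smul, norm_eY, mul_one, Real.norm_of_nonneg (Real.sqrt_nonneg _)]
    refine ⟨(√(r / 4)) • eY n, ?_, ?_⟩
    · rw [mem_unitBall, hn, Real.sqrt_lt' one_pos]; linarith
    · change -deriv baseProfile (4 * ‖(√(r / 4)) • eY n‖ ^ 2) ≠ 0
      rw [hn, Real.sq_sqrt (by positivity), mul_div_cancel₀ _ (by norm_num)]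
      exact neg_ne_zero.2 hr
  refine (hopen.measure_pos volume hne).ne' (measure_mono_null ?_ h)
  rintro Z ⟨hZ, hZ'⟩ hh
  exact hZ' (hh hZ)

/-! ### Concentration of the generalized averages and regularity -/

lemma min_sq_norm_sub_le_translArg {X Z : Pt n} {t r : ℝ} (ht : t ∈ Set.Icc (-1 : ℝ) 1)
    (h1 : r ≤ ‖X - Z‖ ^ 2) (h2 : r ≤ ‖X - reflectY Z‖ ^ 2) : r ≤ translArg X Z t := by
  have h4 : ‖X - reflectY Z‖ ^ 2 = ‖X - Z‖ ^ 2 + 4 * (yCoord X * yCoord Z) := by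
    have := translArg_reflectY X Z 1
    simp only [translArg] at this
    linarith
  rw [translArg]
  rcases le_total 0 (yCoord X * yCoord Z) with h | h
  · nlinarith [ht.2]
  · nlinarith [ht.1]

lemma transl_eq_zero_of_far {b : ℝ} {Φ : ℝ → ℝ} (hΦ : ∀ r, 1 ≤ r → Φ r = 0)
    (hΦ' : ∀ r, 1 ≤ r → deriv Φ r = 0) {l : ℝ} (hl : 0 < l) {X Z : Pt n}
    (h1 : 1 / √l ≤ ‖X - Z‖) (h2 : 1 / √l ≤ ‖X - reflectY Z‖) : transl b Φ l X Z = 0 := by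
  refine integral_eq_zero_of_ae ?_
  filter_upwards [ae_gegenbauer_mem_Icc b] with t ht
  refine translKernel_eq_zero hΦ hΦ' ?_
  have h3 := min_sq_norm_sub_le_translArg ht (pow_le_pow_left₀ (by positivity) h1 2)
    (pow_le_pow_left₀ (by positivity) h2 2)
  rw [div_pow, one_pow, Real.sq_sqrt hl.le, div_le_iff₀ hl] at h3
  linarith

lemma exists_abs_le_of_vanishing {f : ℝ → ℝ} (hf : Continuous f) (h : ∀ r, 1 ≤ r → f r = 0) :
    ∃ M : ℝ, 0 ≤ M ∧ ∀ r, 0 ≤ r → |f r| ≤ M := by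
  obtain ⟨M, hM⟩ := (isCompact_Icc (a := (0 : ℝ)) (b := 1)).exists_bound_of_continuousOn
    hf.continuousOn
  refine ⟨M, (norm_nonneg _).trans (hM 0 (by simp)), fun r hr => ?_⟩
  rcases le_total r 1 with h1 | h1
  · exact hM r ⟨hr, h1⟩
  · rw [h r h1, abs_zero]; exact (norm_nonneg _).trans (hM 0 (by simp))

lemma abs_yCoord_sub_le (X Z : Pt n) : |yCoord X - yCoord Z| ≤ ‖X - Z‖ := abs_yCoord_le (X - Z)

/-- Put `s = l y²`. The kernel is `O(s)` and is supported in `1 - t ≤ 1/s`, a set of mass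
`O(s^{-b/2-1})`; the product is `s^{-b/2}`. The condition `s ≥ 4` makes `y y'` comparable to `y²`.
-/
lemma exists_abs_transl_le (n : ℕ) {b : ℝ} (hb : -1 < b) {Φ : ℝ → ℝ} (hΦ : ContDiff ℝ ∞ Φ)
    (h0 : ∀ r, 1 ≤ r → Φ r = 0) : ∃ D : ℝ, 0 ≤ D ∧ ∀ (l : ℝ) (X Z : Pt n), 0 < l →
      4 ≤ l * yCoord X ^ 2 → ‖X - Z‖ ≤ 1 / √l →
      |transl b Φ l X Z| ≤ D * (l * yCoord X ^ 2) ^ (-b / 2) := by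
  have hΦ0 := deriv_eq_zero_of_vanishing hΦ h0
  obtain ⟨M, hM, hM'⟩ := exists_abs_le_of_vanishing hΦ.continuous h0
  obtain ⟨N, hN, hN'⟩ := exists_abs_le_of_vanishing (contDiff_deriv_of_contDiff hΦ).continuous hΦ0
  obtain ⟨C, hC, hC'⟩ := exists_gegenbauer_le hb
  have := isFiniteMeasure_gegenbauer hb
  refine ⟨((1 + b) * M + 3 * N) * C, mul_nonneg (add_nonneg (mul_nonneg (by linarith) hM)
    (by positivity)) hC, fun l X Z hl hy hZ => ?_⟩
  set y := yCoord X with hy_def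
  set s := l * y ^ 2 with hs
  have hs0 : 0 < s := by linarith
  have hsl : (1 / √l) ^ 2 = 1 / l := by rw [div_pow, one_pow, Real.sq_sqrt hl.le]
  have hz : |y - yCoord Z| ≤ |y| / 2 := by
    refine (abs_yCoord_sub_le X Z).trans (hZ.trans ?_)
    refine abs_le_of_sq_le_sq' ?_ (by positivity) |>.2
    rw [hsl, div_pow, sq_abs, div_le_div_iff₀ hl (by norm_num)]
    linarith
  have hyz : |y * (y - yCoord Z)| ≤ y ^ 2 / 2 := by
    rw [abs_mul]
    calc |y| * |y - yCoord Z| ≤ |y| * (|y| / 2) := by gcongr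
      _ = y ^ 2 / 2 := by rw [← sq_abs y]; ring
  have h1 : y ^ 2 / 2 ≤ y * yCoord Z := by nlinarith [(abs_le.1 hyz).2]
  have h2 : y * yCoord Z ≤ 3 / 2 * y ^ 2 := by nlinarith [(abs_le.1 hyz).1]
  have h3 : 0 ≤ y * yCoord Z := le_trans (by positivity) h1
  set S : Set ℝ := {t | 1 - t ≤ 1 / s} with hS
  have hSm : MeasurableSet S := measurableSet_le (measurable_const.sub measurable_id) measurable_const
  have hk : ∀ᵐ t ∂(gegenbauerMeasure b), ‖translKernel b Φ l X Z t‖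
      ≤ S.indicator (fun _ => ((1 + b) * M + 3 * N) * s) t := by
    filter_upwards [ae_gegenbauer_mem_Icc b] with t ht
    have h4 : y ^ 2 * (1 - t) ≤ translArg X Z t := by
      rw [translArg]
      nlinarith [sq_nonneg ‖X - Z‖, mul_le_mul_of_nonneg_right h1 (sub_nonneg.2 ht.2)]
    have h5 : 0 ≤ translArg X Z t := le_trans (mul_nonneg (sq_nonneg _) (sub_nonneg.2 ht.2)) h4
    by_cases htS : t ∈ S
    · rw [Set.indicator_of_mem htS, Real.norm_eq_abs, translKernel]
      have e1 : |(1 + b) * Φ (l * translArg X Z t)| ≤ (1 + b) * M := by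
        rw [abs_mul, abs_of_pos (by linarith : 0 < 1 + b)]
        exact mul_le_mul_of_nonneg_left (hM' _ (by positivity)) (by linarith)
      have e2 : |2 * (y * yCoord Z) * t * l * deriv Φ (l * translArg X Z t)| ≤ 3 * s * N := by
        rw [abs_mul, abs_mul, abs_mul, abs_of_pos hl, abs_of_nonneg (by linarith)]
        refine mul_le_mul ?_ (hN' _ (by positivity)) (abs_nonneg _) (by positivity)
        have : |t| ≤ 1 := abs_le.2 ht
        calc 2 * (y * yCoord Z) * |t| * l ≤ 2 * (3 / 2 * y ^ 2) * 1 * l := by gcongr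
          _ = 3 * s := by rw [hs]; ring
      have e3 := abs_sub ((1 + b) * Φ (l * translArg X Z t))
        (2 * (y * yCoord Z) * t * l * deriv Φ (l * translArg X Z t))
      have e4 : (1 + b) * M ≤ (1 + b) * M * s :=
        le_mul_of_one_le_right (mul_nonneg (by linarith) hM) (by linarith)
      calc _ ≤ _ := e3
        _ ≤ (1 + b) * M * s + 3 * s * N := by linarith
        _ = _ := by ring
    · rw [Set.indicator_of_notMem htS, translKernel_eq_zero h0 hΦ0, norm_zero]
      have h6 : 1 / s < 1 - t := not_le.1 htS
      rw [div_lt_iff₀ hs0] at h6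
      nlinarith [mul_le_mul_of_nonneg_left h4 hl.le]
  have hint : Integrable (S.indicator fun _ : ℝ => ((1 + b) * M + 3 * N) * s)
      (gegenbauerMeasure b) := (integrable_const _).indicator hSm
  have h7 := norm_integral_le_of_norm_le hint hk
  rw [integral_indicator hSm, setIntegral_const, smul_eq_mul] at h7
  have h8 : (gegenbauerMeasure b).real S ≤ C * (1 / s) ^ (b / 2 + 1) :=
    ENNReal.toReal_le_of_le_ofReal (by positivity)
      (hC' (1 / s) (by positivity) (by rw [div_le_one hs0]; linarith))
  have h9 : (1 / s) ^ (b / 2 + 1) * s = s ^ (-b / 2) := by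
    rw [one_div, Real.inv_rpow hs0.le, ← Real.rpow_neg hs0.le]
    nth_rewrite 2 [← Real.rpow_one s]
    rw [← Real.rpow_add hs0]
    congr 1; ring
  have hK : 0 ≤ (1 + b) * M + 3 * N := add_nonneg (mul_nonneg (by linarith) hM) (by positivity)
  rw [← Real.norm_eq_abs]
  calc _ ≤ _ := h7
    _ ≤ C * (1 / s) ^ (b / 2 + 1) * (((1 + b) * M + 3 * N) * s) := by gcongr
    _ = ((1 + b) * M + 3 * N) * C * ((1 / s) ^ (b / 2 + 1) * s) := by ring
    _ = _ := by rw [h9]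

/-- Small balls away from `{y = 0}` have weighted measure comparable to their volume. -/
lemma exists_weighted_closedBall_le (b : ℝ) {X : Pt n} (hX : yCoord X ≠ 0) : ∃ C : ℝ, 0 ≤ C ∧
    ∀ ε, 0 < ε → ε ≤ |yCoord X| / 2 →
      (weightedMeasure n b).real (Metric.closedBall X ε) ≤ C * ε ^ (n + 1) := by
  set y := yCoord X
  have hy : 0 < |y| := abs_pos.2 hX
  set W : ℝ := (|y| / 2) ^ b + (2 * |y|) ^ b with hW
  have hW0 : 0 ≤ W := by positivity
  refine ⟨W * (volume : Measure (Pt n)).real (Metric.ball 0 1), by positivity, fun ε hε hε' => ?_⟩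
  have hw : ∀ Z ∈ Metric.closedBall X ε, |yCoord Z| ^ b ≤ W := by
    intro Z hZ
    have h1 : |yCoord Z - y| ≤ |y| / 2 :=
      (abs_yCoord_sub_le Z X).trans ((mem_closedBall_iff_norm.1 hZ).trans hε')
    have h2 : |y| / 2 ≤ |yCoord Z| := by
      have := abs_sub_abs_le_abs_sub y (yCoord Z)
      rw [abs_sub_comm] at this; linarith
    have h3 : |yCoord Z| ≤ 2 * |y| := by
      have := abs_sub_abs_le_abs_sub (yCoord Z) y
      linarith
    rcases le_total 0 b with h | h
    · have := Real.rpow_le_rpow (abs_nonneg _) h3 h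
      have : 0 ≤ (|y| / 2) ^ b := by positivity
      linarith
    · have := Real.rpow_le_rpow_of_nonpos (by positivity) h2 h
      have : 0 ≤ (2 * |y|) ^ b := by positivity
      linarith
  refine ENNReal.toReal_le_of_le_ofReal (by positivity) ?_
  rw [weightedMeasure, withDensity_apply _ Metric.isClosed_closedBall.measurableSet]
  calc ∫⁻ Z in Metric.closedBall X ε, ENNReal.ofReal (|yCoord Z| ^ b) ∂(ballMeasure n)
      ≤ ∫⁻ _ in Metric.closedBall X ε, ENNReal.ofReal W ∂(ballMeasure n) :=
        setLIntegral_mono' Metric.isClosed_closedBall.measurableSet fun Z hZ =>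
          ENNReal.ofReal_le_ofReal (hw Z hZ)
    _ = ENNReal.ofReal W * ballMeasure n (Metric.closedBall X ε) := by rw [setLIntegral_const]
    _ ≤ ENNReal.ofReal W * volume (Metric.closedBall X ε) := by
        gcongr; exact Measure.restrict_le_self
    _ = ENNReal.ofReal (W * (volume : Measure (Pt n)).real (Metric.ball 0 1) * ε ^ (n + 1)) := by
        rw [Measure.addHaar_closedBall _ _ hε.le, finrank_euclideanSpace_fin, mul_assoc,
          ENNReal.ofReal_mul hW0, mul_comm ((volume : Measure (Pt n)).real _),
          ENNReal.ofReal_mul (by positivity), ofReal_measureReal]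

lemma IsLHarmonic.integrable {b : ℝ} (hb : -1 < b) {u : Pt n → ℝ} (hu : IsLHarmonic b u) :
    Integrable u (weightedMeasure n b) := by
  have := isFiniteMeasure_weighted (n := n) hb
  obtain ⟨G, hG, -⟩ := hu
  exact hG.1.integrable (by norm_num)

lemma measurableEmbedding_reflectY : MeasurableEmbedding (reflectY : Pt n → Pt n) := by
  rw [← coe_reflectEquiv]
  exact (reflectEquiv n).toHomeomorph.measurableEmbedding

lemma integral_comp_reflectY_weighted (b : ℝ) (p : Pt n → ℝ) :
    ∫ Z, p (reflectY Z) ∂(weightedMeasure n b) = ∫ Z, p Z ∂(weightedMeasure n b) :=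
  (measurePreserving_reflectY_weighted b).integral_comp measurableEmbedding_reflectY p

lemma integrable_comp_reflectY_weighted {b : ℝ} {p : Pt n → ℝ}
    (hp : Integrable p (weightedMeasure n b)) :
    Integrable (fun Z => p (reflectY Z)) (weightedMeasure n b) :=
  (measurePreserving_reflectY_weighted b).integrable_comp_of_integrable hp

/-- The translate lives on two balls, around `X` and around its reflection. Evenness of `w` makes
their contributions equal, whence the factor `2`. -/
lemma abs_integral_mul_transl_le {b : ℝ} {Φ : ℝ → ℝ} (hΦ : ContDiff ℝ ∞ Φ)
    (h0 : ∀ r, 1 ≤ r → Φ r = 0) {w : Pt n → ℝ} (hw : Integrable w (weightedMeasure n b))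
    (hs : ∀ᵐ Z ∂(weightedMeasure n b), w (reflectY Z) = w Z) {l : ℝ} (hl : 0 < l) {X : Pt n}
    {K : ℝ} (hK : ∀ Z, ‖X - Z‖ ≤ 1 / √l → |transl b Φ l X Z| ≤ K) :
    |∫ Z, w Z * transl b Φ l X Z ∂(weightedMeasure n b)|
      ≤ 2 * K * ∫ Z in Metric.closedBall X (1 / √l), ‖w Z‖ ∂(weightedMeasure n b) := by
  set B := Metric.closedBall X (1 / √l) with hB
  have hBm : MeasurableSet B := Metric.isClosed_closedBall.measurableSet
  have hmem : ∀ Z, Z ∈ B ↔ ‖X - Z‖ ≤ 1 / √l := fun Z => by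
    rw [mem_closedBall_iff_norm, norm_sub_rev]
  have hK0 : 0 ≤ K := (abs_nonneg _).trans (hK X (by simp))
  let p : Pt n → ℝ := B.indicator fun Z => ‖w Z‖
  have hp : Integrable p (weightedMeasure n b) := hw.norm.indicator hBm
  have hpR : Integrable (fun Z => p (reflectY Z)) (weightedMeasure n b) :=
    integrable_comp_reflectY_weighted hp
  have hpR' : ∫ Z, p (reflectY Z) ∂(weightedMeasure n b) = ∫ Z, p Z ∂(weightedMeasure n b) :=
    integral_comp_reflectY_weighted b p
  have hp0 : ∀ Z, 0 ≤ p Z := fun Z => Set.indicator_nonneg (fun _ _ => norm_nonneg _) _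
  have hbound : ∀ᵐ Z ∂(weightedMeasure n b), ‖w Z * transl b Φ l X Z‖
      ≤ K * (p Z + p (reflectY Z)) := by
    filter_upwards [hs] with Z hZ
    rw [norm_mul, Real.norm_eq_abs (transl b Φ l X Z)]
    by_cases h1 : Z ∈ B
    · have e1 : p Z = ‖w Z‖ := Set.indicator_of_mem h1 _
      have := mul_le_mul_of_nonneg_left (hK Z ((hmem Z).1 h1)) (norm_nonneg (w Z))
      rw [e1]
      nlinarith [mul_nonneg hK0 (hp0 (reflectY Z))]
    by_cases h2 : reflectY Z ∈ B
    · have e1 : p (reflectY Z) = ‖w Z‖ := by rw [← hZ]; exact Set.indicator_of_mem h2 _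
      have := mul_le_mul_of_nonneg_left (hK _ ((hmem _).1 h2)) (norm_nonneg (w Z))
      rw [transl_reflectY] at this
      rw [e1]
      nlinarith [mul_nonneg hK0 (hp0 Z)]
    · rw [hmem] at h1 h2
      rw [transl_eq_zero_of_far h0 (deriv_eq_zero_of_vanishing hΦ h0) hl (not_le.1 h1).le
        (not_le.1 h2).le, abs_zero, mul_zero]
      exact mul_nonneg hK0 (add_nonneg (hp0 _) (hp0 _))
  have h := norm_integral_le_of_norm_le ((hp.add hpR).const_mul K) hbound
  simp only [Pi.add_apply] at h
  rw [integral_const_mul, integral_add hp hpR, hpR', integral_indicator hBm] at h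
  rw [← Real.norm_eq_abs]
  linarith

/-- The left side does not depend on `l`. At scale `l = ε^{-2}` its distance to `avgConst n b * u X`
is at most a constant times the mean of `|u - u(X)|` over the ball of radius `ε`, which tends to
zero at Lebesgue points. The exceptional null set does not depend on `l`. -/
lemma ae_rpow_mul_translConv_eq {b : ℝ} (hb : -1 < b) {u : Pt n → ℝ} (hu : IsLHarmonic b u)
    (hs : IsSymmetricInY u) : ∀ᵐ X ∂(ballMeasure n), ∀ l, 1 / (1 - ‖X‖) ^ 2 < l →
      l ^ ((n + 1 + b) / 2) * translConv b (deriv baseProfile) u l X = avgConst n b * u X := by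
  have := isFiniteMeasure_weighted (n := n) hb
  have hui := hu.integrable hb
  have hΦ := contDiff_deriv_of_contDiff contDiff_baseProfile
  have hΦ0 := deriv_eq_zero_of_vanishing contDiff_baseProfile baseProfile_eq_zero
  obtain ⟨D, hD, hD'⟩ := exists_abs_transl_le n hb hΦ hΦ0
  have hL := (ae_weighted_iff b).1 ((Besicovitch.vitaliFamily
    (weightedMeasure n b)).ae_tendsto_average_norm_sub hui.locallyIntegrable)
  filter_upwards [hL, ae_yCoord_ne_zero, ae_mem_unitBall] with X hX hy hX1 l hl
  rw [mem_unitBall] at hX1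
  obtain ⟨C, hC, hC'⟩ := exists_weighted_closedBall_le b hy
  have hlim := (hX.comp (Besicovitch.tendsto_filterAt (weightedMeasure n b) X)).const_mul
    (2 * (D * |yCoord X| ^ (-b)) * C)
  rw [mul_zero] at hlim
  have hy0 : 0 < |yCoord X| := abs_pos.2 hy
  have key : ∀ ε, 0 < ε → ε ≤ |yCoord X| / 2 → ε < 1 - ‖X‖ →
      |l ^ (((n : ℝ) + 1 + b) / 2) * translConv b (deriv baseProfile) u l X - avgConst n b * u X|
        ≤ 2 * (D * |yCoord X| ^ (-b)) * C *
          ⨍ Z in Metric.closedBall X ε, ‖u Z - u X‖ ∂(weightedMeasure n b) := by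
    intro ε hε hε1 hε2
    set m : ℝ := (1 / ε) ^ 2 with hm
    have hm0 : 0 < m := by positivity
    have hmε : 1 / √m = ε := by
      rw [hm, Real.sqrt_sq (by positivity), one_div_one_div]
    have hml : 1 / (1 - ‖X‖) ^ 2 < m := by
      rw [hm, div_pow, one_pow]
      exact one_div_lt_one_div_of_lt (by positivity) (pow_lt_pow_left₀ hε2 hε.le (by norm_num))
    have hmpow : ∀ c : ℝ, m ^ (c / 2) = ε ^ (-c) := by
      intro c
      rw [hm, ← Real.rpow_natCast, ← Real.rpow_mul (by positivity), one_div,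
        Real.inv_rpow hε.le, ← Real.rpow_neg hε.le]
      congr 1; push_cast; ring
    rw [rpow_mul_translConv_eq hb hu contDiff_baseProfile baseProfile_eq_zero hX1 hl hml,
      ← rpow_mul_translConv_one hb hX1 hml, translConv_eq hb hui hΦ,
      translConv_eq hb (integrable_const 1) hΦ]
    have hcont : Continuous (transl b (deriv baseProfile) m X) := (contDiff_transl hb hΦ m X).continuous
    have hmem : ∀ᵐ Z ∂(weightedMeasure n b), Z ∈ Metric.closedBall (0 : Pt n) 1 :=
      (ae_weighted_iff b).2 (ae_mem_unitBall.mono fun _ h => Metric.ball_subset_closedBall h)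
    have hint : ∀ {w : Pt n → ℝ}, Integrable w (weightedMeasure n b) → Integrable
        (fun Z => w Z * transl b (deriv baseProfile) m X Z) (weightedMeasure n b) := fun hw =>
      integrable_smul_of_continuous (isCompact_closedBall _ _) hmem hw hcont
    have hsplit : ∫ Z, (u Z - u X) * transl b (deriv baseProfile) m X Z ∂(weightedMeasure n b)
        = ∫ Z, u Z * transl b (deriv baseProfile) m X Z ∂(weightedMeasure n b)
          - u X * ∫ Z, 1 * transl b (deriv baseProfile) m X Z ∂(weightedMeasure n b) := by
      rw [← integral_const_mul, ← integral_sub]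
      · congr 1; ext Z; ring
      · exact hint hui
      · exact (hint (integrable_const 1)).const_mul _
    have e1 : m ^ (((n : ℝ) + 1 + b) / 2) *
        ∫ Z, u Z * transl b (deriv baseProfile) m X Z ∂(weightedMeasure n b)
        - m ^ (((n : ℝ) + 1 + b) / 2) *
          (∫ Z, 1 * transl b (deriv baseProfile) m X Z ∂(weightedMeasure n b)) * u X
        = m ^ (((n : ℝ) + 1 + b) / 2) *
          ∫ Z, (u Z - u X) * transl b (deriv baseProfile) m X Z ∂(weightedMeasure n b) := by
      rw [hsplit]; ring
    rw [e1, abs_mul, abs_of_pos (by positivity)]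
    have hms : m * yCoord X ^ 2 = (|yCoord X| / ε) ^ 2 := by rw [hm, div_pow, div_pow, sq_abs]; ring
    have h4 : 4 ≤ m * yCoord X ^ 2 := by
      rw [hms]
      have : 2 ≤ |yCoord X| / ε := by rw [le_div_iff₀ hε]; linarith
      nlinarith
    have hbd := abs_integral_mul_transl_le hΦ hΦ0 (w := fun Z => u Z - u X)
      (hui.sub (integrable_const _))
      ((ae_weighted_iff b).2 (hs.mono fun Z hZ => by rw [hZ])) hm0 (X := X)
      (fun Z hZ => hD' m X Z hm0 h4 hZ)
    rw [hmε] at hbd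
    set I := ∫ Z in Metric.closedBall X ε, ‖u Z - u X‖ ∂(weightedMeasure n b) with hI
    have hIavg : I = (weightedMeasure n b).real (Metric.closedBall X ε) *
        ⨍ Z in Metric.closedBall X ε, ‖u Z - u X‖ ∂(weightedMeasure n b) := by
      have := measure_smul_setAverage (μ := weightedMeasure n b) (fun Z => ‖u Z - u X‖)
        (s := Metric.closedBall X ε) (measure_ne_top _ _)
      rw [hI, ← this, smul_eq_mul]
    have havg : 0 ≤ ⨍ Z in Metric.closedBall X ε, ‖u Z - u X‖ ∂(weightedMeasure n b) := by
      rw [setAverage_eq]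
      exact smul_nonneg (by positivity) (integral_nonneg fun _ => norm_nonneg _)
    -- Normalization, kernel bound and ball volume contribute `ε^{-(n+1+b)}`, `ε^b` and `ε^{n+1}`,
    -- so every power of `ε` cancels.
    have hpow : m ^ (((n : ℝ) + 1 + b) / 2) * (m * yCoord X ^ 2) ^ (-b / 2) * ε ^ (n + 1)
        = |yCoord X| ^ (-b) := by
      rw [Real.mul_rpow hm0.le (by positivity), hmpow, hmpow, ← sq_abs (yCoord X),
        ← Real.rpow_natCast |yCoord X| 2, ← Real.rpow_mul hy0.le, ← Real.rpow_natCast ε (n + 1)]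
      have : ε ^ (-((n : ℝ) + 1 + b)) * ε ^ (-(-b)) * ε ^ (((n + 1 : ℕ)) : ℝ) = 1 := by
        rw [← Real.rpow_add hε, ← Real.rpow_add hε]
        convert Real.rpow_zero ε using 2
        push_cast; ring
      calc _ = (ε ^ (-((n : ℝ) + 1 + b)) * ε ^ (-(-b)) * ε ^ (((n + 1 : ℕ)) : ℝ))
            * |yCoord X| ^ (((2 : ℕ) : ℝ) * (-b / 2)) := by ring
        _ = |yCoord X| ^ (-b) := by rw [this, one_mul]; congr 1; push_cast; ring
    have hP : 0 ≤ m ^ (((n : ℝ) + 1 + b) / 2) := by positivity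
    have hQ : 0 ≤ (m * yCoord X ^ 2) ^ (-b / 2) := by positivity
    calc _ ≤ m ^ (((n : ℝ) + 1 + b) / 2) * (2 * (D * (m * yCoord X ^ 2) ^ (-b / 2)) * I) := by
          gcongr
      _ ≤ m ^ (((n : ℝ) + 1 + b) / 2) * (2 * (D * (m * yCoord X ^ 2) ^ (-b / 2)) *
          (C * ε ^ (n + 1) * ⨍ Z in Metric.closedBall X ε, ‖u Z - u X‖ ∂(weightedMeasure n b))) := by
          rw [hIavg]
          have := hC' ε hε hε1
          gcongr
      _ = 2 * (D * (m ^ (((n : ℝ) + 1 + b) / 2) * (m * yCoord X ^ 2) ^ (-b / 2) * ε ^ (n + 1))) * C *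
          ⨍ Z in Metric.closedBall X ε, ‖u Z - u X‖ ∂(weightedMeasure n b) := by ring
      _ = _ := by rw [hpow]
  have hle : |l ^ (((n : ℝ) + 1 + b) / 2) * translConv b (deriv baseProfile) u l X
      - avgConst n b * u X| ≤ 0 := by
    refine ge_of_tendsto hlim ?_
    have hδ : 0 < min (|yCoord X| / 2) (1 - ‖X‖) := lt_min (by positivity) (by linarith)
    filter_upwards [Ioo_mem_nhdsGT hδ] with ε hε
    exact key ε hε.1 (hε.2.le.trans (min_le_left _ _)) (hε.2.trans_le (min_le_right _ _))
  exact sub_eq_zero.1 (abs_eq_zero.1 (le_antisymm hle (abs_nonneg _)))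

/-- Symmetric `L_b`-harmonic functions have smooth representatives. -/
theorem exists_contDiffOn_of_isLHarmonic {b : ℝ} (hb : -1 < b) {u : Pt n → ℝ}
    (hu : IsLHarmonic b u) (hs : IsSymmetricInY u) :
    ∃ f : Pt n → ℝ, ContDiffOn ℝ ∞ f (unitBall n) ∧ f =ᵐ[ballMeasure n] u := by
  have hΦ := contDiff_deriv_of_contDiff contDiff_baseProfile
  have hpos : ∀ X ∈ unitBall n, 0 < 1 - ‖X‖ ^ 2 := fun X hX => by
    rw [mem_unitBall] at hX
    nlinarith [norm_nonneg X]
  -- A smooth choice of admissible scale: `1 - ‖X‖² < 2(1 - ‖X‖)` gives `L X > 1/(1 - ‖X‖)²`, and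
  -- the squared norm, unlike the norm, is smooth at the origin.
  set L : Pt n → ℝ := fun X => 4 / (1 - ‖X‖ ^ 2) ^ 2 with hL
  have hLc : ContDiffOn ℝ ∞ L (unitBall n) := by
    refine contDiffOn_const.div ((contDiff_const.sub (contDiff_norm_sq ℝ)).pow 2).contDiffOn ?_
    intro X hX
    exact pow_ne_zero _ (hpos X hX).ne'
  have hL0 : ∀ X ∈ unitBall n, 0 < L X := fun X hX => div_pos (by norm_num) (pow_pos (hpos X hX) 2)
  refine ⟨fun X => L X ^ ((n + 1 + b) / 2) * translConv b (deriv baseProfile) u (L X) X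
    / avgConst n b, ?_, ?_⟩
  · refine ContDiffOn.div_const ?_ _
    refine (hLc.rpow_const_of_ne fun X hX => (hL0 X hX).ne').mul ?_
    exact (contDiff_translConv hb (hu.integrable hb) hΦ).comp_contDiffOn
      (hLc.prodMk contDiffOn_id)
  · filter_upwards [ae_rpow_mul_translConv_eq hb hu hs, ae_mem_unitBall] with X hX hX1
    have h1 := hpos X hX1
    rw [mem_unitBall] at hX1
    rw [hX, mul_div_cancel_left₀ _ (avgConst_ne_zero hb)]
    have h2 : 0 < 1 - ‖X‖ := by linarith
    rw [hL, div_lt_div_iff₀ (by positivity) (by positivity)]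
    nlinarith [norm_nonneg X, mul_pos h2 h2]

end WeightedHarmonic

end

open WeightedHarmonic
theorem proposition2p2 (n : ℕ) (a : ℝ) (ha₁ : -1 < a) (ha₂ : a < 1) :
    (∀ u : WeightedHarmonic.Pt n → ℝ,
      WeightedHarmonic.IsLHarmonic a u → WeightedHarmonic.IsAntisymmetricInY u →
      ∃ v : WeightedHarmonic.Pt n → ℝ,
        (WeightedHarmonic.IsLHarmonic (2 - a) v ∧ WeightedHarmonic.IsSymmetricInY v ∧
          ∀ᵐ X ∂(WeightedHarmonic.ballMeasure n),
            u X = v X * WeightedHarmonic.oddPower a X) ∧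
        ∀ v' : WeightedHarmonic.Pt n → ℝ,
          WeightedHarmonic.IsLHarmonic (2 - a) v' → WeightedHarmonic.IsSymmetricInY v' →
          (∀ᵐ X ∂(WeightedHarmonic.ballMeasure n),
            u X = v' X * WeightedHarmonic.oddPower a X) →
          v' =ᵐ[WeightedHarmonic.ballMeasure n] v) ∧
    (∀ u : WeightedHarmonic.Pt n → ℝ, WeightedHarmonic.IsLHarmonic a u →
      ∃ f g : WeightedHarmonic.Pt n → ℝ,
        (WeightedHarmonic.IsLHarmonic a f ∧ WeightedHarmonic.IsLHarmonic (2 - a) g ∧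
          WeightedHarmonic.IsSymmetricInY f ∧ WeightedHarmonic.IsSymmetricInY g ∧
          ContDiffOn ℝ ∞ f (WeightedHarmonic.unitBall n) ∧
          ContDiffOn ℝ ∞ g (WeightedHarmonic.unitBall n) ∧
          ∀ᵐ X ∂(WeightedHarmonic.ballMeasure n),
            u X = f X + g X * WeightedHarmonic.oddPower a X) ∧
        ∀ f' g' : WeightedHarmonic.Pt n → ℝ,
          WeightedHarmonic.IsLHarmonic a f' → WeightedHarmonic.IsLHarmonic (2 - a) g' →
          WeightedHarmonic.IsSymmetricInY f' → WeightedHarmonic.IsSymmetricInY g' →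
          (∀ᵐ X ∂(WeightedHarmonic.ballMeasure n),
            u X = f' X + g' X * WeightedHarmonic.oddPower a X) →
          f' =ᵐ[WeightedHarmonic.ballMeasure n] f ∧
            g' =ᵐ[WeightedHarmonic.ballMeasure n] g) := by
  -- Uniqueness of the quotient is purely pointwise: `y|y|^{-a}` is nonzero off the null set `Σ`.
  have hdiv : ∀ {u w : Pt n → ℝ}, (∀ᵐ X ∂(ballMeasure n), u X = w X * oddPower a X) →
      w =ᵐ[ballMeasure n] divOdd a u := by
    intro u w h
    filter_upwards [h, ae_yCoord_ne_zero] with X hX hy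
    exact mul_right_cancel₀ (oddPower_ne_zero hy) (by rw [divOdd_mul_oddPower hy, hX])
  constructor
  · intro u hu ho
    refine ⟨divOdd a u, ⟨isLHarmonic_divOdd ha₁ ha₂ hu ho, isSymmetricInY_divOdd ho, ?_⟩,
      fun v' _ _ h => hdiv h⟩
    filter_upwards [ae_yCoord_ne_zero] with X hX
    rw [divOdd_mul_oddPower hX]
  · intro u hu
    have hR := measurePreserving_reflectY_ball (n := n)
    set e : Pt n → ℝ := fun X => (1 / 2) * u X + (1 / 2) * u (reflectY X) with he
    set o : Pt n → ℝ := fun X => (1 / 2) * u X + (-1 / 2) * u (reflectY X) with ho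
    have heH : IsLHarmonic a e :=
      (hu.const_mul (1 / 2)).add ha₁ (hu.reflect.const_mul (1 / 2))
    have hoH : IsLHarmonic a o :=
      (hu.const_mul (1 / 2)).add ha₁ (hu.reflect.const_mul (-1 / 2))
    have heS : IsSymmetricInY e := Eventually.of_forall fun X => by
      simp only [he, reflectY_reflectY]; ring
    have hoA : IsAntisymmetricInY o := Eventually.of_forall fun X => by
      simp only [ho, reflectY_reflectY]; ring
    have hsymm : ∀ {f w : Pt n → ℝ}, f =ᵐ[ballMeasure n] w → IsSymmetricInY w →
        IsSymmetricInY f := by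
      intro f w h hw
      filter_upwards [h, hw, hR.quasiMeasurePreserving.ae h] with X h1 h2 h3
      rw [h3, h2, h1]
    have hdH := isLHarmonic_divOdd ha₁ ha₂ hoH hoA
    have hdS : IsSymmetricInY (divOdd a o) := isSymmetricInY_divOdd hoA
    obtain ⟨f, hf, hfe⟩ := exists_contDiffOn_of_isLHarmonic ha₁ heH heS
    obtain ⟨g, hg, hgo⟩ := exists_contDiffOn_of_isLHarmonic (by linarith) hdH hdS
    refine ⟨f, g, ⟨heH.congr hfe, hdH.congr hgo, hsymm hfe heS, hsymm hgo hdS, hf, hg, ?_⟩, ?_⟩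
    · filter_upwards [hfe, hgo, ae_yCoord_ne_zero] with X h1 h2 h3
      rw [h1, h2, divOdd_mul_oddPower h3]
      simp only [he, ho]; ring
    · intro f' g' _ _ hf' hg' h
      -- Adding and subtracting the decomposition and its reflection identifies `f'` with the even
      -- part of `u` and `g' y|y|^{-a}` with the odd part; the equations of `f'` and `g'` play no
      -- role.
      have hu' : ∀ᵐ X ∂(ballMeasure n), e X = f' X ∧ o X = g' X * oddPower a X := by
        filter_upwards [h, hR.quasiMeasurePreserving.ae h, hf', hg'] with X h1 h2 h3 h4
        rw [h3, h4, oddPower_reflectY] at h2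
        simp only [he, ho, h1, h2]
        constructor <;> ring
      refine ⟨?_, (hdiv (hu'.mono fun X hX => hX.2)).trans hgo.symm⟩
      filter_upwards [hu', hfe] with X h1 h2
      rw [h2, h1.1]
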